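/- Let $K$ be a knot, $D$ a diagram of $K$ with $n_+$ positive and $n_-$ negative crossings, and $R$ a commutative ring. For $h\in R$ let $A_h=R[x]/(x^2-hx)$ with comultiplication $\Delta(1)=1\otimes x+x\otimes 1-h\,1\otimes 1$, $\Delta(x)=x\otimes x$. The cube of smoothings of $D$ gives a cochain complex whose standard generators are smoothings with a label $1$ or $x$ on every circle. A generator with $r$ $1$-smoothings has homological degree $r-n_-$ and $q$-degree $\#\{\text{labels }1\}-\#\{\text{labels }x\}+r+n_+-2n_-$. For $h=0$ this is the Khovanov complex, with cohomology $H^{i,q}_{\mathrm{Kh}}(K;R)$; for $h=1$ it is the Bar-Natan complex $C_{\mathrm{BN}}$, with cohomology $H^{i}_{\mathrm{BN}}(K;R)$, filtered by the subcomplexes $\mathcal F_q$ spanned by the generators of $q$-degree at least $q$. Reduced Khovanov homology $\tilde H^{i,q}_{\mathrm{Kh}}(K;R)$ is the cohomology of the subcomplex of the Khovanov complex spanned by the generators with label $x$ on the circle through a base point of $D$, with $q$-degree shifted up by $1$. Write $i\colon H^0(\mathcal F_q;\mathbb F_2)\to H^0_{\mathrm{BN}}(K;\mathbb F_2)$ and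 $p\colon H^0(\mathcal F_q;\mathbb F_2)\to H^0(\mathcal F_q/\mathcal F_{q+2};\mathbb F_2)=H^{0,q}_{\mathrm{Kh}}(K;\mathbb F_2)$ for the natural maps, and let $\mathrm{Sq}^1\colon H^{-1,q}_{\mathrm{Kh}}(K;\mathbb F_2)\to H^{0,q}_{\mathrm{Kh}}(K;\mathbb F_2)$ be the first Steenrod square, i.e. the Bockstein homomorphism of $0\to\mathbb Z/2\to\mathbb Z/4\to\mathbb Z/2\to0$. Rasmussen's invariant over $\mathbb F_2$ is $$s^{\mathbb F_2}(K)=\max\{q \text{ odd}\mid \operatorname{im}(i\colon H^0(\mathcal F_q;\mathbb F_2)\to H^0_{\mathrm{BN}}(K;\mathbb F_2))\neq0\}-1 .$$ An odd integer $q$ is called $\mathrm{Sq}^1$-full if there are $a,b\in H^0(\mathcal F_q;\mathbb F_2)$ such that $p(a)$ and $p(b)$ are in the image of $\mathrm{Sq}^1$ and $i(a),i(b)$ generate $H^0_{\mathrm{BN}}(K;\mathbb F_2)$, and the Lipshitz–Sarkar refinement is $$s^{\mathrm{Sq}^1}_+(K)=\max\{q\text{ odd}\mid q\text{ is }\mathrm{Sq}^1\text{-full}\}+3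 .$$ **Theorem.** Both maxima exist. Let $s=s^{\mathbb F_2}(K)$. 1. If $\tilde H^{0,q}_{\mathrm{Kh}}(K;\mathbb Z)$ contains no $2$-torsion for $q=s$ and $q=s-2$, then $s^{\mathrm{Sq}^1}_+(K)=s$. 2. If for some integer $c\ge 0$ (for example the crossing number of $K$) $K$ is $1$-thin in degrees $-c$ to $c$, meaning that all non-trivial groups $\tilde H^{i,q}_{\mathrm{Kh}}(K;\mathbb Z)$ with $-c\le i\le c$ lie on a single diagonal $q-2i=\delta$ and are torsion free, then $s^{\mathrm{Sq}^1}_+(K)=s$. In particular, this holds for every $1$-thin knot $K$. -/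

import Mathlib

noncomputable section

/-- An oriented knot diagram on a closed oriented surface, given by its signed Gauss code.  Following
the knot once around, one passes crossings `2 * n` times; the edge number `t` ends, and the next edge
in the cyclic order starts, at the passage number `t`.  The crossing `k` is passed on the over-strand
at `overPassage k` and on the under-strand at `underPassage k`.  A diagram without crossings is one
closed edge.  Knot diagrams in the plane (or the sphere) are the codes that are planar, see
`SignedGaussCode.IsPlanar` below. -/
structure SignedGaussCode where
  /-- the number of crossings -/
  n : ℕ
  /-- whether a crossing is positive (right-handed) or negative -/
  positive : Fin n → Bool
  /-- the over-passage of a crossing -/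
  overPassage : Fin n → Fin (max 1 (2 * n))
  /-- the under-passage of a crossing -/
  underPassage : Fin n → Fin (max 1 (2 * n))
  /-- every passage belongs to one crossing, either as over-passage or as under-passage -/
  passage_injective : Function.Injective (Sum.elim overPassage underPassage)

namespace SignedGaussCode

variable (D : SignedGaussCode)

/-- The edges of the diagram. -/
abbrev Edge : Type := Fin (max 1 (2 * D.n))

/-- The edge that follows a given edge in the orientation of the knot. -/
def next (e : D.Edge) : D.Edge := finRotate _ e

/-- The edges at a crossing: incoming and outgoing, over and under. -/
def overIn (k : Fin D.n) : D.Edge := D.overPassage k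

/-- The outgoing over-edge. -/
def overOut (k : Fin D.n) : D.Edge := D.next (D.overPassage k)

/-- The incoming under-edge. -/
def underIn (k : Fin D.n) : D.Edge := D.underPassage k

/-- The outgoing under-edge. -/
def underOut (k : Fin D.n) : D.Edge := D.next (D.underPassage k)

/-- Draw the crossing with both strands pointing upwards.  The strand from the lower right to the
upper left is the under-strand at a positive crossing, the over-strand at a negative one. -/
def leftwardIn (k : Fin D.n) : D.Edge := if D.positive k then D.underIn k else D.overIn k

/-- The outgoing (upper left) edge of the strand from the lower right to the upper left. -/
def leftwardOut (k : Fin D.n) : D.Edge := if D.positive k then D.underOut k else D.overOut k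

/-- The incoming (lower left) edge of the strand from the lower left to the upper right. -/
def rightwardIn (k : Fin D.n) : D.Edge := if D.positive k then D.overIn k else D.underIn k

/-- The outgoing (upper right) edge of the strand from the lower left to the upper right. -/
def rightwardOut (k : Fin D.n) : D.Edge := if D.positive k then D.overOut k else D.underOut k

/-- `(e, true)` is the left side and `(e, false)` the right side of the oriented edge `e`.  Two
sides are related if they bound the same one of the four corners (east, north, west, south) at some
crossing. -/
inductive SameCorner : D.Edge × Bool → D.Edge × Bool → Prop
  | east (k : Fin D.n) : SameCorner (D.leftwardIn k, false) (D.rightwardOut k, false)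
  | north (k : Fin D.n) : SameCorner (D.rightwardOut k, true) (D.leftwardOut k, false)
  | west (k : Fin D.n) : SameCorner (D.leftwardOut k, true) (D.rightwardIn k, true)
  | south (k : Fin D.n) : SameCorner (D.rightwardIn k, false) (D.leftwardIn k, true)

/-- The regions of the diagram on its (closed, oriented) carrier surface. -/
abbrev Region : Type := Quot D.SameCorner

/-- The carrier surface is a sphere: its Euler characteristic
`n - 2 * n + (number of regions)` equals `2`. -/
def IsPlanar : Prop := Nat.card D.Region = D.n + 2

/-! ### The cube of smoothings -/

/-- The vertices of the cube; `false` stands for the `0`-smoothing, `true` for the `1`-smoothing. -/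
abbrev Vertex : Type := Fin D.n → Bool

/-- Two edges are joined by an arc of the smoothing `v`.  The smoothing that respects the
orientation of the knot is the `0`-smoothing of a positive and the `1`-smoothing of a negative
crossing. -/
inductive Joined (v : D.Vertex) : D.Edge → D.Edge → Prop
  | oriented₁ (k : Fin D.n) (h : v k = !D.positive k) : Joined v (D.underIn k) (D.overOut k)
  | oriented₂ (k : Fin D.n) (h : v k = !D.positive k) : Joined v (D.overIn k) (D.underOut k)
  | unoriented₁ (k : Fin D.n) (h : v k = D.positive k) : Joined v (D.underIn k) (D.overIn k)
  | unoriented₂ (k : Fin D.n) (h : v k = D.positive k) : Joined v (D.underOut k) (D.overOut k)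

/-- The circles of the smoothing `v`. -/
abbrev Circle (v : D.Vertex) : Type := Quot (D.Joined v)

instance (v : D.Vertex) : Fintype (D.Circle v) := Fintype.ofFinite _

/-- The circle through an edge. -/
def circleOf (v : D.Vertex) (e : D.Edge) : D.Circle v := Quot.mk _ e

/-- The standard generators: a smoothing together with a label on each of its circles, where
`false` stands for the basis element `1` and `true` for the basis element `x` of `A`. -/
abbrev Gen : Type := Σ v : D.Vertex, (D.Circle v → Bool)

instance : Fintype D.Gen := Fintype.ofFinite _

variable {D} in
/-- The label of the circle through an edge. -/
def Gen.label (g : D.Gen) (e : D.Edge) : Bool := g.2 (D.circleOf g.1 e)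

/-- The number of positive crossings. -/
def nPlus : ℕ := (Finset.univ.filter fun k => D.positive k = true).card

/-- The number of negative crossings. -/
def nMinus : ℕ := (Finset.univ.filter fun k => D.positive k = false).card

variable {D} in
/-- The number of `1`-smoothings. -/
def Gen.height (g : D.Gen) : ℕ := (Finset.univ.filter fun k => g.1 k = true).card

variable {D} in
/-- The homological degree. -/
def Gen.hdeg (g : D.Gen) : ℤ := (g.height : ℤ) - D.nMinus

variable {D} in
/-- The quantum degree, where `1` has degree `1` and `x` has degree `-1`. -/
def Gen.qdeg (g : D.Gen) : ℤ :=
  ((Finset.univ.filter fun c => g.2 c = false).card : ℤ)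
    - (Finset.univ.filter fun c => g.2 c = true).card
    + g.height + D.nPlus - 2 * D.nMinus

end SignedGaussCode

/-! ### The Frobenius algebra `A = R[x] / (x ^ 2 - h * x)`

`h = 0` gives Khovanov homology, `h = 1` gives the Bar-Natan complex. -/

/-- The coefficient of `x ^ c` in `x ^ a * x ^ b` (`false` is `1`, `true` is `x`):
`1 * 1 = 1`, `1 * x = x * 1 = x`, `x * x = h * x`. -/
def frobeniusMul {R : Type*} [CommRing R] (h : R) : Bool → Bool → Bool → R
  | false, false, false => 1
  | false, true, true => 1
  | true, false, true => 1
  | true, true, true => h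
  | _, _, _ => 0

/-- The coefficient of `x ^ b ⊗ x ^ c` in `Δ (x ^ a)`:
`Δ 1 = 1 ⊗ x + x ⊗ 1 - h * (1 ⊗ 1)`, `Δ x = x ⊗ x`. -/
def frobeniusComul {R : Type*} [CommRing R] (h : R) : Bool → Bool → Bool → R
  | false, false, true => 1
  | false, true, false => 1
  | false, false, false => -h
  | true, true, true => 1
  | _, _, _ => 0

namespace SignedGaussCode

variable (D : SignedGaussCode)

open Classical in
/-- The coefficient of `g'` in the image of `g` along the edge of the cube that changes the
smoothing at the crossing `k`.  At `k` both smoothings have two arcs, one through `underIn k` and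
one through `underOut k`.  If these lie on two circles of the smoothing of `g`, the circles are
merged, otherwise the one circle is split; the labels of all other circles stay. -/
def edgeCoeff {R : Type*} [CommRing R] (h : R) (k : Fin D.n) (g g' : D.Gen) : R :=
  if g.1 k = false ∧ g'.1 = Function.update g.1 k true ∧
      ∀ e : D.Edge, D.circleOf g.1 e ≠ D.circleOf g.1 (D.underIn k) →
        D.circleOf g.1 e ≠ D.circleOf g.1 (D.underOut k) → g'.label e = g.label e then
    (-1) ^ (Finset.univ.filter fun j => j < k ∧ g.1 j = true).card *
      (if D.circleOf g.1 (D.underIn k) = D.circleOf g.1 (D.underOut k) then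
        frobeniusComul h (g.label (D.underIn k)) (g'.label (D.underIn k)) (g'.label (D.underOut k))
      else
        frobeniusMul h (g.label (D.underIn k)) (g.label (D.underOut k)) (g'.label (D.underIn k)))
  else 0

/-- The differential on the free `R`-module on the standard generators. -/
def differential {R : Type*} [CommRing R] (h : R) : (D.Gen → R) →ₗ[R] (D.Gen → R) :=
  Matrix.mulVecLin (Matrix.of fun g' g => ∑ k, D.edgeCoeff h k g g')

/-- The span of the standard generators with property `P`. -/
def cochains (R : Type*) [CommRing R] (P : D.Gen → Prop) : Submodule R (D.Gen → R) where
  carrier := {f | ∀ g, ¬ P g → f g = 0}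
  add_mem' := fun ha hb g hg => by simp [ha g hg, hb g hg]
  zero_mem' := fun _ _ => rfl
  smul_mem' := fun r f hf g hg => by simp [hf g hg]

/-- The cocycles of homological degree `i` in the subcomplex spanned by the generators with
property `P`. -/
def cocycles {R : Type*} [CommRing R] (h : R) (P : D.Gen → Prop) (i : ℤ) :
    Submodule R (D.Gen → R) :=
  D.cochains R (fun g => g.hdeg = i ∧ P g) ⊓ LinearMap.ker (D.differential h)

/-- The coboundaries of homological degree `i` in the subcomplex spanned by the generators with
property `P`. -/
def coboundaries {R : Type*} [CommRing R] (h : R) (P : D.Gen → Prop) (i : ℤ) :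
    Submodule R (D.Gen → R) :=
  (D.cochains R (fun g => g.hdeg = i - 1 ∧ P g)).map (D.differential h)

/-- The cohomology in homological degree `i` of the subcomplex spanned by the generators with
property `P`. -/
abbrev Cohomology {R : Type*} [CommRing R] (h : R) (P : D.Gen → Prop) (i : ℤ) : Type _ :=
  ↥(D.cocycles h P i) ⧸ (D.coboundaries h P i).submoduleOf (D.cocycles h P i)

theorem cocycles_mono {R : Type*} [CommRing R] (h : R) {P Q : D.Gen → Prop}
    (hPQ : ∀ g, P g → Q g) (i : ℤ) : D.cocycles h P i ≤ D.cocycles h Q i :=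
  fun _ hf => ⟨fun g hg => hf.1 g fun hP => hg ⟨hP.1, hPQ g hP.2⟩, hf.2⟩

theorem coboundaries_mono {R : Type*} [CommRing R] (h : R) {P Q : D.Gen → Prop}
    (hPQ : ∀ g, P g → Q g) (i : ℤ) : D.coboundaries h P i ≤ D.coboundaries h Q i :=
  Submodule.map_mono fun _ hf g hg => hf g fun hP => hg ⟨hP.1, hPQ g hP.2⟩

/-- The map on cohomology induced by an inclusion of subcomplexes. -/
def inclusionMap {R : Type*} [CommRing R] (h : R) {P Q : D.Gen → Prop}
    (hPQ : ∀ g, P g → Q g) (i : ℤ) : D.Cohomology h P i →ₗ[R] D.Cohomology h Q i :=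
  Submodule.mapQ _ _ (Submodule.inclusion (D.cocycles_mono h hPQ i))
    fun _ hx => D.coboundaries_mono h hPQ i hx

/-! ### Khovanov and Bar-Natan cohomology -/

/-- Khovanov homology `H_Kh^{i,q}(D; R)`. -/
abbrev Kh (R : Type*) [CommRing R] (i q : ℤ) : Type _ :=
  D.Cohomology (0 : R) (fun g => g.qdeg = q) i

/-- Reduced Khovanov homology with respect to a base point on the edge `b`: the cohomology of the
subcomplex spanned by the generators with label `x` on the circle through the base point, with
quantum degree shifted by `1`. -/
abbrev ReducedKh (b : D.Edge) (R : Type*) [CommRing R] (i q : ℤ) : Type _ :=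
  D.Cohomology (0 : R) (fun g => g.label b = true ∧ g.qdeg + 1 = q) i

/-- Bar-Natan cohomology `H_BN^i(D; R)`. -/
abbrev BN (R : Type*) [CommRing R] (i : ℤ) : Type _ :=
  D.Cohomology (1 : R) (fun _ => True) i

/-- The cohomology `H^i(F_q; R)` of the step `F_q`, spanned by the generators of quantum degree at
least `q`, in the filtration of the Bar-Natan complex. -/
abbrev FilteredBN (R : Type*) [CommRing R] (i q : ℤ) : Type _ :=
  D.Cohomology (1 : R) (fun g => q ≤ g.qdeg) i

/-- The map `H^i(F_q; R) → H_BN^i(D; R)`. -/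
def toBN (R : Type*) [CommRing R] (i q : ℤ) : D.FilteredBN R i q →ₗ[R] D.BN R i :=
  D.inclusionMap 1 (fun _ _ => trivial) i

/-- The induced filtration `H_BN^i(D; R)_q` on Bar-Natan cohomology. -/
def inducedFiltration (R : Type*) [CommRing R] (i q : ℤ) : Submodule R (D.BN R i) :=
  LinearMap.range (D.toBN R i q)

/-- The odd `q` with `H_BN^0(D; F)_q ≠ 0`. -/
def nonzeroLevels (F : Type*) [Field F] : Set ℤ :=
  {q | Odd q ∧ D.inducedFiltration F 0 q ≠ ⊥}

/-- Rasmussen's invariant over the field `F`, that is `s_max - 1`. -/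
def rasmussenInvariant (F : Type*) [Field F] : ℤ := sSup (D.nonzeroLevels F) - 1

/-! ### The refinement by the first Steenrod square -/

/-- The graph of the map `p : H^i(F_q; R) → H^i(F_q / F_{q+2}; R) = H_Kh^{i,q}(D; R)`, which takes
the part of quantum degree `q` of a cocycle. -/
def IsLeadingPart (R : Type*) [CommRing R] (i q : ℤ) (a : D.FilteredBN R i q)
    (y : D.Kh R i q) : Prop :=
  ∃ (z : D.cocycles (1 : R) (fun g => q ≤ g.qdeg) i)
    (w : D.cocycles (0 : R) (fun g => g.qdeg = q) i),
    Submodule.Quotient.mk z = a ∧ Submodule.Quotient.mk w = y ∧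
      ∀ g : D.Gen, g.qdeg = q → w.1 g = z.1 g

/-- The graph of the first Steenrod square
`Sq¹ : H_Kh^{i-1,q}(D; F₂) → H_Kh^{i,q}(D; F₂)`, the Bockstein homomorphism of
`0 → ℤ/2 → ℤ/4 → ℤ/2 → 0`: lift a cocycle to an integral cochain `c`, write its coboundary as
`2 * w`, and reduce `w` modulo `2`. -/
def IsSqOne (i q : ℤ) (a : D.Kh (ZMod 2) (i - 1) q) (y : D.Kh (ZMod 2) i q) : Prop :=
  ∃ (z : D.cocycles (0 : ZMod 2) (fun g => g.qdeg = q) (i - 1))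
    (u : D.cocycles (0 : ZMod 2) (fun g => g.qdeg = q) i)
    (c w : D.Gen → ℤ),
    Submodule.Quotient.mk z = a ∧ Submodule.Quotient.mk u = y ∧
      c ∈ D.cochains ℤ (fun g => g.hdeg = i - 1 ∧ g.qdeg = q) ∧
      w ∈ D.cochains ℤ (fun g => g.hdeg = i ∧ g.qdeg = q) ∧
      D.differential (0 : ℤ) c = (2 : ℤ) • w ∧
      (∀ g, (c g : ZMod 2) = z.1 g) ∧ (∀ g, (w g : ZMod 2) = u.1 g)

/-- `p(a) = Sq¹(ã)` for some `ã` in `H_Kh^{-1,q}(D; F₂)`. -/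
def LeadingPartInSqOne (q : ℤ) (a : D.FilteredBN (ZMod 2) 0 q) : Prop :=
  ∃ (ta : D.Kh (ZMod 2) (0 - 1) q) (y : D.Kh (ZMod 2) 0 q),
    D.IsLeadingPart (ZMod 2) 0 q a y ∧ D.IsSqOne 0 q ta y

/-- The odd integers `q` that are `Sq¹`-full. -/
def sqOneFullLevels : Set ℤ :=
  {q | Odd q ∧ ∃ a b : D.FilteredBN (ZMod 2) 0 q,
    D.LeadingPartInSqOne q a ∧ D.LeadingPartInSqOne q b ∧
      Submodule.span (ZMod 2) {D.toBN (ZMod 2) 0 q a, D.toBN (ZMod 2) 0 q b} = ⊤}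

/-- The refinement `s_+^{Sq¹}`. -/
def sqOneRefinement : ℤ := sSup D.sqOneFullLevels + 3

/-! ### Conditions on reduced integral Khovanov homology -/

/-- There is no `2`-torsion in `H̃_Kh^{i,q}(D; ℤ)`. -/
def NoTwoTorsion (b : D.Edge) (i q : ℤ) : Prop :=
  ∀ y : D.ReducedKh b ℤ i q, (2 : ℤ) • y = 0 → y = 0

/-- `m`-thin in degrees `k` to `l`: the non-trivial groups `H̃_Kh^{i,q}(D; ℤ)` with `k ≤ i ≤ l` lie
on `m` adjacent diagonals `q - 2 * i = δ, δ + 2, …, δ + 2 * (m - 1)` and are torsion free. -/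
def IsThinInDegrees (b : D.Edge) (m : ℕ) (k l : ℤ) : Prop :=
  (∃ δ : ℤ, ∀ i q : ℤ, k ≤ i → i ≤ l → Nontrivial (D.ReducedKh b ℤ i q) →
    ∃ j : ℕ, j < m ∧ q - 2 * i = δ + 2 * j) ∧
  ∀ i q : ℤ, k ≤ i → i ≤ l → ∀ (r : ℤ) (y : D.ReducedKh b ℤ i q), r • y = 0 → r = 0 ∨ y = 0

end SignedGaussCode

end

/-! ### Connectedness of the knot along the cyclic order of its edges -/

noncomputable section

/-! Write the differential as `d₀ + h d₁`, where `d₀` is Khovanov's and `d₁` raises the quantum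
degree by 2. Let `X` be multiplication by `x` at the base point for `h = 0`, `P` the projection to
the generators labelled `x` there, and `ν` the derivation `x ↦ 1` in all labels. Over `ℤ`, `X`
commutes with `d₀`, and `d₀ ν = ν d₀ + 2 d₁`, `ν X = X ν + 1 - 2 P`.

Let `w` have degree `q` and `2 w = d₀ c`, so that `w` represents a value of Sq¹ modulo 2. Kernel and
image of `X` are both the reduced complex. Without 2-torsion in reduced degree `q - 1`, `X w` is a
reduced coboundary, and changing `w` by a coboundary (and `c` accordingly) achieves `X w = 0`. Then
`m = X c` is a `d₀`-cocycle, and the identities give `2 (w - d₁ m) = d₀ (2 P c - X ν c)` inside the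
reduced complex. Without 2-torsion in reduced degree `q + 1` this yields `w = d₀ t + d₁ m`
(`exists_eq_add_of_differential_eq_two_smul`). Modulo 2 this is the leading part of the Bar-Natan
coboundary of `t + m`, so a class of `F_q` whose leading part lies in the image of Sq¹ has the same
Bar-Natan class as one from `F_{q+2}` (`exists_cocycle_of_leadingPartInSqOne`).

Over `𝔽₂`, Bar-Natan homology in degree 0 is a plane, with one coordinate for each of two opposite
colourings of the oriented smoothing (`valuesBN`). The substitution `x ↦ x + 1` exchanges the
coordinates and is the identity up to terms of filtration 2 higher; multiplication by `x` kills one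
coordinate and lowers the filtration by at most 2. Hence the image of `F_q` is nonzero at `q = s +
1` but not beyond, is everything at `s - 1`, and is not everything at `s + 1`. So `s - 3` is
Sq¹-full and nothing above `s - 1` is; if `s - 1` were full, the torsion hypotheses would make the
image of `F_{s+1}` everything.

The algebraic identities come from evaluating labels at the roots `0`, `h` of `x² = h x`: for `h ≠
0` a cochain becomes a function on coloured smoothings, and the differential does not mix colourings
(`evalAt_differential`). Comparing powers of `h` over `ℤ` then reaches `h = 0`. All this requires
every edge of the cube to merge or split circles, which follows from planarity through Gauss's
parity condition (`exists_alternating`). -/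

theorem eq_of_comp_finRotate {m : ℕ} {α : Type*} (f : Fin m → α)
    (h : ∀ e, f (finRotate m e) = f e) (a b : Fin m) : f a = f b := by
  obtain _ | m := m
  · exact a.elim0
  · have key : ∀ (k : ℕ) (hk : k < m + 1), f ⟨k, hk⟩ = f 0 := by
      intro k
      induction k with
      | zero => intro hk; rfl
      | succ k ih =>
        intro hk
        rw [← ih (by omega), ← h ⟨k, by omega⟩, finRotate_of_lt (by omega)]
    rw [key a a.2, key b b.2]

namespace SignedGaussCode

variable (D : SignedGaussCode)

theorem eq_of_comp_next {α : Type*} (f : D.Edge → α) (h : ∀ e, f (D.next e) = f e)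
    (a b : D.Edge) : f a = f b :=
  eq_of_comp_finRotate f h a b

theorem passage_bijective (hn : 0 < D.n) :
    Function.Bijective (Sum.elim D.overPassage D.underPassage) := by
  rw [Fintype.bijective_iff_injective_and_card]
  refine ⟨D.passage_injective, ?_⟩
  simp
  omega

/-- Every edge ends at exactly one passage if there are crossings; otherwise there is only one edge.
-/
theorem eq_of_comp_out {α : Type*} (f : D.Edge → α)
    (h : ∀ k, f (D.overOut k) = f (D.overIn k) ∧ f (D.underOut k) = f (D.underIn k))
    (a b : D.Edge) : f a = f b := by
  rcases Nat.eq_zero_or_pos D.n with hn | hn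
  · have : Subsingleton D.Edge := by
      have : max 1 (2 * D.n) = 1 := by omega
      unfold Edge
      rw [this]
      infer_instance
    rw [Subsingleton.elim a b]
  · refine D.eq_of_comp_next f (fun e => ?_) a b
    obtain ⟨k | k, rfl⟩ := (D.passage_bijective hn).2 e
    · exact (h k).1
    · exact (h k).2

/-! ### Checkerboard colourings of planar diagrams -/

/-- The boundary map from regions to edges, modulo `2`. -/
def regionBoundary : (D.Region → ZMod 2) →ₗ[ZMod 2] (D.Edge → ZMod 2) where
  toFun f e := f (Quot.mk _ (e, true)) + f (Quot.mk _ (e, false))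
  map_add' f g := by ext e; simp; ring
  map_smul' r f := by ext e; simp; ring

/-- The boundary map from edges to crossings, modulo `2`. -/
def edgeBoundary : Matrix (Fin D.n) D.Edge (ZMod 2) := fun k e =>
  (if D.overIn k = e then 1 else 0) + (if D.underIn k = e then 1 else 0) +
    ((if D.overOut k = e then 1 else 0) + (if D.underOut k = e then 1 else 0))

theorem edgeBoundary_mulVec (y : D.Edge → ZMod 2) (k : Fin D.n) :
    D.edgeBoundary.mulVec y k =
      y (D.overIn k) + y (D.underIn k) + (y (D.overOut k) + y (D.underOut k)) := by
  simp [Matrix.mulVec, dotProduct, edgeBoundary, add_mul, Finset.sum_add_distrib]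

theorem region_corner (k : Fin D.n) (f : D.Region → ZMod 2) :
    f (Quot.mk _ (D.leftwardIn k, false)) = f (Quot.mk _ (D.rightwardOut k, false)) ∧
    f (Quot.mk _ (D.rightwardOut k, true)) = f (Quot.mk _ (D.leftwardOut k, false)) ∧
    f (Quot.mk _ (D.leftwardOut k, true)) = f (Quot.mk _ (D.rightwardIn k, true)) ∧
    f (Quot.mk _ (D.rightwardIn k, false)) = f (Quot.mk _ (D.leftwardIn k, true)) :=
  ⟨congrArg f (Quot.sound (.east k)), congrArg f (Quot.sound (.north k)),
    congrArg f (Quot.sound (.west k)), congrArg f (Quot.sound (.south k))⟩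

/-- The eight edge sides at a crossing pair off into four corners, so every value occurs twice. -/
theorem edgeBoundary_regionBoundary (f : D.Region → ZMod 2) :
    D.edgeBoundary.mulVec (D.regionBoundary f) = 0 := by
  ext k
  obtain ⟨h1, h2, h3, h4⟩ := D.region_corner k f
  have h2x : ∀ x : ZMod 2, x + x = 0 := by decide
  rw [edgeBoundary_mulVec]
  simp only [regionBoundary, LinearMap.coe_mk, AddHom.coe_mk, Pi.zero_apply]
  simp only [leftwardIn, leftwardOut, rightwardIn, rightwardOut] at h1 h2 h3 h4
  cases hp : D.positive k <;> simp only [hp, if_true, if_false, Bool.false_eq_true] at h1 h2 h3 h4 <;>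
    rw [h1, h2, h3, h4] <;> ring_nf <;> simp [show (2 : ZMod 2) = 0 from rfl]

/-- A function with equal values on both sides of each edge keeps its value through every crossing,
so it is constant along the knot, and every region borders an edge. -/
theorem finrank_ker_regionBoundary : Module.finrank (ZMod 2) (LinearMap.ker D.regionBoundary) ≤ 1 := by
  have h2x : ∀ x y : ZMod 2, x + y = 0 → x = y := by decide
  refine (Submodule.finrank_mono (t := Submodule.span (ZMod 2) {fun _ : D.Region => 1}) ?_).trans
    ((finrank_span_le_card _).trans (by simp))
  intro f hf
  have hs : ∀ e, f (Quot.mk _ (e, true)) = f (Quot.mk _ (e, false)) := fun e =>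
    h2x _ _ (congrFun (LinearMap.mem_ker.1 hf) e)
  have hc := D.eq_of_comp_out (fun e => f (Quot.mk _ (e, false))) (fun k => by
    obtain ⟨h1, h2, h3, h4⟩ := D.region_corner k f
    have a1 := hs (D.overIn k)
    have a2 := hs (D.overOut k)
    have a3 := hs (D.underIn k)
    have a4 := hs (D.underOut k)
    simp only [leftwardIn, leftwardOut, rightwardIn, rightwardOut] at h1 h2 h3 h4
    cases hp : D.positive k <;>
      simp only [hp, if_true, if_false, Bool.false_eq_true] at h1 h2 h3 h4 <;>
      constructor <;> simp_all)
  let e0 : D.Edge := ⟨0, by omega⟩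
  refine Submodule.mem_span_singleton.2 ⟨f (Quot.mk _ (e0, false)), ?_⟩
  ext r
  obtain ⟨⟨e, s⟩, rfl⟩ := Quot.exists_rep r
  cases s
  · simpa using hc e0 e
  · simpa [hs] using hc e0 e

/-- A kernel element takes equal values at both ends of every edge, and the knot passes through all
crossings. -/
theorem finrank_ker_edgeBoundary_transpose (hn : 0 < D.n) :
    Module.finrank (ZMod 2) (LinearMap.ker D.edgeBoundary.transpose.mulVecLin) ≤ 1 := by
  have h2x : ∀ x y : ZMod 2, x + y = 0 → x = y := by decide
  refine (Submodule.finrank_mono (t := Submodule.span (ZMod 2) {fun _ : Fin D.n => 1}) ?_).trans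
    ((finrank_span_le_card _).trans (by simp))
  intro g hg
  have hg' : ∀ e, ((∑ k, if D.overIn k = e then g k else 0) +
      ∑ k, if D.underIn k = e then g k else 0) =
      (∑ k, if D.overOut k = e then g k else 0) +
      ∑ k, if D.underOut k = e then g k else 0 := by
    intro e
    apply h2x
    have := congrFun (LinearMap.mem_ker.1 hg) e
    simpa [Matrix.vecMul, dotProduct, edgeBoundary, mul_add, Finset.sum_add_distrib] using this
  let E := Equiv.ofBijective _ (D.passage_bijective hn)
  -- The value of `g` at the crossing where the edge `e` ends.
  let c : D.Edge → ZMod 2 := fun e => Sum.elim g g (E.symm e)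
  have hin : ∀ e, ((∑ k, if D.overIn k = e then g k else 0) +
      ∑ k, if D.underIn k = e then g k else 0) = c e := by
    intro e
    have : ∑ x : Fin D.n ⊕ Fin D.n, (if E x = e then Sum.elim g g x else 0) = c e := by
      simp only [← Equiv.eq_symm_apply]
      simp [c]
    rw [← this, Fintype.sum_sum_type]
    rfl
  have hc : ∀ e, c (D.next e) = c e := by
    intro e
    rw [← hin (D.next e), hg', ← hin e]
    have hinj : ∀ a b, D.next a = D.next b ↔ a = b := fun a b => (finRotate _).injective.eq_iff
    simp only [overOut, underOut, hinj, overIn, underIn]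
    rfl
  let k0 : Fin D.n := ⟨0, hn⟩
  have hcE : ∀ k, c (D.overPassage k) = g k := fun k => by
    have : E.symm (D.overPassage k) = Sum.inl k := by
      rw [Equiv.symm_apply_eq]; rfl
    simp [c, this]
  refine Submodule.mem_span_singleton.2 ⟨g k0, ?_⟩
  ext k
  simpa [hcE] using D.eq_of_comp_next c hc (D.overPassage k0) (D.overPassage k)

/-- The first homology of the sphere modulo 2 vanishes, by counting dimensions: with `n + 2` regions
the range has dimension at least `n + 1`, while the edge boundary has rank at least `n - 1` on a
space of dimension `2 n`. -/
theorem range_regionBoundary (hD : D.IsPlanar) (hn : 0 < D.n) :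
    LinearMap.range D.regionBoundary = LinearMap.ker D.edgeBoundary.mulVecLin := by
  apply Submodule.eq_of_le_of_finrank_le
  · rintro _ ⟨f, rfl⟩
    exact D.edgeBoundary_regionBoundary f
  · have h1 := LinearMap.finrank_range_add_finrank_ker D.regionBoundary
    have h2 := LinearMap.finrank_range_add_finrank_ker D.edgeBoundary.mulVecLin
    have h3 := LinearMap.finrank_range_add_finrank_ker D.edgeBoundary.transpose.mulVecLin
    have h4 := D.edgeBoundary.rank_transpose
    have h5 := D.finrank_ker_regionBoundary
    have h6 := D.finrank_ker_edgeBoundary_transpose hn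
    unfold Matrix.rank at h4
    have : Fintype D.Region := Fintype.ofFinite _
    unfold IsPlanar at hD
    rw [Nat.card_eq_fintype_card] at hD
    rw [Module.finrank_fintype_fun_eq_card] at h1 h2 h3
    rw [Fintype.card_fin] at h2 h3
    have : max 1 (2 * D.n) = 2 * D.n := by omega
    omega

/-- Gauss's parity condition: on a planar diagram the edges can be coloured so that the colours
alternate along the knot, and the two strands at every crossing have opposite colours. -/
theorem exists_alternating (hD : D.IsPlanar) : ∃ χ : D.Edge → Bool, ∀ k,
    χ (D.overOut k) = !χ (D.overIn k) ∧ χ (D.underOut k) = !χ (D.underIn k) ∧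
      χ (D.underIn k) = !χ (D.overIn k) := by
  rcases Nat.eq_zero_or_pos D.n with hn | hn
  · exact ⟨fun _ => false, fun k => absurd k.2 (by omega)⟩
  -- Four edge ends meet at each crossing, so the sum of all edges is a cycle. A region function
  -- bounding it is a checkerboard colouring.
  have h1 : (fun _ => 1 : D.Edge → ZMod 2) ∈ LinearMap.range D.regionBoundary := by
    rw [D.range_regionBoundary hD hn, LinearMap.mem_ker]
    ext k
    simp only [Matrix.mulVecLin_apply, edgeBoundary_mulVec]
    rfl
  obtain ⟨f, hf⟩ := h1
  have hs : ∀ e, f (Quot.mk _ (e, true)) = 1 + f (Quot.mk _ (e, false)) := by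
    have : ∀ x y : ZMod 2, x + y = 1 → x = 1 + y := by decide
    exact fun e => this _ _ (congrFun hf e)
  -- An edge receives the checkerboard colour of the region on its right.
  refine ⟨fun e => decide (f (Quot.mk _ (e, false)) = 0), fun k => ?_⟩
  obtain ⟨h1, h2, h3, h4⟩ := D.region_corner k f
  have key : ∀ a b c d : ZMod 2, a = b → 1 + b = c → 1 + c = 1 + d → d = 1 + a →
      (decide (c = 0) = !decide (a = 0) ∧ decide (b = 0) = !decide (d = 0) ∧
        decide (a = 0) = !decide (d = 0)) := by decide
  rw [hs] at h2 h3 h4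
  rw [hs] at h3
  obtain ⟨k1, k2, k3⟩ := key _ _ _ _ h1 h2 h3 h4
  unfold leftwardIn leftwardOut rightwardIn rightwardOut at *
  cases hp : D.positive k <;> simp only [hp, if_true, if_false, Bool.false_eq_true] at k1 k2 k3
  · exact ⟨k1, k2, by simp only [k3, Bool.not_not]⟩
  · exact ⟨k2, k1, k3⟩

end SignedGaussCode
end

noncomputable section

/-! ### The parity of the number of orbits of a permutation -/

theorem Equiv.Perm.sameCycle_iff_quot {α : Type*} (σ : Equiv.Perm α) (a b : α) :
    σ.SameCycle a b ↔
      (Quot.mk (fun x y => σ x = y) a : Quot fun x y => σ x = y) = Quot.mk _ b := by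
  have step : ∀ x, (Quot.mk _ (σ x) : Quot fun x y => σ x = y) = Quot.mk _ x := fun x =>
    (Quot.sound (r := fun x y => σ x = y) rfl).symm
  constructor
  · rintro ⟨i, rfl⟩
    induction i with
    | zero => rfl
    | succ i ih =>
      rw [ih, add_comm, zpow_add, zpow_one, Equiv.Perm.mul_apply, step]
    | pred i ih =>
      rw [ih, ← step ((σ ^ (-(i : ℤ) - 1)) a), ← Equiv.Perm.mul_apply, ← zpow_one_add]
      congr 3
      ring_nf
  · intro h
    induction Quot.eqvGen_exact h with
    | rel x y hxy => exact ⟨1, by simpa using hxy⟩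
    | refl x => exact Equiv.Perm.SameCycle.refl _ _
    | symm x y hxy ih => exact (ih (Quot.eqvGen_sound hxy)).symm
    | trans x y z hxy hyz ih1 ih2 =>
      exact (ih1 (Quot.eqvGen_sound hxy)).trans (ih2 (Quot.eqvGen_sound hyz))

/-- An orbit of length `l` contributes `(-1) ^ (l - 1)`, also when `l = 1`. -/
theorem Equiv.Perm.sign_eq_neg_one_pow_card_quot {α : Type*} [Fintype α] [DecidableEq α]
    (σ : Equiv.Perm α) :
    (Equiv.Perm.sign σ : ℤˣ) =
      (-1) ^ (Fintype.card α + Nat.card (Quot fun x y => σ x = y)) := by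
  classical
  -- `F` names the orbits: a fixed point by itself, any other orbit by its cycle factor. Its fibres
  -- are the orbits.
  let F : α → Equiv.Perm α ⊕ α := fun x => if σ x = x then Sum.inr x else Sum.inl (σ.cycleOf x)
  have hF : ∀ x y, F x = F y ↔ σ.SameCycle x y := by
    intro x y
    by_cases hx : σ x = x <;> by_cases hy : σ y = y <;> simp only [F, hx, hy, if_true, if_false]
    · rw [Sum.inr.injEq]
      refine ⟨fun h => h ▸ Equiv.Perm.SameCycle.refl _ _, fun h => (h.eq_of_left hx)⟩
    · simp only [reduceCtorEq, false_iff]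
      exact fun h => hy (h.apply_eq_self_iff.1 hx)
    · simp only [reduceCtorEq, false_iff]
      exact fun h => hx (h.apply_eq_self_iff.2 hy)
    · rw [Sum.inl.injEq]
      exact (Equiv.Perm.sameCycle_iff_cycleOf_eq_of_mem_support
        (Equiv.Perm.mem_support.2 hx) (Equiv.Perm.mem_support.2 hy)).symm
  have hcard : Nat.card (Quot fun x y => σ x = y) = (Finset.univ.image F).card := by
    have hinj : Function.Injective (Quot.lift F (fun a b h =>
        (hF a b).2 ((σ.sameCycle_iff_quot a b).2 (Quot.sound h)))) := by
      rintro ⟨a⟩ ⟨b⟩ h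
      exact (σ.sameCycle_iff_quot a b).1 ((hF a b).1 h)
    rw [← Nat.card_congr (Equiv.ofInjective _ hinj).symm, ← Nat.card_eq_card_toFinset
      (s := Set.range F) |>.trans (congrArg _ (by ext; simp))]
    congr 2
    ext y
    constructor
    · rintro ⟨⟨a⟩, rfl⟩; exact ⟨a, rfl⟩
    · rintro ⟨a, rfl⟩; exact ⟨Quot.mk _ a, rfl⟩
  have himage : Finset.univ.image F = σ.cycleFactorsFinset.disjSum σ.supportᶜ := by
    ext y
    rcases y with c | x
    · simp only [Finset.mem_image, Finset.mem_univ, true_and, Finset.inl_mem_disjSum]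
      constructor
      · rintro ⟨x, hx⟩
        by_cases h : σ x = x
        · simp [F, h] at hx
        · simp only [F, h, if_false, Sum.inl.injEq] at hx
          rw [← hx, Equiv.Perm.cycleOf_mem_cycleFactorsFinset_iff]
          exact Equiv.Perm.mem_support.2 h
      · intro hc
        obtain ⟨x, hx⟩ := (Equiv.Perm.mem_cycleFactorsFinset_iff.1 hc).1.nonempty_support
        refine ⟨x, ?_⟩
        have h := Equiv.Perm.mem_support.1 (Equiv.Perm.mem_cycleFactorsFinset_support_le hc hx)
        simp [F, h, Equiv.Perm.cycle_is_cycleOf hx hc]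
    · simp only [Finset.mem_image, Finset.mem_univ, true_and, Finset.inr_mem_disjSum,
        Finset.mem_compl, Equiv.Perm.mem_support, not_not]
      constructor
      · rintro ⟨z, hz⟩
        by_cases h : σ z = z
        · simp only [F, h, if_true, Sum.inr.injEq] at hz
          exact hz ▸ h
        · simp [F, h] at hz
      · intro h
        exact ⟨x, by simp [F, h]⟩
  rw [Equiv.Perm.sign_of_cycleType, hcard, himage, Finset.card_disjSum, Finset.card_compl,
    Equiv.Perm.sum_cycleType,
    show σ.cycleFactorsFinset.card = Multiset.card σ.cycleType by
      rw [Equiv.Perm.cycleType_def, Multiset.card_map, Finset.card_def]]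
  have hle := Finset.card_le_univ σ.support
  obtain ⟨m, hm⟩ := Nat.exists_eq_add_of_le hle
  rw [hm, Nat.add_sub_cancel_left]
  rw [show σ.support.card + m + (Multiset.card σ.cycleType + m) =
    σ.support.card + Multiset.card σ.cycleType + (m + m) by ring, pow_add _ _ (m + m),
    Even.neg_one_pow ⟨m, rfl⟩, mul_one]

/-! ### Merging two classes of a relation -/

/-- The classes of `s` are those of `r`, except that the classes of `p` and `q` are united. -/
def Merges {α : Type*} (r s : α → α → Prop) (p q : α) : Prop :=
  ∀ a b, (Quot.mk s a = Quot.mk s b) ↔ (Quot.mk r a = Quot.mk r b ∨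
    (Quot.mk r a = Quot.mk r p ∨ Quot.mk r a = Quot.mk r q) ∧
      (Quot.mk r b = Quot.mk r p ∨ Quot.mk r b = Quot.mk r q))

theorem Merges.of_rel {α : Type*} {r s : α → α → Prop} {p q : α}
    (h1 : ∀ a b, r a b → Quot.mk s a = Quot.mk s b)
    (h2 : ∀ a b, s a b → Quot.mk r a = Quot.mk r b ∨
      (Quot.mk r a = Quot.mk r p ∨ Quot.mk r a = Quot.mk r q) ∧
        (Quot.mk r b = Quot.mk r p ∨ Quot.mk r b = Quot.mk r q))
    (h3 : Quot.mk s p = Quot.mk s q) : Merges r s p q := by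
  have h1' : ∀ a b, Quot.mk r a = Quot.mk r b → Quot.mk s a = Quot.mk s b := fun a b h =>
    congrArg (Quot.lift (Quot.mk s) h1) h
  intro a b
  constructor
  · intro h
    induction Quot.eqvGen_exact h with
    | rel x y hxy => exact h2 x y hxy
    | refl x => exact Or.inl rfl
    | symm x y hxy ih =>
      rcases ih (Quot.eqvGen_sound hxy) with h | ⟨h, h'⟩
      · exact Or.inl h.symm
      · exact Or.inr ⟨h', h⟩
    | trans x y z hxy hyz ih1 ih2 =>
      rcases ih1 (Quot.eqvGen_sound hxy) with h | ⟨h, h'⟩ <;>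
        rcases ih2 (Quot.eqvGen_sound hyz) with k | ⟨k, k'⟩
      · exact Or.inl (h.trans k)
      · exact Or.inr ⟨h ▸ k, k'⟩
      · exact Or.inr ⟨h, k ▸ h'⟩
      · exact Or.inr ⟨h, k'⟩
  · rintro (h | ⟨h | h, h' | h'⟩)
    · exact h1' _ _ h
    · exact (h1' _ _ h).trans (h1' _ _ h').symm
    · exact (h1' _ _ h).trans (h3.trans (h1' _ _ h').symm)
    · exact (h1' _ _ h).trans (h3.symm.trans (h1' _ _ h').symm)
    · exact (h1' _ _ h).trans (h1' _ _ h').symm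

/-- Coordinates for a merger of two distinct classes: `Z` consists of the untouched classes and
`none`, `some none` are the special ones. Merge and split maps on labels are computed in these
coordinates. -/
theorem Merges.exists_equiv.{u} {α : Type u} {r s : α → α → Prop} {p q : α} [Finite α]
    (h : Merges r s p q) (hpq : Quot.mk r p ≠ Quot.mk r q) :
    ∃ (Z : Type u) (_ : Fintype Z) (e₁ : Option (Option Z) ≃ Quot r) (e₂ : Option Z ≃ Quot s),
      e₁ none = Quot.mk r p ∧ e₁ (some none) = Quot.mk r q ∧ e₂ none = Quot.mk s p ∧
        e₂ none = Quot.mk s q ∧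
        ∀ z a, e₁ (some (some z)) = Quot.mk r a ↔ e₂ (some z) = Quot.mk s a := by
  let Z := {c : Quot r // c ≠ Quot.mk r p ∧ c ≠ Quot.mk r q}
  have hs : Quot.mk s p = Quot.mk s q := (h p q).2 (Or.inr ⟨Or.inl rfl, Or.inr rfl⟩)
  let π : Quot r → Quot s := Quot.lift (Quot.mk s) fun a b hab =>
    (h a b).2 (Or.inl (Quot.sound hab))
  let f₁ : Option (Option Z) → Quot r
    | none => Quot.mk r p
    | some none => Quot.mk r q
    | some (some z) => z.1
  let f₂ : Option Z → Quot s
    | none => Quot.mk s p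
    | some z => π z.1
  have hf₁ : Function.Bijective f₁ := by
    constructor
    · rintro (_ | _ | z) (_ | _ | z') hz
      · rfl
      · exact absurd hz hpq
      · exact absurd hz.symm z'.2.1
      · exact absurd hz.symm hpq
      · rfl
      · exact absurd hz.symm z'.2.2
      · exact absurd hz z.2.1
      · exact absurd hz z.2.2
      · exact congrArg (some ∘ some) (Subtype.ext hz)
    · intro c
      by_cases h1 : c = Quot.mk r p
      · exact ⟨none, h1.symm⟩
      by_cases h2 : c = Quot.mk r q
      · exact ⟨some none, h2.symm⟩
      exact ⟨some (some ⟨c, h1, h2⟩), rfl⟩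
  have hf₂ : Function.Bijective f₂ := by
    constructor
    · rintro (_ | ⟨⟨z⟩, hz1, hz2⟩) (_ | ⟨⟨z'⟩, hz1', hz2'⟩) hz
      · rfl
      · rcases (h _ _).1 hz with h' | ⟨-, h' | h'⟩
        exacts [absurd h'.symm hz1', absurd h' hz1', absurd h' hz2']
      · rcases (h _ _).1 hz with h' | ⟨h' | h', -⟩
        exacts [absurd h' hz1, absurd h' hz1, absurd h' hz2]
      · rcases (h _ _).1 hz with h' | ⟨h' | h', -⟩
        exacts [congrArg some (Subtype.ext h'), absurd h' hz1, absurd h' hz2]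
    · rintro ⟨a⟩
      by_cases h1 : Quot.mk r a = Quot.mk r p
      · exact ⟨none, ((h a p).2 (Or.inl h1)).symm⟩
      by_cases h2 : Quot.mk r a = Quot.mk r q
      · exact ⟨none, hs.trans ((h a q).2 (Or.inl h2)).symm⟩
      exact ⟨some ⟨Quot.mk r a, h1, h2⟩, rfl⟩
  refine ⟨Z, Fintype.ofFinite _, Equiv.ofBijective f₁ hf₁, Equiv.ofBijective f₂ hf₂, rfl, rfl, rfl,
    hs, ?_⟩
  rintro ⟨⟨b⟩, hb1, hb2⟩ a
  refine ⟨fun hab => (h b a).2 (Or.inl hab), fun hab => ?_⟩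
  rcases (h b a).1 hab with h' | ⟨h' | h', -⟩
  exacts [h', absurd h' hb1, absurd h' hb2]

theorem Merges.card {α : Type*} {r s : α → α → Prop} {p q : α} [Finite α]
    (h : Merges r s p q) :
    (Quot.mk r p = Quot.mk r q ∧ Nat.card (Quot r) = Nat.card (Quot s)) ∨
      (Quot.mk r p ≠ Quot.mk r q ∧ Nat.card (Quot r) = Nat.card (Quot s) + 1) := by
  by_cases hpq : Quot.mk r p = Quot.mk r q
  · refine Or.inl ⟨hpq, ?_⟩
    have h' : ∀ a b, (Quot.mk s a = Quot.mk s b) ↔ (Quot.mk r a = Quot.mk r b) := by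
      intro a b
      rw [h a b]
      refine ⟨?_, Or.inl⟩
      rintro (h | ⟨h | h, h' | h'⟩)
      · exact h
      · exact h.trans h'.symm
      · exact h.trans (hpq.trans h'.symm)
      · exact h.trans (hpq.symm.trans h'.symm)
      · exact h.trans h'.symm
    refine Nat.card_congr (Equiv.ofBijective (Quot.lift (Quot.mk s) fun a b hab =>
      (h' a b).2 (Quot.sound hab)) ⟨?_, ?_⟩)
    · rintro ⟨a⟩ ⟨b⟩ hab
      exact (h' a b).1 hab
    · rintro ⟨a⟩
      exact ⟨Quot.mk r a, rfl⟩
  · refine Or.inr ⟨hpq, ?_⟩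
    obtain ⟨Z, _, e₁, e₂, -⟩ := h.exists_equiv hpq
    rw [← Nat.card_congr e₁, ← Nat.card_congr e₂]
    simp

theorem card_quot_congr {α : Type*} {r s : α → α → Prop}
    (h1 : ∀ a b, r a b → s a b ∨ s b a) (h2 : ∀ a b, s a b → r a b ∨ r b a) :
    Nat.card (Quot r) = Nat.card (Quot s) := by
  refine Nat.card_congr ⟨Quot.lift (Quot.mk s) fun a b hab => ?_,
    Quot.lift (Quot.mk r) fun a b hab => ?_, ?_, ?_⟩
  · exact (h1 a b hab).elim Quot.sound fun h => (Quot.sound h).symm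
  · exact (h2 a b hab).elim Quot.sound fun h => (Quot.sound h).symm
  · rintro ⟨a⟩; rfl
  · rintro ⟨a⟩; rfl
end

noncomputable section
namespace SignedGaussCode

variable (D : SignedGaussCode)

/-! ### Circles of adjacent smoothings -/

theorem joined_of_eq {D : SignedGaussCode} {v w : D.Vertex} {e f : D.Edge} (h : D.Joined v e f) :
    ∃ k, (v k = w k → D.Joined w e f) ∧ (D.circleOf v e = D.circleOf v (D.underIn k) ∨
      D.circleOf v e = D.circleOf v (D.underOut k)) ∧
      (e = D.underIn k ∨ e = D.underOut k ∨ e = D.overIn k ∨ e = D.overOut k) ∧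
      (f = D.underIn k ∨ f = D.underOut k ∨ f = D.overIn k ∨ f = D.overOut k) := by
  cases h with
  | oriented₁ k h => exact ⟨k, fun h' => .oriented₁ k (h' ▸ h), Or.inl rfl, by simp, by simp⟩
  | oriented₂ k h =>
    exact ⟨k, fun h' => .oriented₂ k (h' ▸ h), Or.inr (Quot.sound (.oriented₂ k h)), by simp,
      by simp⟩
  | unoriented₁ k h => exact ⟨k, fun h' => .unoriented₁ k (h' ▸ h), Or.inl rfl, by simp, by simp⟩
  | unoriented₂ k h => exact ⟨k, fun h' => .unoriented₂ k (h' ▸ h), Or.inr rfl, by simp, by simp⟩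

theorem circleOf_over (v : D.Vertex) (k : Fin D.n) :
    (D.circleOf v (D.overOut k) = D.circleOf v (D.underIn k) ∧
      D.circleOf v (D.overIn k) = D.circleOf v (D.underOut k)) ∨
    (D.circleOf v (D.overIn k) = D.circleOf v (D.underIn k) ∧
      D.circleOf v (D.overOut k) = D.circleOf v (D.underOut k)) := by
  by_cases h : v k = D.positive k
  · exact Or.inr ⟨(Quot.sound (.unoriented₁ k h)).symm, (Quot.sound (.unoriented₂ k h)).symm⟩
  · have h : v k = !D.positive k := by
      revert h; cases v k <;> cases D.positive k <;> simp
    exact Or.inl ⟨(Quot.sound (.oriented₁ k h)).symm, Quot.sound (.oriented₂ k h)⟩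

theorem circleOf_of_touches (v : D.Vertex) {k : Fin D.n} {e : D.Edge}
    (h : e = D.underIn k ∨ e = D.underOut k ∨ e = D.overIn k ∨ e = D.overOut k) :
    D.circleOf v e = D.circleOf v (D.underIn k) ∨ D.circleOf v e = D.circleOf v (D.underOut k) := by
  have := D.circleOf_over v k
  rcases h with rfl | rfl | rfl | rfl <;> tauto

/-- Only the arcs at `k` differ. By `hw` all four edge ends at `k` lie on one circle of `w`, whereas
in `v` each lies on the circle of `underIn` or of `underOut`. -/
theorem merges_joined {v w : D.Vertex} {k : Fin D.n} (hvw : ∀ j, j ≠ k → v j = w j)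
    (hw : D.circleOf w (D.underIn k) = D.circleOf w (D.underOut k)) :
    Merges (D.Joined v) (D.Joined w) (D.underIn k) (D.underOut k) := by
  have hall : ∀ {e}, (e = D.underIn k ∨ e = D.underOut k ∨ e = D.overIn k ∨ e = D.overOut k) →
      D.circleOf w e = D.circleOf w (D.underIn k) := fun h =>
    (D.circleOf_of_touches w h).elim id fun h' => h'.trans hw.symm
  refine Merges.of_rel ?_ ?_ hw
  · intro a b h
    obtain ⟨j, h1, -, h3, h4⟩ := joined_of_eq (w := w) h
    by_cases hj : j = k
    · subst hj
      exact (hall h3).trans (hall h4).symm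
    · exact Quot.sound (h1 (hvw j hj))
  · intro a b h
    obtain ⟨j, h1, -, h3, h4⟩ := joined_of_eq (w := v) h
    by_cases hj : j = k
    · subst hj
      exact Or.inr ⟨D.circleOf_of_touches v h3, D.circleOf_of_touches v h4⟩
    · exact Or.inl (Quot.sound (h1 (hvw j hj).symm))

/-- The edges, with the circles of two smoothings identified. -/
def JoinedEither (v w : D.Vertex) (e f : D.Edge) : Prop := D.Joined v e f ∨ D.Joined w e f

theorem merges_joinedEither {v w : D.Vertex} {k : Fin D.n} (hvw : ∀ j, j ≠ k → v j = w j)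
    (hk : w k = !v k) :
    Merges (D.Joined v) (D.JoinedEither v w) (D.underIn k) (D.underOut k) := by
  refine Merges.of_rel (fun a b h => Quot.sound (Or.inl h)) ?_ ?_
  · rintro a b (h | h)
    · exact Or.inl (Quot.sound h)
    · obtain ⟨j, h1, -, h3, h4⟩ := joined_of_eq (w := v) h
      by_cases hj : j = k
      · subst hj
        exact Or.inr ⟨D.circleOf_of_touches v h3, D.circleOf_of_touches v h4⟩
      · exact Or.inl (Quot.sound (h1 (hvw j hj).symm))
  -- The arcs of both smoothings at `k` together connect the path `underIn`, `overIn`, `underOut`.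
  · have key : ∀ u : D.Vertex, u k = (!D.positive k) → ∀ u' : D.Vertex, u' k = D.positive k →
        ∀ s : D.Edge → D.Edge → Prop, (∀ a b, D.Joined u a b → s a b) →
        (∀ a b, D.Joined u' a b → s a b) → Quot.mk s (D.underIn k) = Quot.mk s (D.underOut k) :=
      fun u hu u' hu' s hs hs' => (Quot.sound (hs' _ _ (.unoriented₁ k hu'))).trans
        (Quot.sound (hs _ _ (.oriented₂ k hu)))
    by_cases hv : v k = D.positive k
    · exact key w (by rw [hk, hv]) v hv _ (fun _ _ => Or.inr) (fun _ _ => Or.inl)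
    · have hv : v k = !D.positive k := by
        revert hv; cases v k <;> cases D.positive k <;> simp
      exact key v hv w (by rw [hk, hv, Bool.not_not]) _ (fun _ _ => Or.inl) (fun _ _ => Or.inr)

/-! ### The source-sink orientation and the parity of the number of circles -/

/-- The edges pointing to the crossing `k` in the source-sink orientation given by `χ`. -/
def headEdge (χ : D.Edge → Bool) : Fin D.n × Bool → D.Edge
  | (k, true) => if χ (D.underIn k) then D.underIn k else D.overIn k
  | (k, false) => if χ (D.underIn k) then D.underOut k else D.overOut k

/-- The edges pointing away from the crossing `k` in the source-sink orientation given by `χ`. -/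
def tailEdge (χ : D.Edge → Bool) : Fin D.n × Bool → D.Edge
  | (k, true) => if χ (D.underIn k) then D.overOut k else D.underOut k
  | (k, false) => if χ (D.underIn k) then D.overIn k else D.underIn k

/-- Gauss's parity condition. -/
def IsAlternating (χ : D.Edge → Bool) : Prop :=
  ∀ k, χ (D.overOut k) = (!χ (D.overIn k)) ∧ χ (D.underOut k) = (!χ (D.underIn k)) ∧
      χ (D.underIn k) = !χ (D.overIn k)

variable {D}

theorem IsAlternating.head_color {χ : D.Edge → Bool} (hχ : D.IsAlternating χ)
    (x : Fin D.n × Bool) : χ (D.headEdge χ x) = x.2 := by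
  obtain ⟨k, b⟩ := x
  obtain ⟨h1, h2, h3⟩ := hχ k
  cases b <;> cases h : χ (D.underIn k) <;> simp_all [headEdge]

theorem IsAlternating.tail_color {χ : D.Edge → Bool} (hχ : D.IsAlternating χ)
    (x : Fin D.n × Bool) : χ (D.tailEdge χ x) = x.2 := by
  obtain ⟨k, b⟩ := x
  obtain ⟨h1, h2, h3⟩ := hχ k
  cases b <;> cases h : χ (D.underIn k) <;> simp_all [tailEdge]

theorem crossing_eq_of_passage {P : Fin D.n → Prop} [DecidablePred P] {j k : Fin D.n}
    (h : (if P j then D.underPassage j else D.overPassage j) =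
      if P k then D.underPassage k else D.overPassage k) : j = k := by
  have h' : Sum.elim D.overPassage D.underPassage (if P j then Sum.inr j else Sum.inl j) =
      Sum.elim D.overPassage D.underPassage (if P k then Sum.inr k else Sum.inl k) := by
    split_ifs at h ⊢ <;> exact h
  have := D.passage_injective h'
  split_ifs at this <;> simpa using this

theorem next_injective : Function.Injective D.next := (finRotate _).injective

theorem IsAlternating.head_bijective {χ : D.Edge → Bool} (hχ : D.IsAlternating χ)
    (hn : 0 < D.n) : Function.Bijective (D.headEdge χ) := by
  rw [Fintype.bijective_iff_injective_and_card]
  refine ⟨?_, by simp; omega⟩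
  rintro ⟨j, b⟩ ⟨k, c⟩ h
  obtain rfl : b = c :=
    (hχ.head_color (j, b)).symm.trans ((congrArg χ h).trans (hχ.head_color (k, c)))
  refine Prod.ext ?_ rfl
  cases b
  · refine crossing_eq_of_passage (P := fun k => χ (D.underIn k) = true) (next_injective ?_)
    rw [apply_ite D.next, apply_ite D.next]
    exact h
  · exact crossing_eq_of_passage (P := fun k => χ (D.underIn k) = true) h

theorem IsAlternating.tail_bijective {χ : D.Edge → Bool} (hχ : D.IsAlternating χ)
    (hn : 0 < D.n) : Function.Bijective (D.tailEdge χ) := by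
  rw [Fintype.bijective_iff_injective_and_card]
  refine ⟨?_, by simp; omega⟩
  rintro ⟨j, b⟩ ⟨k, c⟩ h
  obtain rfl : b = c :=
    (hχ.tail_color (j, b)).symm.trans ((congrArg χ h).trans (hχ.tail_color (k, c)))
  refine Prod.ext ?_ rfl
  cases b
  · refine crossing_eq_of_passage (P := fun k => ¬ χ (D.underIn k) = true) ?_
    simp only [ite_not]
    exact h
  · refine crossing_eq_of_passage (P := fun k => ¬ χ (D.underIn k) = true) (next_injective ?_)
    simp only [ite_not]
    rw [apply_ite D.next, apply_ite D.next]
    exact h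

/-- The permutation of the edges that follows the circles of a smoothing in the source-sink
orientation. -/
def IsAlternating.circlePerm {χ : D.Edge → Bool} (hχ : D.IsAlternating χ) (hn : 0 < D.n)
    (v : D.Vertex) : Equiv.Perm D.Edge :=
  ((Equiv.ofBijective _ (hχ.head_bijective hn)).symm.trans
    (Equiv.prodCongrRight fun k => if v k = D.positive k then Equiv.boolNot else 1)).trans
      (Equiv.ofBijective _ (hχ.tail_bijective hn))

theorem IsAlternating.circlePerm_head {χ : D.Edge → Bool} (hχ : D.IsAlternating χ) (hn : 0 < D.n)
    (v : D.Vertex) (k : Fin D.n) (b : Bool) :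
    hχ.circlePerm hn v (D.headEdge χ (k, b)) =
      D.tailEdge χ (k, if v k = D.positive k then !b else b) := by
  have : (Equiv.ofBijective _ (hχ.head_bijective hn)).symm (D.headEdge χ (k, b)) = (k, b) := by
    rw [Equiv.symm_apply_eq]; rfl
  simp only [circlePerm, Equiv.trans_apply, this]
  split_ifs with h <;> simp [h]

/-- Orient the edges coloured `true` along the knot and the others against it. Each arc of either
smoothing then runs from a head to a tail, so the orbits of `circlePerm` are the circles. -/
theorem IsAlternating.card_circle {χ : D.Edge → Bool} (hχ : D.IsAlternating χ) (hn : 0 < D.n)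
    (v : D.Vertex) :
    Nat.card (D.Circle v) = Nat.card (Quot fun e f => hχ.circlePerm hn v e = f) := by
  have hnot : ∀ k, ¬ v k = D.positive k → v k = !D.positive k := fun k h => by
    revert h; cases v k <;> cases D.positive k <;> simp
  have back : ∀ e f, hχ.circlePerm hn v e = f → D.Joined v e f ∨ D.Joined v f e := by
    rintro e _ rfl
    obtain ⟨⟨k, b⟩, rfl⟩ := (hχ.head_bijective hn).2 e
    rw [hχ.circlePerm_head]
    by_cases h : v k = D.positive k <;> cases b <;> cases hc : χ (D.underIn k) <;>
      simp only [headEdge, tailEdge, h, hc, if_true, if_false, Bool.not_true, Bool.not_false,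
        Bool.false_eq_true]
    · exact Or.inr (.unoriented₂ k h)
    · exact Or.inl (.unoriented₂ k h)
    · exact Or.inr (.unoriented₁ k h)
    · exact Or.inl (.unoriented₁ k h)
    · exact Or.inr (.oriented₁ k (hnot k h))
    · exact Or.inr (.oriented₂ k (hnot k h))
    · exact Or.inl (.oriented₂ k (hnot k h))
    · exact Or.inl (.oriented₁ k (hnot k h))
  refine card_quot_congr (fun e f h => ?_) back
  have hb := fun k b => hχ.circlePerm_head hn v k b
  cases h with
  | oriented₁ k h =>
    have h' : ¬ v k = D.positive k := by rw [h]; simp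
    have h1 := hb k true
    have h2 := hb k false
    cases hc : χ (D.underIn k) <;> simp [headEdge, tailEdge, h', hc] at h1 h2 <;>
      simp only [h1, h2, true_or, or_true]
  | oriented₂ k h =>
    have h' : ¬ v k = D.positive k := by rw [h]; simp
    have h1 := hb k true
    have h2 := hb k false
    cases hc : χ (D.underIn k) <;> simp [headEdge, tailEdge, h', hc] at h1 h2 <;>
      simp only [h1, h2, true_or, or_true]
  | unoriented₁ k h =>
    have h1 := hb k true
    cases hc : χ (D.underIn k) <;> simp [headEdge, tailEdge, h, hc] at h1 <;>
      simp only [h1, true_or, or_true]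
  | unoriented₂ k h =>
    have h2 := hb k false
    cases hc : χ (D.underIn k) <;> simp [headEdge, tailEdge, h, hc] at h2 <;>
      simp only [h2, true_or, or_true]

/-- Here `w` is the oriented smoothing. A crossing smoothed in the other way contributes a
transposition of its two heads. -/
theorem IsAlternating.sign_circlePerm {χ : D.Edge → Bool} (hχ : D.IsAlternating χ) (hn : 0 < D.n)
    (v w : D.Vertex) (hw : ∀ k, w k = !D.positive k) :
    Equiv.Perm.sign (hχ.circlePerm hn v) =
      (∏ k, if v k = D.positive k then -1 else 1) * Equiv.Perm.sign (hχ.circlePerm hn w) := by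
  let E := Equiv.ofBijective _ (hχ.head_bijective hn)
  have h1 : hχ.circlePerm hn v = ((E.symm.trans (Equiv.prodCongrRight fun k =>
      if v k = D.positive k then Equiv.boolNot else 1)).trans E).trans (hχ.circlePerm hn w) := by
    ext1 e
    obtain ⟨⟨k, b⟩, rfl⟩ := (hχ.head_bijective hn).2 e
    have : E.symm (D.headEdge χ (k, b)) = (k, b) := by
      rw [Equiv.symm_apply_eq]; rfl
    simp only [Equiv.trans_apply, this, circlePerm_head]
    have h2 : ∀ b, (hχ.circlePerm hn w) (E (k, b)) = D.tailEdge χ (k, b) := fun b =>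
      (hχ.circlePerm_head hn w k b).trans (by simp [hw])
    split_ifs with h <;> simp [h, h2]
  rw [h1, Equiv.Perm.sign_trans, mul_comm, Equiv.Perm.sign_symm_trans_trans,
    Equiv.Perm.sign_prodCongrRight]
  congr 1
  refine Finset.prod_congr rfl fun k _ => ?_
  split_ifs
  · decide
  · exact Equiv.Perm.sign_one

/-- The permutation of the edges that follows the circles of the oriented smoothing. -/
def seifertPerm (D : SignedGaussCode) (hn : 0 < D.n) : Equiv.Perm D.Edge :=
  (((Equiv.ofBijective _ (D.passage_bijective hn)).symm.trans (Equiv.sumComm _ _)).trans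
    (Equiv.ofBijective _ (D.passage_bijective hn))).trans (finRotate _)

theorem seifertPerm_apply (hn : 0 < D.n) (k : Fin D.n) :
    D.seifertPerm hn (D.overIn k) = D.underOut k ∧
      D.seifertPerm hn (D.underIn k) = D.overOut k := by
  have h1 : (Equiv.ofBijective _ (D.passage_bijective hn)).symm (D.overIn k) = Sum.inl k := by
    rw [Equiv.symm_apply_eq]; rfl
  have h2 : (Equiv.ofBijective _ (D.passage_bijective hn)).symm (D.underIn k) = Sum.inr k := by
    rw [Equiv.symm_apply_eq]; rfl
  constructor
  · simp only [seifertPerm, Equiv.trans_apply, h1]; rfl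
  · simp only [seifertPerm, Equiv.trans_apply, h2]; rfl

/-- Exchanging the over- and under-passage at every crossing is a product of `n` transpositions. It
is followed by a cycle of length `2 n`, since the diagram has one component. -/
theorem sign_seifertPerm (hn : 0 < D.n) :
    Equiv.Perm.sign (D.seifertPerm hn) = (-1) ^ (D.n + 1) := by
  have h1 : Equiv.Perm.sign (Equiv.sumComm (Fin D.n) (Fin D.n)) = (-1) ^ D.n := by
    rw [Equiv.Perm.sign_of_pow_two_eq_one]
    · have : IsEmpty (Function.fixedPoints (Equiv.sumComm (Fin D.n) (Fin D.n))) := by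
        constructor
        rintro ⟨x | x, hx⟩ <;> simp [Function.mem_fixedPoints, Function.IsFixedPt] at hx
      rw [Fintype.card_eq_zero (α := Function.fixedPoints _), Fintype.card_sum, Fintype.card_fin,
        Nat.sub_zero]
      congr 1
      omega
    · ext1 x
      rcases x with x | x <;> rfl
  have h2 : (-1 : ℤˣ) ^ (max 1 (2 * D.n) - 1) = -1 := Odd.neg_one_pow ⟨D.n - 1, by omega⟩
  rw [seifertPerm, Equiv.Perm.sign_trans, sign_finRotate, Equiv.Perm.sign_symm_trans_trans, h1, h2,
    pow_succ, mul_comm]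

theorem card_circle_oriented (hn : 0 < D.n) (w : D.Vertex) (hw : ∀ k, w k = !D.positive k) :
    Nat.card (D.Circle w) = Nat.card (Quot fun e f => D.seifertPerm hn e = f) := by
  refine card_quot_congr (fun e f h => Or.inl ?_) ?_
  · cases h with
    | oriented₁ k h => exact (seifertPerm_apply hn k).2
    | oriented₂ k h => exact (seifertPerm_apply hn k).1
    | unoriented₁ k h => rw [hw] at h; simp at h
    | unoriented₂ k h => rw [hw] at h; simp at h
  · rintro e _ rfl
    obtain ⟨k | k, rfl⟩ := (D.passage_bijective hn).2 e
    · exact Or.inl ((seifertPerm_apply hn k).1 ▸ .oriented₂ k (hw k))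
    · exact Or.inl ((seifertPerm_apply hn k).2 ▸ .oriented₁ k (hw k))

theorem neg_one_pow_card_filter {ι : Type*} [Fintype ι] (P : ι → Prop) [DecidablePred P] :
    (-1 : ℤˣ) ^ (Finset.univ.filter P).card = ∏ k, if P k then -1 else 1 := by
  rw [Finset.prod_ite, Finset.prod_const, Finset.prod_const_one, mul_one]

/-- For the oriented smoothing, `circlePerm` and `seifertPerm` have the same number of orbits, hence
the same sign; `sign_circlePerm` carries the parity to every other smoothing. This also makes all
quantum degrees odd. -/
theorem IsAlternating.neg_one_pow_card_circle {χ : D.Edge → Bool} (hχ : D.IsAlternating χ)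
    (v : D.Vertex) :
    (-1 : ℤˣ) ^ (Nat.card (D.Circle v) + (Finset.univ.filter fun k => v k = true).card + D.nPlus) =
      -1 := by
  rcases Nat.eq_zero_or_pos D.n with hn | hn
  · have hs : Subsingleton (D.Circle v) := by
      refine ⟨?_⟩
      rintro ⟨a⟩ ⟨b⟩
      exact congrArg _ (D.eq_of_comp_out id (fun k => absurd k.2 (by omega)) a b)
    have hne : Nonempty (D.Circle v) := ⟨Quot.mk _ ⟨0, by omega⟩⟩
    have : IsEmpty (Fin D.n) := hn ▸ Fin.isEmpty
    rw [Nat.card_eq_one_iff_unique.2 ⟨hs, hne⟩]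
    simp [nPlus, Finset.univ_eq_empty]
  let w : D.Vertex := fun k => !D.positive k
  have h1 := (hχ.circlePerm hn v).sign_eq_neg_one_pow_card_quot
  have h2 := (hχ.circlePerm hn w).sign_eq_neg_one_pow_card_quot
  have h3 := (D.seifertPerm hn).sign_eq_neg_one_pow_card_quot
  rw [← hχ.card_circle hn, hχ.sign_circlePerm hn v w fun _ => rfl] at h1
  rw [← hχ.card_circle hn] at h2
  rw [← card_circle_oriented hn w fun _ => rfl, ← h2, sign_seifertPerm hn] at h3
  have hE : (-1 : ℤˣ) ^ Fintype.card D.Edge = 1 := Even.neg_one_pow ⟨D.n, by simp; omega⟩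
  rw [← h3, pow_add _ (Fintype.card _), hE, one_mul] at h1
  have hp : (∏ k, ((if v k = D.positive k then -1 else 1) * (if v k = true then -1 else 1) *
      (if D.positive k = true then -1 else 1) : ℤˣ)) = (-1) ^ D.n := by
    rw [show (-1 : ℤˣ) ^ D.n = ∏ _k : Fin D.n, -1 by simp]
    refine Finset.prod_congr rfl fun k _ => ?_
    cases v k <;> cases D.positive k <;> decide
  rw [Finset.prod_mul_distrib, Finset.prod_mul_distrib] at hp
  rw [pow_add, pow_add, ← h1, nPlus, neg_one_pow_card_filter, neg_one_pow_card_filter,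
    mul_right_comm _ ((-1) ^ _), mul_right_comm _ ((-1) ^ _), hp, ← pow_add]
  exact Odd.neg_one_pow ⟨D.n, by ring⟩

theorem card_filter_update {ι : Type*} [Fintype ι] [DecidableEq ι] (v : ι → Bool) (k : ι)
    (hv : v k = false) :
    (Finset.univ.filter fun j => Function.update v k true j = true).card =
      (Finset.univ.filter fun j => v j = true).card + 1 := by
  have : (Finset.univ.filter fun j => Function.update v k true j = true) =
      insert k (Finset.univ.filter fun j => v j = true) := by
    ext j
    by_cases h : j = k
    · subst h; simp
    · simp [h]
  rw [this, Finset.card_insert_of_notMem (by simp [hv])]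

/-- Changing the smoothing at a crossing either merges or splits circles. -/
theorem IsAlternating.circle_dichotomy {χ : D.Edge → Bool} (hχ : D.IsAlternating χ)
    {v : D.Vertex} {k : Fin D.n} (hv : v k = false) :
    D.circleOf v (D.underIn k) = D.circleOf v (D.underOut k) ↔
      D.circleOf (Function.update v k true) (D.underIn k) ≠
        D.circleOf (Function.update v k true) (D.underOut k) := by
  set w := Function.update v k true with hw
  have h1 := (D.merges_joinedEither (v := v) (w := w) (k := k)
    (fun j hj => by simp [hw, hj]) (by simp [hw, hv])).card
  have h2 := (D.merges_joinedEither (v := w) (w := v) (k := k)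
    (fun j hj => by simp [hw, hj]) (by simp [hw, hv])).card
  have h3 : Nat.card (Quot (D.JoinedEither w v)) = Nat.card (Quot (D.JoinedEither v w)) :=
    card_quot_congr (fun a b h => Or.inl h.symm) (fun a b h => Or.inl h.symm)
  -- Each count is that of `JoinedEither` or one more, and their parities differ; so exactly one of
  -- the two smoothings has two circles at `k`.
  have hne : Nat.card (D.Circle v) ≠ Nat.card (D.Circle w) := by
    intro he
    have e1 := hχ.neg_one_pow_card_circle v
    have e2 := hχ.neg_one_pow_card_circle w
    rw [hw, card_filter_update v k hv, ← hw, ← he, add_right_comm, ← add_assoc, pow_succ,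
      add_right_comm, e1] at e2
    exact absurd e2 (by decide)
  unfold circleOf
  unfold Circle at hne
  rcases h1 with ⟨h1, h1'⟩ | ⟨h1, h1'⟩ <;> rcases h2 with ⟨h2, h2'⟩ | ⟨h2, h2'⟩
  · omega
  · exact ⟨fun _ => h2, fun _ => h1⟩
  · exact ⟨fun h => absurd h h1, fun h => absurd h2 h⟩
  · omega

end SignedGaussCode
end

/-! ### The edge maps of the cube in coordinates adapted to a crossing -/

noncomputable section
namespace SignedGaussCode

variable {D : SignedGaussCode}

theorem IsAlternating.merge_or_split {χ : D.Edge → Bool} (hχ : D.IsAlternating χ)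
    {v w : D.Vertex} {k : Fin D.n} (hv : v k = false) (hw : w = Function.update v k true) :
    (D.circleOf v (D.underIn k) ≠ D.circleOf v (D.underOut k) ∧
      Merges (D.Joined v) (D.Joined w) (D.underIn k) (D.underOut k)) ∨
    (D.circleOf v (D.underIn k) = D.circleOf v (D.underOut k) ∧
      D.circleOf w (D.underIn k) ≠ D.circleOf w (D.underOut k) ∧
      Merges (D.Joined w) (D.Joined v) (D.underIn k) (D.underOut k)) := by
  have hvw : ∀ j, j ≠ k → v j = w j := fun j hj => by simp [hw, hj]
  have h := hχ.circle_dichotomy hv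
  rw [← hw] at h
  by_cases hpq : D.circleOf v (D.underIn k) = D.circleOf v (D.underOut k)
  · exact Or.inr ⟨hpq, h.1 hpq, D.merges_joined (fun j hj => (hvw j hj).symm) hpq⟩
  · exact Or.inl ⟨hpq, D.merges_joined hvw (not_not.1 fun h' => hpq (h.2 h'))⟩

/-- The number of `1`-smoothings before the crossing `k`. -/
def countBefore (v : D.Vertex) (k : Fin D.n) : ℕ :=
  (Finset.univ.filter fun j => j < k ∧ v j = true).card

theorem edgeCoeff_of_not {R : Type*} [CommRing R] (h : R) (k : Fin D.n) (g g' : D.Gen)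
    (hg : ¬ (g.1 k = false ∧ g'.1 = Function.update g.1 k true)) : D.edgeCoeff h k g g' = 0 := by
  unfold edgeCoeff
  rw [if_neg fun h' => hg ⟨h'.1, h'.2.1⟩]

open Classical in
theorem edgeCoeff_merge {R : Type*} [CommRing R] (h : R) {k : Fin D.n} {v w : D.Vertex}
    (hv : v k = false) (hw : w = Function.update v k true) {Z : Type}
    {e₁ : Option (Option Z) ≃ D.Circle v} {e₂ : Option Z ≃ D.Circle w}
    (hp : e₁ none = D.circleOf v (D.underIn k)) (hq : e₁ (some none) = D.circleOf v (D.underOut k))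
    (hp' : e₂ none = D.circleOf w (D.underIn k))
    (hz : ∀ z e, e₁ (some (some z)) = D.circleOf v e ↔ e₂ (some z) = D.circleOf w e)
    (l : D.Circle v → Bool) (l' : D.Circle w → Bool) :
    D.edgeCoeff h k ⟨v, l⟩ ⟨w, l'⟩ = (-1) ^ countBefore v k *
      if ∀ z, l' (e₂ (some z)) = l (e₁ (some (some z))) then
        frobeniusMul h (l (e₁ none)) (l (e₁ (some none))) (l' (e₂ none)) else 0 := by
  have hpq : D.circleOf v (D.underIn k) ≠ D.circleOf v (D.underOut k) := by
    rw [← hp, ← hq]; simp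
  have hiff : (∀ e : D.Edge, D.circleOf v e ≠ D.circleOf v (D.underIn k) →
        D.circleOf v e ≠ D.circleOf v (D.underOut k) → l' (D.circleOf w e) = l (D.circleOf v e)) ↔
      ∀ z, l' (e₂ (some z)) = l (e₁ (some (some z))) := by
    rw [← hp, ← hq]
    constructor
    · intro H z
      obtain ⟨a, ha⟩ := Quot.exists_rep (e₁ (some (some z)))
      have ha : D.circleOf v a = e₁ (some (some z)) := ha
      rw [(hz z a).1 ha.symm, ← ha]
      exact H a (by rw [ha]; simp) (by rw [ha]; simp)
    · intro H e h1 h2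
      obtain ⟨y, hy⟩ := e₁.surjective (D.circleOf v e)
      rcases y with _ | _ | z
      · exact absurd hy.symm h1
      · exact absurd hy.symm h2
      · rw [← (hz z e).1 hy, ← hy, H]
  unfold edgeCoeff
  simp only [Gen.label]
  rw [if_neg hpq, hp, hq, hp']
  split_ifs with h1 h2 h2
  · rfl
  · exact absurd (hiff.1 h1.2.2) h2
  · exact absurd ⟨hv, hw, hiff.2 h2⟩ h1
  · rw [mul_zero]

open Classical in
theorem edgeCoeff_split {R : Type*} [CommRing R] (h : R) {k : Fin D.n} {v w : D.Vertex}
    (hv : v k = false) (hw : w = Function.update v k true) {Z : Type}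
    {e₁ : Option (Option Z) ≃ D.Circle w} {e₂ : Option Z ≃ D.Circle v}
    (hp : e₁ none = D.circleOf w (D.underIn k)) (hq : e₁ (some none) = D.circleOf w (D.underOut k))
    (hp' : e₂ none = D.circleOf v (D.underIn k)) (hq' : e₂ none = D.circleOf v (D.underOut k))
    (hz : ∀ z e, e₁ (some (some z)) = D.circleOf w e ↔ e₂ (some z) = D.circleOf v e)
    (l : D.Circle v → Bool) (l' : D.Circle w → Bool) :
    D.edgeCoeff h k ⟨v, l⟩ ⟨w, l'⟩ = (-1) ^ countBefore v k *
      if ∀ z, l' (e₁ (some (some z))) = l (e₂ (some z)) then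
        frobeniusComul h (l (e₂ none)) (l' (e₁ none)) (l' (e₁ (some none))) else 0 := by
  have hpq : D.circleOf v (D.underIn k) = D.circleOf v (D.underOut k) := hp'.symm.trans hq'
  have hiff : (∀ e : D.Edge, D.circleOf v e ≠ D.circleOf v (D.underIn k) →
        D.circleOf v e ≠ D.circleOf v (D.underOut k) → l' (D.circleOf w e) = l (D.circleOf v e)) ↔
      ∀ z, l' (e₁ (some (some z))) = l (e₂ (some z)) := by
    rw [← hpq, ← hp']
    constructor
    · intro H z
      obtain ⟨a, ha⟩ := Quot.exists_rep (e₂ (some z))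
      have ha : D.circleOf v a = e₂ (some z) := ha
      rw [(hz z a).2 ha.symm, ← ha]
      exact H a (by rw [ha]; simp) (by rw [ha]; simp)
    · intro H e h1 _
      obtain ⟨y, hy⟩ := e₂.surjective (D.circleOf v e)
      rcases y with _ | z
      · exact absurd hy.symm h1
      · rw [← (hz z e).2 hy, ← hy, H]
  unfold edgeCoeff
  simp only [Gen.label]
  rw [if_pos hpq, hp, hq, hp']
  split_ifs with h1 h2 h2
  · rfl
  · exact absurd (hiff.1 h1.2.2) h2
  · exact absurd ⟨hv, hw, hiff.2 h2⟩ h1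
  · rw [mul_zero]

/-! ### Evaluation of labels at the roots of `x ^ 2 = h * x` -/

/-- The value of `1` (for `false`) or `x` (for `true`) at the root `h` (for `true`) or `0` (for
`false`). -/
def rootValue {R : Type*} [CommRing R] (h : R) : Bool → Bool → R
  | false, _ => 1
  | true, true => h
  | true, false => 0

/-- The value of a labelling at a choice of roots. -/
def labelValue {R : Type*} [CommRing R] (h : R) {ι : Type*} [Fintype ι] (l c : ι → Bool) : R :=
  ∏ i, rootValue h (l i) (c i)

theorem labelValue_equiv {R : Type*} [CommRing R] (h : R) {ι κ : Type*} [Fintype ι] [Fintype κ]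
    (e : κ ≃ ι) (l c : ι → Bool) :
    labelValue h l c = ∏ i, rootValue h (l (e i)) (c (e i)) :=
  (Fintype.prod_equiv e _ _ fun _ => rfl).symm

open Classical in
-- Evaluation at a root is a ring homomorphism, so the value of a product is the product of the
-- values at the same root.
theorem sum_frobeniusMul {R : Type*} [CommRing R] (h : R) {A B Z : Type*} [Fintype A] [Fintype B]
    (e₁ : Option (Option Z) ≃ A) (e₂ : Option Z ≃ B) (l c : A → Bool)
    (c' : B → Bool) (h0 : c (e₁ none) = c' (e₂ none)) (h1 : c (e₁ (some none)) = c' (e₂ none))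
    (hz : ∀ z, c (e₁ (some (some z))) = c' (e₂ (some z))) :
    ∑ l' : B → Bool, (if ∀ z, l' (e₂ (some z)) = l (e₁ (some (some z))) then
      frobeniusMul h (l (e₁ none)) (l (e₁ (some none))) (l' (e₂ none)) else 0) *
        labelValue h l' c' = labelValue h l c := by
  have : Fintype Z := Fintype.ofInjective (fun z => e₂ (some z)) (by
    intro a b hab; simpa using hab)
  -- Only labellings unchanged away from the merged circle contribute; they are parametrized by the
  -- label `a` there.
  let j : Bool → B → Bool := fun a b => (e₂.symm b).elim a fun z => l (e₁ (some (some z)))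
  have hj0 : ∀ a, j a (e₂ none) = a := fun a => by simp [j]
  have hjz : ∀ a z, j a (e₂ (some z)) = l (e₁ (some (some z))) := fun a z => by simp [j]
  rw [← Fintype.sum_of_injective j (fun a b hab => by rw [← hj0 a, hab, hj0])
    (fun a => frobeniusMul h (l (e₁ none)) (l (e₁ (some none))) a * labelValue h (j a) c')]
  · simp only [Fintype.sum_bool, labelValue_equiv h e₁, labelValue_equiv h e₂,
      Fintype.prod_option, hj0, hjz, h0, h1, hz]
    rw [← mul_assoc, ← mul_assoc, ← mul_assoc, ← add_mul]
    congr 1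
    cases l (e₁ none) <;> cases l (e₁ (some none)) <;> cases c' (e₂ none) <;>
      simp [frobeniusMul, rootValue]
  · intro l' hl'
    rw [if_neg, zero_mul]
    intro H
    refine hl' ⟨l' (e₂ none), ?_⟩
    ext b
    obtain ⟨y, rfl⟩ := e₂.surjective b
    rcases y with _ | z
    · rw [hj0]
    · rw [hjz, H]
  · intro a
    simp [hj0, hjz]

open Classical in
-- The comultiplication is diagonal in the idempotent basis: evaluated at two different roots it
-- vanishes, at `(h, h)` it multiplies the value at `h` by `h`, and at `(0, 0)` the value at `0` by
-- `-h`.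
theorem sum_frobeniusComul {R : Type*} [CommRing R] (h : R) {A B Z : Type*} [Fintype A] [Fintype B]
    (e₁ : Option (Option Z) ≃ A) (e₂ : Option Z ≃ B) (l : B → Bool)
    (c' : A → Bool) :
    ∑ l' : A → Bool, (if ∀ z, l' (e₁ (some (some z))) = l (e₂ (some z)) then
      frobeniusComul h (l (e₂ none)) (l' (e₁ none)) (l' (e₁ (some none))) else 0) *
        labelValue h l' c' =
    if c' (e₁ none) = c' (e₁ (some none)) then
      (if c' (e₁ none) then h else -h) * labelValue h l
        (fun b => (e₂.symm b).elim (c' (e₁ none)) fun z => c' (e₁ (some (some z)))) else 0 := by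
  have : Fintype Z := Fintype.ofInjective (fun z => e₂ (some z)) (by
    intro a b hab; simpa using hab)
  let j : Bool × Bool → A → Bool := fun x a =>
    (e₁.symm a).elim x.1 fun y => y.elim x.2 fun z => l (e₂ (some z))
  have hj0 : ∀ x, j x (e₁ none) = x.1 := fun a => by simp [j]
  have hj1 : ∀ x, j x (e₁ (some none)) = x.2 := fun a => by simp [j]
  have hjz : ∀ x z, j x (e₁ (some (some z))) = l (e₂ (some z)) := fun a z => by simp [j]
  rw [← Fintype.sum_of_injective j (fun a b hab => Prod.ext (by rw [← hj0 a, hab, hj0])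
    (by rw [← hj1 a, hab, hj1]))
    (fun x => frobeniusComul h (l (e₂ none)) x.1 x.2 * labelValue h (j x) c')]
  · simp only [Fintype.sum_prod_type, Fintype.sum_bool, labelValue_equiv h e₁,
      labelValue_equiv h e₂, Fintype.prod_option, hj0, hj1, hjz, Equiv.symm_apply_apply,
      Option.elim]
    generalize (∏ z, rootValue h (l (e₂ (some z))) (c' (e₁ (some (some z))))) = P
    cases l (e₂ none) <;> cases c' (e₁ none) <;> cases c' (e₁ (some none)) <;>
      simp [frobeniusComul, rootValue]
  · intro l' hl'
    rw [if_neg, zero_mul]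
    intro H
    refine hl' ⟨(l' (e₁ none), l' (e₁ (some none))), ?_⟩
    ext b
    obtain ⟨y, rfl⟩ := e₁.surjective b
    rcases y with _ | _ | z
    · rw [hj0]
    · rw [hj1]
    · rw [hjz, H]
  · intro a
    simp [hj0, hj1, hjz]

end SignedGaussCode
end

noncomputable section
namespace SignedGaussCode

variable {D : SignedGaussCode}

/-! ### Degrees -/

/-- The quantum degree of a label. -/
def labelDegree (b : Bool) : ℤ := if b then -1 else 1

theorem qdeg_eq (g : D.Gen) :
    g.qdeg = ∑ c, labelDegree (g.2 c) + g.height + D.nPlus - 2 * D.nMinus := by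
  have : ∀ c, labelDegree (g.2 c) = (if g.2 c = false then 1 else 0) - if g.2 c = true then 1 else 0 :=
    fun c => by cases g.2 c <;> rfl
  simp only [this, Finset.sum_sub_distrib, Finset.sum_boole]
  rfl

theorem IsAlternating.odd_qdeg {χ : D.Edge → Bool} (hχ : D.IsAlternating χ) (g : D.Gen) :
    Odd g.qdeg := by
  have h1 := hχ.neg_one_pow_card_circle g.1
  have h2 : Odd (Nat.card (D.Circle g.1) + g.height + D.nPlus) := by
    rw [← Nat.not_even_iff_odd]
    intro h
    have h3 := h.neg_one_pow (α := ℤˣ)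
    rw [Gen.height] at h3
    rw [h1] at h3
    exact absurd h3 (by decide)
  have h3 : (Nat.card (D.Circle g.1) : ℤ) = (Finset.univ.filter fun c => g.2 c = false).card
      + (Finset.univ.filter fun c => g.2 c = true).card := by
    rw [Nat.card_eq_fintype_card, ← Finset.card_univ,
      ← Finset.card_filter_add_card_filter_not (s := Finset.univ) (fun c => g.2 c = false)]
    simp
  obtain ⟨m, hm⟩ := h2
  refine ⟨m - (Finset.univ.filter fun c => g.2 c = true).card - D.nMinus, ?_⟩
  unfold Gen.qdeg
  have : (Nat.card (D.Circle g.1) : ℤ) + g.height + D.nPlus = 2 * m + 1 := by exact_mod_cast hm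
  linarith

theorem height_eq_of_edgeCoeff_ne_zero {R : Type*} [CommRing R] {h : R} {k : Fin D.n}
    {g g' : D.Gen} (hg : D.edgeCoeff h k g g' ≠ 0) : g'.height = g.height + 1 := by
  have := not_imp_comm.1 (edgeCoeff_of_not h k g g') hg
  rw [Gen.height, this.2, card_filter_update _ _ this.1, Gen.height]

theorem hdeg_eq_of_edgeCoeff_ne_zero {R : Type*} [CommRing R] {h : R} {k : Fin D.n}
    {g g' : D.Gen} (hg : D.edgeCoeff h k g g' ≠ 0) : g'.hdeg = g.hdeg + 1 := by
  have := height_eq_of_edgeCoeff_ne_zero hg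
  unfold Gen.hdeg
  rw [this]
  push_cast
  ring

theorem frobeniusMul_degree {R : Type*} [CommRing R] (a b c : Bool) :
    (frobeniusMul (0 : R) a b c ≠ 0 → labelDegree c + 1 = labelDegree a + labelDegree b) ∧
    (frobeniusMul (1 : R) a b c - frobeniusMul 0 a b c ≠ 0 →
      labelDegree c + 1 = labelDegree a + labelDegree b + 2) := by
  cases a <;> cases b <;> cases c <;> simp [frobeniusMul, labelDegree]

theorem frobeniusComul_degree {R : Type*} [CommRing R] (a b c : Bool) :
    (frobeniusComul (0 : R) a b c ≠ 0 → labelDegree b + labelDegree c + 1 = labelDegree a) ∧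
    (frobeniusComul (1 : R) a b c - frobeniusComul 0 a b c ≠ 0 →
      labelDegree b + labelDegree c + 1 = labelDegree a + 2) := by
  cases a <;> cases b <;> cases c <;> simp [frobeniusComul, labelDegree]

theorem frobeniusMul_linear {R : Type*} [CommRing R] (h : R) (a b c : Bool) :
    frobeniusMul h a b c =
      frobeniusMul 0 a b c + h * (frobeniusMul 1 a b c - frobeniusMul 0 a b c) := by
  cases a <;> cases b <;> cases c <;> simp [frobeniusMul]

theorem frobeniusComul_linear {R : Type*} [CommRing R] (h : R) (a b c : Bool) :
    frobeniusComul h a b c =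
      frobeniusComul 0 a b c + h * (frobeniusComul 1 a b c - frobeniusComul 0 a b c) := by
  cases a <;> cases b <;> cases c <;> simp [frobeniusComul]

theorem edgeCoeff_linear {R : Type*} [CommRing R] (h : R) (k : Fin D.n) (g g' : D.Gen) :
    D.edgeCoeff h k g g' =
      D.edgeCoeff 0 k g g' + h * (D.edgeCoeff 1 k g g' - D.edgeCoeff 0 k g g') := by
  unfold edgeCoeff
  split_ifs
  · rw [frobeniusComul_linear]; ring
  · rw [frobeniusMul_linear]; ring
  · ring

/-- Product and coproduct for `h = 0` lower the label degree by 1, which the additional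
`1`-smoothing restores. The terms with `h` are of degree 2 higher. -/
theorem IsAlternating.qdeg_eq_of_edgeCoeff {χ : D.Edge → Bool} (hχ : D.IsAlternating χ)
    {R : Type*} [CommRing R] (k : Fin D.n) (g g' : D.Gen) :
    (D.edgeCoeff (0 : R) k g g' ≠ 0 → g'.qdeg = g.qdeg) ∧
    (D.edgeCoeff (1 : R) k g g' - D.edgeCoeff 0 k g g' ≠ 0 → g'.qdeg = g.qdeg + 2) := by
  by_cases hg : g.1 k = false ∧ g'.1 = Function.update g.1 k true
  swap
  · rw [edgeCoeff_of_not _ _ _ _ hg, edgeCoeff_of_not _ _ _ _ hg]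
    simp
  obtain ⟨v, l⟩ := g
  obtain ⟨w, l'⟩ := g'
  obtain ⟨hv, hw⟩ := hg
  simp only at hv hw
  have hh : Gen.height (D := D) ⟨w, l'⟩ = Gen.height (D := D) ⟨v, l⟩ + 1 := by
    change (Finset.univ.filter fun j => w j = true).card =
      (Finset.univ.filter fun j => v j = true).card + 1
    rw [hw, card_filter_update v k hv]
  rw [qdeg_eq, qdeg_eq, hh]
  push_cast
  rcases hχ.merge_or_split hv hw with ⟨hpq, hm⟩ | ⟨-, hpq, hm⟩ <;>
    obtain ⟨Z, _, e₁, e₂, hp, hq, hp', hq', hz⟩ := hm.exists_equiv hpq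
  · rw [edgeCoeff_merge _ hv hw hp hq hp' hz, edgeCoeff_merge _ hv hw hp hq hp' hz, ← mul_sub]
    split_ifs with H
    · obtain ⟨d1, d2⟩ := frobeniusMul_degree (R := R) (l (e₁ none)) (l (e₁ (some none)))
        (l' (e₂ none))
      rw [← e₁.sum_comp, ← e₂.sum_comp]
      simp only [Fintype.sum_option, H]
      exact ⟨fun h => by linarith [d1 (right_ne_zero_of_mul h)],
        fun h => by linarith [d2 (right_ne_zero_of_mul h)]⟩
    · simp
  · rw [edgeCoeff_split _ hv hw hp hq hp' hq' hz, edgeCoeff_split _ hv hw hp hq hp' hq' hz,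
      ← mul_sub]
    split_ifs with H
    · obtain ⟨d1, d2⟩ := frobeniusComul_degree (R := R) (l (e₂ none)) (l' (e₁ none))
        (l' (e₁ (some none)))
      rw [← e₁.sum_comp, ← e₂.sum_comp]
      simp only [Fintype.sum_option, H]
      exact ⟨fun h => by linarith [d1 (right_ne_zero_of_mul h)],
        fun h => by linarith [d2 (right_ne_zero_of_mul h)]⟩
    · simp

/-! ### Evaluation of cochains at edge colourings -/

/-- An edge colouring is constant along the circles of a smoothing. -/
abbrev Compatible (v : D.Vertex) (κ : D.Edge → Bool) : Prop := ∀ e f, D.Joined v e f → κ e = κ f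

open Classical in
/-- The value of a cochain at a smoothing and an edge colouring, where the colours stand for the
roots of `x ^ 2 = h * x`. -/
def evalAt {R : Type*} [CommRing R] (h : R) (f : D.Gen → R) (v : D.Vertex) (κ : D.Edge → Bool) : R :=
  if hc : Compatible v κ then
    ∑ l : D.Circle v → Bool, f ⟨v, l⟩ * labelValue h l (Quot.lift κ hc) else 0

open Classical in
/-- The factor by which the edge of the cube at the crossing `k` acts on values at a colouring. -/
def edgeFactor {R : Type*} [CommRing R] (h : R) (v : D.Vertex) (k : Fin D.n) (κ : D.Edge → Bool) :
    R :=
  if D.circleOf v (D.underIn k) = D.circleOf v (D.underOut k) then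
    (if κ (D.underIn k) then h else -h) else 1

open Classical in
-- If a split gives its two circles different colours, `κ` is not compatible with `v`, and the
-- vanishing of the coproduct there matches the default value 0.
theorem IsAlternating.sum_edgeCoeff {χ : D.Edge → Bool} (hχ : D.IsAlternating χ)
    {R : Type*} [CommRing R] (h : R) {k : Fin D.n} {v w : D.Vertex}
    (hv : v k = false) (hw : w = Function.update v k true) {κ : D.Edge → Bool}
    (hc : Compatible w κ) (l : D.Circle v → Bool) :
    ∑ l' : D.Circle w → Bool, D.edgeCoeff h k ⟨v, l⟩ ⟨w, l'⟩ * labelValue h l' (Quot.lift κ hc) =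
      (-1) ^ countBefore v k * edgeFactor h v k κ *
        if hc' : Compatible v κ then labelValue h l (Quot.lift κ hc') else 0 := by
  have hκw : ∀ e f, D.circleOf w e = D.circleOf w f → κ e = κ f := fun e f he =>
    congrArg (Quot.lift κ hc) he
  rcases hχ.merge_or_split hv hw with ⟨hpq, hm⟩ | ⟨hvpq, hpq, hm⟩ <;>
    obtain ⟨Z, _, e₁, e₂, hp, hq, hp', hq', hz⟩ := hm.exists_equiv hpq
  · have hc' : Compatible v κ := fun e f he => hκw e f ((hm e f).2 (Or.inl (Quot.sound he)))
    have hl : ∀ y e, e₁ y = D.circleOf v e → Quot.lift κ hc' (e₁ y) = κ e := fun y e he => by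
      rw [he]; rfl
    have hl' : ∀ y e, e₂ y = D.circleOf w e → Quot.lift κ hc (e₂ y) = κ e := fun y e he => by
      rw [he]; rfl
    simp only [edgeCoeff_merge h hv hw hp hq hp' hz, mul_assoc]
    rw [← Finset.mul_sum, sum_frobeniusMul h e₁ e₂ l (Quot.lift κ hc')]
    · rw [edgeFactor, if_neg hpq, one_mul, dif_pos hc']
    · rw [hl _ _ hp, hl' _ _ hp']
    · rw [hl _ _ hq, hl' _ _ hq']
    · intro z
      obtain ⟨a, ha⟩ := Quot.exists_rep (e₁ (some (some z)))
      rw [hl _ a ha.symm, hl' _ a ((hz z a).1 ha.symm)]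
  · have hl : ∀ y e, e₁ y = D.circleOf w e → Quot.lift κ hc (e₁ y) = κ e := fun y e he => by
      rw [he]; rfl
    simp only [edgeCoeff_split h hv hw hp hq hp' hq' hz, mul_assoc]
    rw [← Finset.mul_sum, sum_frobeniusComul h e₁ e₂ l]
    congr 1
    rw [hl _ _ hp, hl _ _ hq, edgeFactor, if_pos hvpq]
    by_cases hκ : κ (D.underIn k) = κ (D.underOut k)
    · have hc' : Compatible v κ := by
        intro e f he
        have ht : ∀ e, (D.circleOf w e = D.circleOf w (D.underIn k) ∨
            D.circleOf w e = D.circleOf w (D.underOut k)) → κ e = κ (D.underIn k) := by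
          rintro e (he | he)
          · exact hκw _ _ he
          · rw [hκ]; exact hκw _ _ he
        rcases (hm e f).1 (Quot.sound he) with h' | ⟨h1, h2⟩
        · exact hκw e f h'
        · exact (ht e h1).trans (ht f h2).symm
      rw [if_pos hκ, dif_pos hc']
      congr 2
      ext b
      obtain ⟨y, rfl⟩ := e₂.surjective b
      rw [Equiv.symm_apply_apply]
      rcases y with _ | z
      · rw [hp']; rfl
      · obtain ⟨a, ha⟩ := Quot.exists_rep (e₂ (some z))
        rw [Option.elim, hl _ a ((hz z a).2 ha.symm), ← ha]
    · rw [if_neg hκ, dif_neg, mul_zero]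
      exact fun hc' => hκ (congrArg (Quot.lift κ hc') hvpq)

open Classical in
theorem sum_gen {M : Type*} [AddCommMonoid M] (F : D.Gen → M) :
    ∑ g, F g = ∑ v, ∑ l : D.Circle v → Bool, F ⟨v, l⟩ := by
  rw [← Finset.sum_sigma Finset.univ (fun _ => Finset.univ) F]
  exact Finset.sum_congr (by ext; simp) fun _ _ => rfl

theorem differential_apply {R : Type*} [CommRing R] (h : R) (f : D.Gen → R) (g' : D.Gen) :
    D.differential h f g' = ∑ g, (∑ k, D.edgeCoeff h k g g') * f g := rfl

/-- The differential relates values at the same edge colouring only, through scalars on the edges of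
the cube. Identities of operators thus reduce to identities of scalars. -/
theorem IsAlternating.evalAt_differential {χ : D.Edge → Bool} (hχ : D.IsAlternating χ)
    {R : Type*} [CommRing R] (h : R) (f : D.Gen → R) (w : D.Vertex) {κ : D.Edge → Bool}
    (hc : Compatible w κ) :
    evalAt h (D.differential h f) w κ = ∑ k, if w k = true then
      (-1) ^ countBefore (Function.update w k false) k *
        edgeFactor h (Function.update w k false) k κ * evalAt h f (Function.update w k false) κ
      else 0 := by
  classical
  have h1 : evalAt h (D.differential h f) w κ = ∑ k, ∑ v, ∑ l : D.Circle v → Bool, f ⟨v, l⟩ *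
      ∑ l' : D.Circle w → Bool, D.edgeCoeff h k ⟨v, l⟩ ⟨w, l'⟩ *
        labelValue h l' (Quot.lift κ hc) := by
    rw [evalAt, dif_pos hc]
    simp only [differential_apply, Finset.sum_mul, Finset.mul_sum]
    rw [Finset.sum_comm]
    refine (Finset.sum_congr rfl fun g _ => Finset.sum_comm).trans ?_
    rw [Finset.sum_comm]
    refine Finset.sum_congr rfl fun k _ => ?_
    rw [sum_gen]
    refine Finset.sum_congr rfl fun v _ => Finset.sum_congr rfl fun l _ =>
      Finset.sum_congr rfl fun l' _ => ?_
    ring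
  rw [h1]
  refine Finset.sum_congr rfl fun k _ => ?_
  have h0 : ∀ v, ¬ (v k = false ∧ w = Function.update v k true) →
      ∑ l : D.Circle v → Bool, f ⟨v, l⟩ *
        ∑ l' : D.Circle w → Bool, D.edgeCoeff h k ⟨v, l⟩ ⟨w, l'⟩ *
          labelValue h l' (Quot.lift κ hc) = 0 := by
    intro v hv
    refine Finset.sum_eq_zero fun l _ => ?_
    rw [Finset.sum_eq_zero, mul_zero]
    intro l' _
    rw [edgeCoeff_of_not _ _ _ _ hv, zero_mul]
  split_ifs with hwk
  · have hv : Function.update w k false k = false := by simp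
    have hw : w = Function.update (Function.update w k false) k true := by
      rw [Function.update_idem, ← hwk, Function.update_eq_self]
    rw [Finset.sum_eq_single (Function.update w k false)]
    · simp only [hχ.sum_edgeCoeff h hv hw hc]
      rw [evalAt]
      split_ifs with hc'
      · rw [Finset.mul_sum]
        exact Finset.sum_congr rfl fun l _ => by ring
      · simp
    · intro v _ hne
      refine h0 v fun h' => hne ?_
      rw [h'.2, Function.update_idem, ← h'.1, Function.update_eq_self]
    · exact fun h' => absurd (Finset.mem_univ _) h'
  · refine Finset.sum_eq_zero fun v _ => h0 v fun h' => hwk ?_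
    rw [h'.2, Function.update_self]

end SignedGaussCode
end

/-! ### Injectivity of evaluation -/

noncomputable section

/-- The matrix of values is triangular for the pointwise order on labellings: it vanishes unless `l
≤ c`, and its diagonal entries are powers of `h`. -/
theorem eq_zero_of_sum_labelValue {R : Type*} [CommRing R] [IsDomain R] {h : R} (hh : h ≠ 0)
    {ι : Type*} [Fintype ι] [DecidableEq ι] (F : (ι → Bool) → R)
    (hF : ∀ c, ∑ l, F l * SignedGaussCode.labelValue h l c = 0) : F = 0 := by
  ext c
  induction c using WellFoundedLT.induction with
  | ind c ih =>
    have h1 := hF c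
    rw [Finset.sum_eq_single c] at h1
    · refine (mul_eq_zero.1 h1).resolve_right ?_
      refine Finset.prod_ne_zero_iff.2 fun i _ => ?_
      cases c i <;> simp [SignedGaussCode.rootValue, hh]
    · intro l _ hl
      by_cases hle : l ≤ c
      · rw [ih l (lt_of_le_of_ne hle hl), Pi.zero_apply, zero_mul]
      · obtain ⟨i, hi⟩ := not_forall.1 hle
        refine mul_eq_zero_of_right _ (Finset.prod_eq_zero (Finset.mem_univ i) ?_)
        revert hi
        cases l i <;> cases c i <;> simp [SignedGaussCode.rootValue]
    · exact fun h' => absurd (Finset.mem_univ _) h'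

theorem card_filter_update_and {ι : Type*} [Fintype ι] [DecidableEq ι] (v : ι → Bool) (k : ι)
    (hv : v k = false) (P : ι → Prop) [DecidablePred P] :
    (Finset.univ.filter fun j => P j ∧ Function.update v k true j = true).card =
      (Finset.univ.filter fun j => P j ∧ v j = true).card + if P k then 1 else 0 := by
  split_ifs with hP
  · have : (Finset.univ.filter fun j => P j ∧ Function.update v k true j = true) =
        insert k (Finset.univ.filter fun j => P j ∧ v j = true) := by
      ext j
      by_cases h : j = k
      · subst h; simp [hP]
      · simp [h]
    rw [this, Finset.card_insert_of_notMem (by simp [hv])]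
  · rw [add_zero]
    congr 1
    ext j
    by_cases h : j = k
    · subst h; simp [hP]
    · simp [h]

namespace SignedGaussCode

variable {D : SignedGaussCode}

theorem evalAt_of_not {R : Type*} [CommRing R] (h : R) (f : D.Gen → R) {v : D.Vertex}
    {κ : D.Edge → Bool} (hc : ¬ Compatible v κ) : evalAt h f v κ = 0 := dif_neg hc

theorem evalAt_add {R : Type*} [CommRing R] (h : R) (f f' : D.Gen → R) (v : D.Vertex)
    (κ : D.Edge → Bool) : evalAt h (f + f') v κ = evalAt h f v κ + evalAt h f' v κ := by
  unfold evalAt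
  split_ifs
  · rw [← Finset.sum_add_distrib]
    exact Finset.sum_congr rfl fun l _ => add_mul _ _ _
  · rw [add_zero]

theorem evalAt_smul {R : Type*} [CommRing R] (h a : R) (f : D.Gen → R) (v : D.Vertex)
    (κ : D.Edge → Bool) : evalAt h (a • f) v κ = a * evalAt h f v κ := by
  unfold evalAt
  split_ifs
  · rw [Finset.mul_sum]
    exact Finset.sum_congr rfl fun l _ => mul_assoc _ _ _
  · rw [mul_zero]

theorem evalAt_zero {R : Type*} [CommRing R] (h : R) (v : D.Vertex)
    (κ : D.Edge → Bool) : evalAt h (0 : D.Gen → R) v κ = 0 := by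
  simpa using evalAt_smul h 0 (0 : D.Gen → R) v κ

theorem evalAt_sub {R : Type*} [CommRing R] (h : R) (f f' : D.Gen → R) (v : D.Vertex)
    (κ : D.Edge → Bool) : evalAt h (f - f') v κ = evalAt h f v κ - evalAt h f' v κ := by
  rw [sub_eq_add_neg, ← neg_one_smul R f', evalAt_add, evalAt_smul]
  ring

theorem eq_of_evalAt_eq {R : Type*} [CommRing R] [IsDomain R] {h : R} (hh : h ≠ 0)
    {f f' : D.Gen → R} (H : ∀ v κ, Compatible v κ → evalAt h f v κ = evalAt h f' v κ) :
    f = f' := by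
  classical
  rw [← sub_eq_zero]
  ext ⟨v, l⟩
  refine congrFun (eq_zero_of_sum_labelValue hh (fun l => (f - f') ⟨v, l⟩) fun c => ?_) l
  have hc : Compatible v fun e => c (D.circleOf v e) := fun e e' he => congrArg c (Quot.sound he)
  have h1 := H v _ hc
  rw [← sub_eq_zero, ← evalAt_sub, evalAt, dif_pos hc] at h1
  have : Quot.lift _ hc = c := by ext ⟨e⟩; rfl
  rwa [this] at h1

theorem Compatible.interpolate {u v w : D.Vertex} {κ : D.Edge → Bool} (hv : Compatible v κ)
    (hw : Compatible w κ) (hu : ∀ k, u k = v k ∨ u k = w k) : Compatible u κ := by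
  intro e f he
  cases he with
  | oriented₁ k h =>
    exact (hu k).elim (fun h' => hv _ _ (.oriented₁ k (h' ▸ h)))
      fun h' => hw _ _ (.oriented₁ k (h' ▸ h))
  | oriented₂ k h =>
    exact (hu k).elim (fun h' => hv _ _ (.oriented₂ k (h' ▸ h)))
      fun h' => hw _ _ (.oriented₂ k (h' ▸ h))
  | unoriented₁ k h =>
    exact (hu k).elim (fun h' => hv _ _ (.unoriented₁ k (h' ▸ h)))
      fun h' => hw _ _ (.unoriented₁ k (h' ▸ h))
  | unoriented₂ k h =>
    exact (hu k).elim (fun h' => hv _ _ (.unoriented₂ k (h' ▸ h)))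
      fun h' => hw _ _ (.unoriented₂ k (h' ▸ h))

/-! ### The square of the differential -/

/-- The number of circles of a given colour plus the number of `1`-smoothings at crossings of this
colour. -/
def colourCount (v : D.Vertex) {κ : D.Edge → Bool} (hc : Compatible v κ) (c : Bool) : ℕ :=
  (∑ x, if Quot.lift κ hc x = c then 1 else 0) +
    (Finset.univ.filter fun k => κ (D.underIn k) = c ∧ v k = true).card

/-- A potential for the factors of the edges of the cube. -/
def cubePotential {R : Type*} [CommRing R] (h : R) (v : D.Vertex) {κ : D.Edge → Bool}
    (hc : Compatible v κ) : R :=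
  h ^ (colourCount v hc true / 2) * (-h) ^ (colourCount v hc false / 2)

open Classical in
-- A merger trades one circle of its colour for one `1`-smoothing of that colour; a split gains one
-- of each. Steps being 0 or 2, the halved counts change by exactly 0 or 1, despite the rounding.
theorem IsAlternating.colourCount_update {χ : D.Edge → Bool} (hχ : D.IsAlternating χ)
    {k : Fin D.n} {v w : D.Vertex}
    (hv : v k = false) (hw : w = Function.update v k true) {κ : D.Edge → Bool}
    (hcv : Compatible v κ) (hcw : Compatible w κ) (c : Bool) :
    colourCount w hcw c = colourCount v hcv c +
      if D.circleOf v (D.underIn k) = D.circleOf v (D.underOut k) ∧ κ (D.underIn k) = c then 2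
      else 0 := by
  have hm : (Finset.univ.filter fun k => κ (D.underIn k) = c ∧ w k = true).card =
      (Finset.univ.filter fun k => κ (D.underIn k) = c ∧ v k = true).card +
        if κ (D.underIn k) = c then 1 else 0 := by
    rw [hw]
    exact card_filter_update_and v k hv _
  unfold colourCount
  rw [hm]
  have lv : ∀ y e, y = D.circleOf v e → Quot.lift κ hcv y = κ e := fun y e he => by rw [he]; rfl
  have lw : ∀ y e, y = D.circleOf w e → Quot.lift κ hcw y = κ e := fun y e he => by rw [he]; rfl
  rcases hχ.merge_or_split hv hw with ⟨hpq, hm⟩ | ⟨hvpq, hpq, hm⟩ <;>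
    obtain ⟨Z, _, e₁, e₂, hp, hq, hp', hq', hz⟩ := hm.exists_equiv hpq <;>
    rw [← e₁.sum_comp, ← e₂.sum_comp, Fintype.sum_option, Fintype.sum_option, Fintype.sum_option]
  · have hzz : ∀ z, Quot.lift κ hcv (e₁ (some (some z))) = Quot.lift κ hcw (e₂ (some z)) := by
      intro z
      obtain ⟨a, ha⟩ := Quot.exists_rep (e₁ (some (some z)))
      rw [lv _ a ha.symm, lw _ a ((hz z a).1 ha.symm)]
    have h1 : κ (D.underOut k) = κ (D.underIn k) := by
      rw [← lw _ _ hp', ← lw _ _ hq']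
    have h2 : ¬ (D.circleOf v (D.underIn k) = D.circleOf v (D.underOut k) ∧
      κ (D.underIn k) = c) := fun h' => hpq h'.1
    simp only [hzz, lv _ _ hp, lv _ _ hq, lw _ _ hp', h1, if_neg h2]
    ring
  · have hzz : ∀ z, Quot.lift κ hcw (e₁ (some (some z))) = Quot.lift κ hcv (e₂ (some z)) := by
      intro z
      obtain ⟨a, ha⟩ := Quot.exists_rep (e₁ (some (some z)))
      rw [lw _ a ha.symm, lv _ a ((hz z a).1 ha.symm)]
    have h1 : κ (D.underOut k) = κ (D.underIn k) := by
      rw [← lv _ _ hp', ← lv _ _ hq']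
    simp only [hzz, lw _ _ hp, lw _ _ hq, lv _ _ hp', h1, hvpq, true_and]
    split_ifs <;> ring

/-- Edge factors are quotients of a vertex potential, so their product along two paths around a
square is the same. -/
theorem IsAlternating.edgeFactor_mul_cubePotential {χ : D.Edge → Bool} (hχ : D.IsAlternating χ)
    {R : Type*} [CommRing R] (h : R) {k : Fin D.n} {v w : D.Vertex}
    (hv : v k = false) (hw : w = Function.update v k true) {κ : D.Edge → Bool}
    (hcv : Compatible v κ) (hcw : Compatible w κ) :
    edgeFactor h v k κ * cubePotential h v hcv = cubePotential h w hcw := by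
  unfold cubePotential
  rw [hχ.colourCount_update hv hw hcv hcw, hχ.colourCount_update hv hw hcv hcw, edgeFactor]
  by_cases hpq : D.circleOf v (D.underIn k) = D.circleOf v (D.underOut k)
  · cases hκ : κ (D.underIn k) <;> simp only [hpq, true_and, if_true, if_false, add_zero,
      Bool.false_eq_true, Bool.true_eq_false, Nat.add_div_right _ two_pos, pow_succ] <;> ring
  · simp [hpq]

theorem countBefore_update (v : D.Vertex) (k l : Fin D.n) (hv : v l = false) :
    countBefore (Function.update v l true) k = countBefore v k + if l < k then 1 else 0 :=
  card_filter_update_and v l hv fun j => j < k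

theorem IsAlternating.differential_differential {χ : D.Edge → Bool} (hχ : D.IsAlternating χ)
    {R : Type*} [CommRing R] [IsDomain R] {h : R} (hh : h ≠ 0) (f : D.Gen → R) :
    D.differential h (D.differential h f) = 0 := by
  classical
  refine eq_of_evalAt_eq hh fun w κ hc => ?_
  rw [evalAt_zero]
  let A : Fin D.n → Fin D.n → R := fun k l =>
    if w k = true ∧ w l = true ∧ k ≠ l then
      (-1) ^ countBefore (Function.update w k false) k *
        edgeFactor h (Function.update w k false) k κ *
      ((-1) ^ countBefore (Function.update (Function.update w k false) l false) l *
        edgeFactor h (Function.update (Function.update w k false) l false) l κ *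
        evalAt h f (Function.update (Function.update w k false) l false) κ) else 0
  have hA : evalAt h (D.differential h (D.differential h f)) w κ = ∑ k, ∑ l, A k l := by
    rw [hχ.evalAt_differential h _ w hc]
    refine Finset.sum_congr rfl fun k _ => ?_
    split_ifs with hk
    · by_cases hck : Compatible (Function.update w k false) κ
      · rw [hχ.evalAt_differential h _ _ hck, Finset.mul_sum]
        refine Finset.sum_congr rfl fun l _ => ?_
        by_cases hlk : l = k
        · subst hlk; simp [A]
        · simp only [A, hk, Function.update_of_ne hlk, true_and, ne_eq, Ne.symm hlk,
            not_false_eq_true, and_true]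
          split_ifs <;> simp
      · rw [evalAt_of_not _ _ hck, mul_zero]
        refine (Finset.sum_eq_zero fun l _ => ?_).symm
        by_cases hlk : l = k
        · subst hlk; simp [A]
        simp only [A]
        -- A colouring compatible with two opposite corners of a square is compatible with the whole
        -- square, so no two-step term is lost.
        rw [evalAt_of_not h f (fun hkl => hck (hc.interpolate hkl fun j => ?_))]
        · simp
        · by_cases hj : j = l
          · subst hj; simp [hlk]
          · simp [hj]
    · simp [A, hk]
  -- The two paths around a square have opposite signs by `countBefore_update` and equal factors by
  -- the potential.
  have hanti : ∀ k l, A k l = -A l k := by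
    intro k l
    by_cases hkl : w k = true ∧ w l = true ∧ k ≠ l
    swap
    · have hlk : ¬ (w l = true ∧ w k = true ∧ l ≠ k) := fun h' => hkl ⟨h'.2.1, h'.1, h'.2.2.symm⟩
      simp only [A, if_neg hkl, if_neg hlk, neg_zero]
    have hlk : w l = true ∧ w k = true ∧ l ≠ k := ⟨hkl.2.1, hkl.1, hkl.2.2.symm⟩
    simp only [A, if_pos hkl, if_pos hlk]
    obtain ⟨hk, hl, hne⟩ := hkl
    rw [Function.update_comm hne.symm false false w]
    set u := Function.update (Function.update w k false) l false with hu
    by_cases hcu : Compatible u κ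
    swap
    · rw [evalAt_of_not h f hcu]; ring
    have huk : u k = false := by simp [hu, hne]
    have hul : u l = false := by simp [hu]
    have hwk : Function.update w k false = Function.update u l true := by
      ext j
      by_cases hj : j = l
      · subst hj; simp [hl, hne.symm]
      · simp [hu, hj]
    have hwl : Function.update w l false = Function.update u k true := by
      ext j
      by_cases hj : j = k
      · subst hj; simp [hk, hne]
      · by_cases hj' : j = l
        · subst hj'; simp [hu, hj]
        · simp [hu, hj, hj']
    have hwk' : w = Function.update (Function.update u l true) k true := by
      rw [← hwk, Function.update_idem, ← hk, Function.update_eq_self]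
    have hwl' : w = Function.update (Function.update u k true) l true := by
      rw [← hwl, Function.update_idem, ← hl, Function.update_eq_self]
    have hck : Compatible (Function.update u l true) κ := hc.interpolate hcu fun j => by
      by_cases hj : j = l
      · subst hj; simp [hl]
      · simp [hj]
    have hcl : Compatible (Function.update u k true) κ := hc.interpolate hcu fun j => by
      by_cases hj : j = k
      · subst hj; simp [hk]
      · simp [hj]
    rw [hwk, hwl, countBefore_update u k l hul, countBefore_update u l k huk]
    have p1 := hχ.edgeFactor_mul_cubePotential h (v := Function.update u l true) (k := k)
      (by simp [hne, huk]) hwk' hck hc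
    have p2 := hχ.edgeFactor_mul_cubePotential h (v := Function.update u k true) (k := l)
      (by simp [hne.symm, hul]) hwl' hcl hc
    rw [← hχ.edgeFactor_mul_cubePotential h hul rfl hcu, ← mul_assoc] at p1
    rw [← hχ.edgeFactor_mul_cubePotential h huk rfl hcu, ← mul_assoc] at p2
    have hne0 : cubePotential h u hcu ≠ 0 :=
      mul_ne_zero (pow_ne_zero _ hh) (pow_ne_zero _ (neg_ne_zero.2 hh))
    have hp := mul_right_cancel₀ hne0 (p1.trans p2.symm)
    rcases lt_or_gt_of_ne hne with h' | h'
    · rw [if_neg h'.not_gt, if_pos h', add_zero, pow_succ]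
      linear_combination (-1) ^ countBefore u k * (-1) ^ countBefore u l * evalAt h f u κ * hp
    · rw [if_pos h', if_neg h'.not_gt, add_zero, pow_succ]
      linear_combination -(-1) ^ countBefore u k * (-1) ^ countBefore u l * evalAt h f u κ * hp
  rw [hA, ← Fintype.sum_prod_type']
  refine Finset.sum_involution (fun x _ => x.swap) (fun x _ => ?_) (fun x _ hx hx' => hx ?_)
    (fun _ _ => Finset.mem_univ _) (fun _ _ => Prod.swap_swap _)
  · rw [hanti]
    exact neg_add_cancel _
  · have : x.2 = x.1 := congrArg Prod.fst hx'
    simp [A, this]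

end SignedGaussCode
end

noncomputable section

theorem sum_eq_sum_ite_update {ι M : Type*} [Fintype ι] [DecidableEq ι] [AddCommMonoid M] (i : ι)
    (G : (ι → Bool) → M) :
    ∑ l, G l = ∑ l, if l i = true then G l + G (Function.update l i false) else 0 := by
  have h1 : ∑ l, (if l i = true then G (Function.update l i false) else 0) =
      ∑ l, if ¬ l i = true then G l else 0 := by
    rw [← Finset.sum_filter, ← Finset.sum_filter]
    refine Finset.sum_nbij' (fun l => Function.update l i false) (fun l => Function.update l i true)
      ?_ ?_ ?_ ?_ ?_
    · intro l _; simp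
    · intro l _; simp
    · intro l hl
      have : l i = true := by simpa using hl
      rw [Function.update_idem, ← this, Function.update_eq_self]
    · intro l hl
      have : l i = false := by simpa using hl
      rw [Function.update_idem, ← this, Function.update_eq_self]
    · intro l _; rfl
  have h2 : ∀ l : ι → Bool, (if l i = true then G l + G (Function.update l i false) else 0) =
      (if l i = true then G l else 0) + if l i = true then G (Function.update l i false) else 0 :=
    fun l => by split_ifs <;> simp
  simp only [h2, Finset.sum_add_distrib, h1]
  rw [← Finset.sum_add_distrib]
  exact Finset.sum_congr rfl fun l _ => by split_ifs <;> simp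

namespace SignedGaussCode

variable {D : SignedGaussCode}

theorem labelValue_update {R : Type*} [CommRing R] (h : R) {ι : Type*} [Fintype ι] [DecidableEq ι]
    (l c : ι → Bool) (i : ι) (hl : l i = true) :
    labelValue h l c = (if c i then h else 0) * labelValue h (Function.update l i false) c := by
  unfold labelValue
  rw [← Finset.mul_prod_erase _ _ (Finset.mem_univ i), ← Finset.mul_prod_erase _ (fun j =>
    rootValue h (Function.update l i false j) (c j)) (Finset.mem_univ i), hl,
    Function.update_self]
  have : ∀ j ∈ Finset.univ.erase i, rootValue h (Function.update l i false j) (c j) =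
      rootValue h (l j) (c j) := fun j hj => by
    rw [Function.update_of_ne (Finset.ne_of_mem_erase hj)]
  rw [Finset.prod_congr rfl this]
  cases c i <;> simp [rootValue]

/-! ### Multiplication by `x` at the base point -/

open Classical in
/-- Change the label of the circle through an edge. -/
def setLabel (g : D.Gen) (b : D.Edge) (a : Bool) : D.Gen :=
  ⟨g.1, Function.update g.2 (D.circleOf g.1 b) a⟩

/-- Restriction of a cochain to the generators with label `x` at the base point. -/
def projX {R : Type*} [CommRing R] (b : D.Edge) : (D.Gen → R) →ₗ[R] (D.Gen → R) where
  toFun f g := if g.label b = true then f g else 0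
  map_add' f f' := by ext g; by_cases h : g.label b = true <;> simp [h]
  map_smul' r f := by ext g; by_cases h : g.label b = true <;> simp [h]

/-- Multiplication by `x` at the base point, if `x ^ 2 = h * x`. -/
def mulX {R : Type*} [CommRing R] (h : R) (b : D.Edge) : (D.Gen → R) →ₗ[R] (D.Gen → R) where
  toFun f g := if g.label b = true then f (setLabel g b false) + h * f g else 0
  map_add' f f' := by ext g; by_cases h : g.label b = true <;> simp [h]; ring
  map_smul' r f := by ext g; by_cases h : g.label b = true <;> simp [h]; ring

theorem mulX_eq {R : Type*} [CommRing R] (h : R) (b : D.Edge) (f : D.Gen → R) :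
    mulX h b f = mulX 0 b f + h • projX b f := by
  ext g
  by_cases h : g.label b = true <;> simp [mulX, projX, h]

/-- The factor is the root chosen on the circle through `b`. The sum is grouped into pairs of
labellings that differ only on that circle. -/
theorem evalAt_mulX {R : Type*} [CommRing R] (h : R) (b : D.Edge) (f : D.Gen → R) (v : D.Vertex)
    (κ : D.Edge → Bool) : evalAt h (mulX h b f) v κ = (if κ b then h else 0) * evalAt h f v κ := by
  classical
  by_cases hc : Compatible v κ
  swap
  · rw [evalAt_of_not _ _ hc, evalAt_of_not _ _ hc, mul_zero]
  rw [evalAt, evalAt, dif_pos hc, dif_pos hc,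
    sum_eq_sum_ite_update (D.circleOf v b) fun l => f ⟨v, l⟩ * labelValue h l (Quot.lift κ hc),
    Finset.mul_sum]
  refine Finset.sum_congr rfl fun l _ => ?_
  have hκ : Quot.lift κ hc (D.circleOf v b) = κ b := rfl
  by_cases hl : l (D.circleOf v b) = true
  · rw [if_pos hl, labelValue_update h l _ _ hl, hκ]
    have h1 : mulX h b f ⟨v, l⟩ =
        f ⟨v, Function.update l (D.circleOf v b) false⟩ + h * f ⟨v, l⟩ := if_pos hl
    rw [h1]
    split_ifs <;> ring
  · have h1 : mulX h b f ⟨v, l⟩ = 0 := if_neg hl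
    rw [if_neg hl, h1, zero_mul, mul_zero]

theorem IsAlternating.differential_mulX {χ : D.Edge → Bool} (hχ : D.IsAlternating χ)
    {R : Type*} [CommRing R] [IsDomain R] {h : R} (hh : h ≠ 0) (b : D.Edge) (f : D.Gen → R) :
    D.differential h (mulX h b f) = mulX h b (D.differential h f) := by
  refine eq_of_evalAt_eq hh fun w κ hc => ?_
  rw [evalAt_mulX, hχ.evalAt_differential _ _ _ hc, hχ.evalAt_differential _ _ _ hc, Finset.mul_sum]
  refine Finset.sum_congr rfl fun k _ => ?_
  rw [evalAt_mulX]
  split_ifs <;> ring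

/-! ### The substitution `x ↦ x + h` -/

/-- The coefficient of `x ^ a` in `(x + h) ^ b`. -/
def shiftCoeff {R : Type*} [CommRing R] (h : R) (a b : Bool) : R :=
  if a = b then 1 else if b then h else 0

open Classical in
/-- The substitution `x ↦ x + h` in all labels. -/
def shift {R : Type*} [CommRing R] (h : R) (f : D.Gen → R) : D.Gen → R := fun g =>
  ∑ l : D.Circle g.1 → Bool, (∏ x, shiftCoeff h (g.2 x) (l x)) * f ⟨g.1, l⟩

theorem Compatible.not {v : D.Vertex} {κ : D.Edge → Bool} (hc : Compatible v κ) :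
    Compatible v fun e => !κ e := fun e f he => congrArg _ (hc e f he)

/-- The map `x ↦ x + h` takes the roots `0`, `-h` of `x² = -h x` to the roots `h`, `0` of `x² = h
x`, so the colours are exchanged. -/
theorem evalAt_shift {R : Type*} [CommRing R] (h : R) (f : D.Gen → R) (v : D.Vertex)
    (κ : D.Edge → Bool) : evalAt (-h) (shift h f) v κ = evalAt h f v fun e => !κ e := by
  classical
  by_cases hc : Compatible v κ
  swap
  · rw [evalAt_of_not _ _ hc, evalAt_of_not _ _ fun hc' => hc (by simpa using hc'.not)]
  rw [evalAt, evalAt, dif_pos hc, dif_pos hc.not]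
  have hs : ∀ l, shift h f ⟨v, l⟩ = ∑ l' : D.Circle v → Bool,
    (∏ x, shiftCoeff h (l x) (l' x)) * f ⟨v, l'⟩ := fun _ => rfl
  simp only [hs, Finset.sum_mul]
  rw [Finset.sum_comm]
  refine Finset.sum_congr rfl fun l' _ => ?_
  have h1 : labelValue h l' (Quot.lift _ hc.not) = ∏ x, ∑ a : Bool,
      shiftCoeff h a (l' x) * rootValue (-h) a (Quot.lift κ hc x) := by
    refine Finset.prod_congr rfl fun x _ => ?_
    have : Quot.lift _ hc.not x = !Quot.lift κ hc x := by
      obtain ⟨e⟩ := x; rfl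
    rw [this]
    cases l' x <;> cases Quot.lift κ hc x <;> simp [shiftCoeff, rootValue]
  rw [h1, Finset.prod_univ_sum, Fintype.piFinset_univ, Finset.mul_sum]
  refine Finset.sum_congr rfl fun l _ => ?_
  rw [Finset.prod_mul_distrib, labelValue]
  ring

theorem edgeFactor_not {R : Type*} [CommRing R] (h : R) (v : D.Vertex) (k : Fin D.n)
    (κ : D.Edge → Bool) : edgeFactor h v k (fun e => !κ e) = edgeFactor (-h) v k κ := by
  unfold edgeFactor
  cases hk : κ (D.underIn k) <;> simp [hk]

theorem IsAlternating.differential_shift {χ : D.Edge → Bool} (hχ : D.IsAlternating χ)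
    {R : Type*} [CommRing R] [IsDomain R] {h : R} (hh : h ≠ 0) (f : D.Gen → R) :
    D.differential (-h) (shift h f) = shift h (D.differential h f) := by
  refine eq_of_evalAt_eq (neg_ne_zero.2 hh) fun w κ hc => ?_
  rw [evalAt_shift, hχ.evalAt_differential _ _ _ hc, hχ.evalAt_differential _ _ _ hc.not]
  refine Finset.sum_congr rfl fun k _ => ?_
  rw [evalAt_shift, edgeFactor_not]

theorem shift_mulX {R : Type*} [CommRing R] [IsDomain R] {h : R} (hh : h ≠ 0) (b : D.Edge)
    (f : D.Gen → R) : shift h (mulX h b f) = mulX (-h) b (shift h f) + h • shift h f := by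
  refine eq_of_evalAt_eq (neg_ne_zero.2 hh) fun w κ hc => ?_
  rw [evalAt_shift, evalAt_mulX, evalAt_add, evalAt_smul, evalAt_mulX, evalAt_shift]
  cases κ b <;> simp

/-! ### Expansion of the shift in powers of `h` -/

open Classical in
/-- The number of circles on which two labellings differ. -/
def labelDist {ι : Type*} [Fintype ι] (l l' : ι → Bool) : ℕ :=
  (Finset.univ.filter fun x => l x ≠ l' x).card

open Classical in
theorem prod_shiftCoeff {R : Type*} [CommRing R] (h : R) {ι : Type*} [Fintype ι] (l l' : ι → Bool) :
    ∏ x, shiftCoeff h (l x) (l' x) = if l ≤ l' then h ^ labelDist l l' else 0 := by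
  split_ifs with hle
  · rw [labelDist, ← Finset.prod_const, Finset.prod_filter]
    refine Finset.prod_congr rfl fun x _ => ?_
    have := hle x
    revert this
    cases l x <;> cases l' x <;> simp [shiftCoeff]
  · obtain ⟨x, hx⟩ := not_forall.1 hle
    refine Finset.prod_eq_zero (Finset.mem_univ x) ?_
    revert hx
    cases l x <;> cases l' x <;> simp [shiftCoeff]

theorem qdeg_of_le {v : D.Vertex} {l l' : D.Circle v → Bool} (hle : l ≤ l') :
    Gen.qdeg (D := D) ⟨v, l⟩ = Gen.qdeg (D := D) ⟨v, l'⟩ + 2 * labelDist l l' := by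
  rw [qdeg_eq, qdeg_eq]
  have h1 : ∑ x, labelDegree (l x) = ∑ x, labelDegree (l' x) + 2 * labelDist l l' := by
    rw [labelDist, Finset.card_filter]
    push_cast
    rw [Finset.mul_sum, ← Finset.sum_add_distrib]
    refine Finset.sum_congr rfl fun x _ => ?_
    have := hle x
    revert this
    cases l x <;> cases l' x <;> simp [labelDegree]
  have h2 : Gen.height (D := D) ⟨v, l⟩ = Gen.height (D := D) ⟨v, l'⟩ := rfl
  rw [h2]
  simp only [h1]
  ring

open Classical in
/-- The derivation `x ↦ 1` in all labels. -/
def derivX {R : Type*} [CommRing R] : (D.Gen → R) →ₗ[R] (D.Gen → R) where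
  toFun f g := ∑ l : D.Circle g.1 → Bool,
    if g.2 ≤ l ∧ labelDist g.2 l = 1 then f ⟨g.1, l⟩ else 0
  map_add' f f' := by
    ext g
    simp only [Pi.add_apply]
    rw [← Finset.sum_add_distrib]
    exact Finset.sum_congr rfl fun l _ => by split_ifs <;> simp
  map_smul' r f := by
    ext g
    simp only [Pi.smul_apply, smul_eq_mul, RingHom.id_apply]
    rw [Finset.mul_sum]
    exact Finset.sum_congr rfl fun l _ => by split_ifs <;> simp

theorem labelDist_eq_zero {ι : Type*} [Fintype ι] {l l' : ι → Bool} :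
    labelDist l l' = 0 ↔ l = l' := by
  classical
  rw [labelDist, Finset.card_eq_zero, Finset.filter_eq_empty_iff]
  simp [funext_iff]

/-- Replacing `x` by `h` on `d` circles carries the factor `h ^ d`; `derivX` collects the terms with
`d = 1`. -/
theorem exists_shift_eq {R : Type*} [CommRing R] (h : R) (f : D.Gen → R) :
    ∃ e, shift h f = f + h • derivX f + h ^ 2 • e := by
  classical
  refine ⟨fun g => ∑ l : D.Circle g.1 → Bool,
    (if g.2 ≤ l ∧ 2 ≤ labelDist g.2 l then h ^ (labelDist g.2 l - 2) else 0) * f ⟨g.1, l⟩, ?_⟩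
  ext g
  have h1 : f g = ∑ l : D.Circle g.1 → Bool, if g.2 = l then f ⟨g.1, l⟩ else 0 := by
    rw [Finset.sum_ite_eq, if_pos (Finset.mem_univ _)]
  simp only [Pi.add_apply, Pi.smul_apply, smul_eq_mul, shift, derivX, LinearMap.coe_mk,
    AddHom.coe_mk]
  conv_rhs => rw [h1]
  rw [Finset.mul_sum, Finset.mul_sum, ← Finset.sum_add_distrib, ← Finset.sum_add_distrib]
  refine Finset.sum_congr rfl fun l _ => ?_
  rw [prod_shiftCoeff]
  by_cases hle : g.2 ≤ l
  · rcases hd : labelDist g.2 l with _ | _ | d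
    · have := labelDist_eq_zero.1 hd
      simp [this]
    · have : g.2 ≠ l := fun h' => by rw [labelDist_eq_zero.2 h'] at hd; omega
      simp [this, hle]
    · have : g.2 ≠ l := fun h' => by rw [labelDist_eq_zero.2 h'] at hd; omega
      simp [this, hle, pow_succ]
      ring
  · have : g.2 ≠ l := fun h' => hle h'.le
    simp [this, hle]

end SignedGaussCode
end

noncomputable section
namespace SignedGaussCode

variable {D : SignedGaussCode}

/-! ### The terms of the differential of degrees `0` and `2` -/

/-- The coefficient of `h` in the differential. -/
def differentialOne (D : SignedGaussCode) (R : Type*) [CommRing R] : (D.Gen → R) →ₗ[R] (D.Gen → R) :=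
  D.differential 1 - D.differential 0

theorem differential_eq {R : Type*} [CommRing R] (h : R) (f : D.Gen → R) :
    D.differential h f = D.differential 0 f + h • D.differentialOne R f := by
  ext g'
  simp only [differentialOne, LinearMap.sub_apply, Pi.add_apply, Pi.smul_apply, Pi.sub_apply,
    differential_apply, smul_eq_mul]
  rw [← Finset.sum_sub_distrib, Finset.mul_sum, ← Finset.sum_add_distrib]
  refine Finset.sum_congr rfl fun g _ => ?_
  rw [Finset.sum_congr rfl fun k _ => edgeCoeff_linear h k g g', Finset.sum_add_distrib,
    ← Finset.mul_sum, Finset.sum_sub_distrib]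
  ring

/-- Comparison of the coefficients of `h` using integer values of `h`: each entry of the difference
is divisible by every nonzero `h`, in particular by one larger than its absolute value. -/
theorem eq_of_forall_smul_eq {ι : Type*} {f f' : ι → ℤ}
    (H : ∀ h : ℤ, h ≠ 0 → ∃ e, h • f = h • f' + h ^ 2 • e) : f = f' := by
  rw [← sub_eq_zero]
  ext i
  obtain ⟨e, he⟩ := H (|(f - f') i| + 1) (by positivity)
  have h1 := congrFun he i
  simp only [Pi.smul_apply, Pi.add_apply, smul_eq_mul, Pi.sub_apply] at h1
  have h2 : f i - f' i = (|f i - f' i| + 1) * e i := by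
    have h3 : |f i - f' i| + 1 ≠ 0 := by positivity
    apply mul_left_cancel₀ h3
    linear_combination h1
  exact Int.eq_zero_of_abs_lt_dvd ⟨e i, h2⟩ (by simp)

theorem eq_of_forall_eq_add_smul {ι : Type*} {f f' : ι → ℤ}
    (H : ∀ h : ℤ, h ≠ 0 → ∃ e, f = f' + h • e) : f = f' :=
  eq_of_forall_smul_eq fun h hh => by
    obtain ⟨e, he⟩ := H h hh
    exact ⟨e, by rw [he]; ext i; simp; ring⟩

/-- Evaluation needs `h ≠ 0`; the case `h = 0` is the constant term of `differential_differential`.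
-/
theorem IsAlternating.differential_zero_differential_zero {χ : D.Edge → Bool}
    (hχ : D.IsAlternating χ) (f : D.Gen → ℤ) :
    D.differential 0 (D.differential 0 f) = 0 := by
  refine eq_of_forall_eq_add_smul fun h hh => ?_
  have h1 := hχ.differential_differential hh f
  rw [differential_eq, differential_eq h f, map_add, map_smul] at h1
  refine ⟨-(D.differential 0 (D.differentialOne ℤ f) +
    D.differentialOne ℤ (D.differential 0 f + h • D.differentialOne ℤ f)), ?_⟩
  rw [zero_add, smul_neg, smul_add, ← sub_eq_zero, ← h1]
  abel

theorem IsAlternating.differential_zero_mulX {χ : D.Edge → Bool}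
    (hχ : D.IsAlternating χ) (b : D.Edge) (f : D.Gen → ℤ) :
    D.differential 0 (mulX 0 b f) = mulX 0 b (D.differential 0 f) := by
  refine eq_of_forall_eq_add_smul fun h hh => ?_
  have h1 := hχ.differential_mulX hh b f
  rw [mulX_eq h, mulX_eq h, differential_eq h f, differential_eq h] at h1
  simp only [map_add, map_smul] at h1
  refine ⟨mulX 0 b (D.differentialOne ℤ f) + projX b (D.differential 0 f + h • D.differentialOne ℤ f)
    - D.differential 0 (projX b f) - D.differentialOne ℤ (mulX 0 b f + h • projX b f), ?_⟩
  ext g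
  have h2 := congrFun h1 g
  simp only [map_add, map_smul, Pi.add_apply, Pi.smul_apply, Pi.sub_apply, smul_eq_mul] at h2 ⊢
  linear_combination h2

/-- The coefficient of `h` in `differential_shift`. The term with `differentialOne` is doubled
because the shift turns `h` into `-h`. -/
theorem IsAlternating.differential_zero_derivX {χ : D.Edge → Bool}
    (hχ : D.IsAlternating χ) (f : D.Gen → ℤ) :
    D.differential 0 (derivX f) =
      derivX (D.differential 0 f) + (2 : ℤ) • D.differentialOne ℤ f := by
  refine eq_of_forall_smul_eq fun h hh => ?_
  have h1 := hχ.differential_shift hh f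
  obtain ⟨e, he⟩ := exists_shift_eq h f
  obtain ⟨e', he'⟩ := exists_shift_eq h (D.differential h f)
  rw [he', he, differential_eq (-h), differential_eq h] at h1
  simp only [map_add, map_smul] at h1
  refine ⟨derivX (D.differentialOne ℤ f) + e' - D.differential 0 e +
    D.differentialOne ℤ (derivX f) + h • D.differentialOne ℤ e, ?_⟩
  ext g
  have h2 := congrFun h1 g
  simp only [Pi.add_apply, Pi.smul_apply, Pi.sub_apply, smul_eq_mul] at h2 ⊢
  linear_combination h2

/-- The coefficient of `h` in `shift_mulX`, where `projX` enters once from `mulX h` and once from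
`mulX (-h)`. -/
theorem derivX_mulX (b : D.Edge) (f : D.Gen → ℤ) :
    derivX (mulX 0 b f) = mulX 0 b (derivX f) + f - (2 : ℤ) • projX b f := by
  refine eq_of_forall_smul_eq fun h hh => ?_
  have h1 := shift_mulX hh b f
  obtain ⟨e, he⟩ := exists_shift_eq h f
  obtain ⟨e', he'⟩ := exists_shift_eq h (mulX h b f)
  rw [he', he, mulX_eq (-h), mulX_eq h] at h1
  simp only [map_add, map_smul] at h1
  refine ⟨mulX 0 b e - projX b (derivX f) - h • projX b e + derivX f + h • e -
    derivX (projX b f) - e', ?_⟩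
  ext g
  have h2 := congrFun h1 g
  simp only [Pi.add_apply, Pi.smul_apply, Pi.sub_apply, smul_eq_mul] at h2 ⊢
  linear_combination h2

/-! ### Degrees of the maps -/

/-- A product with a factor `x` is a multiple of `x`, and `Δ x = x ⊗ x`: the label `x` at the base
point persists. -/
theorem IsAlternating.label_of_edgeCoeff_ne_zero {χ : D.Edge → Bool} (hχ : D.IsAlternating χ)
    {R : Type*} [CommRing R] {h : R} {k : Fin D.n} {g g' : D.Gen} {b : D.Edge}
    (hg : D.edgeCoeff h k g g' ≠ 0) (hb : g.label b = true) : g'.label b = true := by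
  classical
  obtain ⟨v, l⟩ := g
  obtain ⟨w, l'⟩ := g'
  obtain ⟨hv, hw⟩ := not_imp_comm.1 (edgeCoeff_of_not h k _ _) hg
  simp only at hv hw
  change l (D.circleOf v b) = true at hb
  change l' (D.circleOf w b) = true
  rcases hχ.merge_or_split hv hw with ⟨hpq, hm⟩ | ⟨-, hpq, hm⟩ <;>
    obtain ⟨Z, _, e₁, e₂, hp, hq, hp', hq', hz⟩ := hm.exists_equiv hpq
  · rw [edgeCoeff_merge _ hv hw hp hq hp' hz] at hg
    have hg := right_ne_zero_of_mul hg
    split_ifs at hg with H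
    · obtain ⟨y, hy⟩ := e₁.surjective (D.circleOf v b)
      rcases y with _ | _ | z
      · have : e₂ none = D.circleOf w b :=
          hp'.trans ((hm _ _).2 (Or.inl (hp.symm.trans hy)))
        rw [← hy] at hb
        rw [← this]
        rw [hb] at hg
        revert hg
        cases l (e₁ (some none)) <;> cases l' (e₂ none) <;> simp [frobeniusMul]
      · have : e₂ none = D.circleOf w b :=
          hq'.trans ((hm _ _).2 (Or.inl (hq.symm.trans hy)))
        rw [← hy] at hb
        rw [← this]
        rw [hb] at hg
        revert hg
        cases l (e₁ none) <;> cases l' (e₂ none) <;> simp [frobeniusMul]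
      · have h1 : e₂ (some z) = D.circleOf w b := (hz z b).1 hy
        rw [← h1, H, hy, hb]
    · exact absurd rfl hg
  · rw [edgeCoeff_split _ hv hw hp hq hp' hq' hz] at hg
    have hg := right_ne_zero_of_mul hg
    split_ifs at hg with H
    · obtain ⟨y, hy⟩ := e₂.surjective (D.circleOf v b)
      rcases y with _ | z
      · rw [← hy] at hb
        rw [hb] at hg
        have h2 : l' (e₁ none) = true ∧ l' (e₁ (some none)) = true := by
          revert hg
          cases l' (e₁ none) <;> cases l' (e₁ (some none)) <;> simp [frobeniusComul]
        rw [hp, hq] at h2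
        rcases (hm _ _).1 (hy.symm.trans hp') with h' | ⟨h' | h', -⟩
        · exact (congrArg l' h').trans h2.1
        · exact (congrArg l' h').trans h2.1
        · exact (congrArg l' h').trans h2.2
      · have h1 : e₁ (some (some z)) = D.circleOf w b := (hz z b).2 hy
        rw [← h1, H, hy, hb]
    · exact absurd rfl hg

theorem exists_of_differential_ne_zero {R : Type*} [CommRing R] {h : R} {f : D.Gen → R} {g' : D.Gen}
    (hg : D.differential h f g' ≠ 0) : ∃ g k, f g ≠ 0 ∧ D.edgeCoeff h k g g' ≠ 0 := by
  rw [differential_apply] at hg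
  obtain ⟨g, -, hg⟩ := Finset.exists_ne_zero_of_sum_ne_zero hg
  obtain ⟨k, -, hk⟩ := Finset.exists_ne_zero_of_sum_ne_zero (left_ne_zero_of_mul hg)
  exact ⟨g, k, right_ne_zero_of_mul hg, hk⟩

theorem exists_of_differentialOne_ne_zero {R : Type*} [CommRing R] {f : D.Gen → R} {g' : D.Gen}
    (hg : D.differentialOne R f g' ≠ 0) :
    ∃ g k, f g ≠ 0 ∧ D.edgeCoeff (1 : R) k g g' - D.edgeCoeff 0 k g g' ≠ 0 := by
  simp only [differentialOne, LinearMap.sub_apply, Pi.sub_apply, differential_apply] at hg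
  rw [← Finset.sum_sub_distrib] at hg
  obtain ⟨g, -, hg⟩ := Finset.exists_ne_zero_of_sum_ne_zero hg
  rw [← sub_mul, ← Finset.sum_sub_distrib] at hg
  obtain ⟨k, -, hk⟩ := Finset.exists_ne_zero_of_sum_ne_zero (left_ne_zero_of_mul hg)
  exact ⟨g, k, right_ne_zero_of_mul hg, hk⟩

theorem mem_cochains {R : Type*} [CommRing R] {P : D.Gen → Prop} {f : D.Gen → R} :
    f ∈ D.cochains R P ↔ ∀ g, f g ≠ 0 → P g :=
  forall_congr' fun _ => not_imp_comm

theorem cochains_mono {R : Type*} [CommRing R] {P Q : D.Gen → Prop} (h : ∀ g, P g → Q g) :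
    D.cochains R P ≤ D.cochains R Q :=
  fun _ hf g hg => hf g fun hP => hg (h g hP)

theorem IsAlternating.differential_zero_mem {χ : D.Edge → Bool} (hχ : D.IsAlternating χ)
    {R : Type*} [CommRing R] {i q : ℤ} {f : D.Gen → R}
    (hf : f ∈ D.cochains R fun g => g.hdeg = i ∧ g.qdeg = q) :
    D.differential 0 f ∈ D.cochains R fun g => g.hdeg = i + 1 ∧ g.qdeg = q := by
  rw [mem_cochains] at hf ⊢
  intro g' hg'
  obtain ⟨g, k, h1, h2⟩ := exists_of_differential_ne_zero hg'
  obtain ⟨h3, h4⟩ := hf g h1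
  exact ⟨by rw [hdeg_eq_of_edgeCoeff_ne_zero h2, h3],
    by rw [(hχ.qdeg_eq_of_edgeCoeff k g g').1 h2, h4]⟩

theorem IsAlternating.differentialOne_mem {χ : D.Edge → Bool} (hχ : D.IsAlternating χ)
    {R : Type*} [CommRing R] {i q : ℤ} {f : D.Gen → R}
    (hf : f ∈ D.cochains R fun g => g.hdeg = i ∧ g.qdeg = q) :
    D.differentialOne R f ∈ D.cochains R fun g => g.hdeg = i + 1 ∧ g.qdeg = q + 2 := by
  rw [mem_cochains] at hf ⊢
  intro g' hg'
  obtain ⟨g, k, h1, h2⟩ := exists_of_differentialOne_ne_zero hg'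
  obtain ⟨h3, h4⟩ := hf g h1
  have h5 : g'.hdeg = g.hdeg + 1 := by
    by_cases h6 : D.edgeCoeff (0 : R) k g g' = 0
    · rw [h6, sub_zero] at h2
      exact hdeg_eq_of_edgeCoeff_ne_zero h2
    · exact hdeg_eq_of_edgeCoeff_ne_zero h6
  exact ⟨by rw [h5, h3], by rw [(hχ.qdeg_eq_of_edgeCoeff k g g').2 h2, h4]⟩

theorem IsAlternating.differential_mem_label {χ : D.Edge → Bool} (hχ : D.IsAlternating χ)
    {R : Type*} [CommRing R] {h : R} {b : D.Edge} {f : D.Gen → R}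
    (hf : f ∈ D.cochains R fun g => g.label b = true) :
    D.differential h f ∈ D.cochains R fun g => g.label b = true := by
  rw [mem_cochains] at hf ⊢
  intro g' hg'
  obtain ⟨g, k, h1, h2⟩ := exists_of_differential_ne_zero hg'
  exact hχ.label_of_edgeCoeff_ne_zero h2 (hf g h1)

theorem IsAlternating.differentialOne_mem_label {χ : D.Edge → Bool} (hχ : D.IsAlternating χ)
    {R : Type*} [CommRing R] {b : D.Edge} {f : D.Gen → R}
    (hf : f ∈ D.cochains R fun g => g.label b = true) :
    D.differentialOne R f ∈ D.cochains R fun g => g.label b = true :=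
  Submodule.sub_mem _ (hχ.differential_mem_label hf) (hχ.differential_mem_label hf)

theorem qdeg_setLabel {g : D.Gen} {b : D.Edge} (hb : g.label b = true) :
    (setLabel g b false).qdeg = g.qdeg + 2 := by
  classical
  obtain ⟨v, l⟩ := g
  change l (D.circleOf v b) = true at hb
  have hle : Function.update l (D.circleOf v b) false ≤ l := by
    intro x
    by_cases hx : x = D.circleOf v b
    · subst hx; simp
    · simp [hx]
  have hd : labelDist (Function.update l (D.circleOf v b) false) l = 1 := by
    rw [labelDist, Finset.card_eq_one]
    refine ⟨D.circleOf v b, ?_⟩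
    ext x
    by_cases hx : x = D.circleOf v b
    · subst hx; simp [hb]
    · simp [hx]
  have := qdeg_of_le hle
  rw [hd] at this
  simpa [setLabel] using this

theorem label_setLabel (g : D.Gen) (b : D.Edge) (a : Bool) : (setLabel g b a).label b = a := by
  classical
  exact Function.update_self (D.circleOf g.1 b) a g.2

theorem setLabel_setLabel (g : D.Gen) (b : D.Edge) (a c : Bool) :
    setLabel (setLabel g b a) b c = setLabel g b c := by
  classical
  unfold setLabel
  simp

theorem setLabel_label (g : D.Gen) (b : D.Edge) : setLabel g b (g.label b) = g := by
  classical
  unfold setLabel Gen.label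
  simp

theorem mulX_zero_mem {R : Type*} [CommRing R] {i q : ℤ} {b : D.Edge} {f : D.Gen → R}
    (hf : f ∈ D.cochains R fun g => g.hdeg = i ∧ g.qdeg = q) :
    mulX 0 b f ∈ D.cochains R fun g => g.hdeg = i ∧ g.label b = true ∧ g.qdeg = q - 2 := by
  rw [mem_cochains] at hf ⊢
  intro g hg
  by_cases hb : g.label b = true
  · have h1 : mulX 0 b f g = f (setLabel g b false) := by simp [mulX, hb]
    rw [h1] at hg
    obtain ⟨h2, h3⟩ := hf _ hg
    rw [qdeg_setLabel hb] at h3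
    exact ⟨h2, hb, by omega⟩
  · exact absurd (if_neg hb) hg

theorem projX_mem {R : Type*} [CommRing R] {i q : ℤ} {b : D.Edge} {f : D.Gen → R}
    (hf : f ∈ D.cochains R fun g => g.hdeg = i ∧ g.qdeg = q) :
    projX b f ∈ D.cochains R fun g => g.hdeg = i ∧ g.label b = true ∧ g.qdeg = q := by
  rw [mem_cochains] at hf ⊢
  intro g hg
  by_cases hb : g.label b = true
  · have h1 : projX b f g = f g := if_pos hb
    rw [h1] at hg
    exact ⟨(hf g hg).1, hb, (hf g hg).2⟩
  · exact absurd (if_neg hb) hg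

theorem derivX_mem {R : Type*} [CommRing R] {i q : ℤ} {f : D.Gen → R}
    (hf : f ∈ D.cochains R fun g => g.hdeg = i ∧ g.qdeg = q) :
    derivX f ∈ D.cochains R fun g => g.hdeg = i ∧ g.qdeg = q + 2 := by
  classical
  rw [mem_cochains] at hf ⊢
  intro g hg
  obtain ⟨l, -, hl⟩ := Finset.exists_ne_zero_of_sum_ne_zero hg
  split_ifs at hl with h1
  · obtain ⟨h2, h3⟩ := hf _ hl
    have h4 := qdeg_of_le h1.1
    rw [h1.2, h3] at h4
    exact ⟨h2, by simpa using h4⟩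
  · exact absurd rfl hl

theorem mulX_zero_eq_zero_iff {R : Type*} [CommRing R] {b : D.Edge} {f : D.Gen → R} :
    mulX 0 b f = 0 ↔ f ∈ D.cochains R fun g => g.label b = true := by
  rw [mem_cochains]
  constructor
  · intro h g hg
    by_contra hb
    have hb' : g.label b = false := by simpa using hb
    have h1 := congrFun h (setLabel g b true)
    have h2 : mulX 0 b f (setLabel g b true) = f g := by
      have : setLabel (setLabel g b true) b false = g := by
        rw [setLabel_setLabel, ← hb', setLabel_label]
      simp [mulX, label_setLabel, this]
    rw [h2] at h1
    exact hg h1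
  · intro h
    ext g
    by_cases hb : g.label b = true
    · have : f (setLabel g b false) = 0 := by
        by_contra h'
        have := h _ h'
        rw [label_setLabel] at this
        exact absurd this (by simp)
      simp [mulX, this]
    · exact if_neg hb

/-- Together with `mulX_zero_eq_zero_iff`, this makes the reduced complex both the image and the
kernel of `mulX 0 b`. The preimage relabels the base circle from `x` to `1`. -/
theorem exists_mulX_zero_eq {R : Type*} [CommRing R] {i q : ℤ} {b : D.Edge} {f : D.Gen → R}
    (hf : f ∈ D.cochains R fun g => g.hdeg = i ∧ g.label b = true ∧ g.qdeg = q) :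
    ∃ e ∈ D.cochains R fun g => g.hdeg = i ∧ g.qdeg = q + 2, mulX 0 b e = f := by
  refine ⟨fun g => if g.label b = true then 0 else f (setLabel g b true), ?_, ?_⟩
  · rw [mem_cochains] at hf ⊢
    intro g hg
    by_cases hb : g.label b = true
    · exact absurd (if_pos hb) hg
    · simp only [if_neg hb] at hg
      obtain ⟨h1, h2, h3⟩ := hf _ hg
      have h4 := qdeg_setLabel h2
      have hb' : g.label b = false := by simpa using hb
      rw [setLabel_setLabel, ← hb', setLabel_label, h3] at h4
      exact ⟨h1, h4⟩
  · ext g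
    by_cases hb : g.label b = true
    · have : setLabel (setLabel g b false) b true = g := by
        rw [setLabel_setLabel, ← hb, setLabel_label]
      simp [mulX, hb, label_setLabel, this]
    · have h1 : mulX 0 b (fun g => if g.label b = true then 0 else f (setLabel g b true)) g = 0 :=
        if_neg hb
      rw [h1]
      exact (hf g fun h => hb h.2.1).symm

end SignedGaussCode
end

noncomputable section
namespace SignedGaussCode

variable {D : SignedGaussCode}

/-! ### Bar-Natan homology over the field with two elements -/

/-- Labellings of the circles and compatible edge colourings correspond, so over a field the
injective evaluation is an endomorphism of a finite-dimensional space and hence onto. -/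
theorem exists_evalAt_eq {F : Type*} [Field F] {h : F} (hh : h ≠ 0)
    (G : D.Vertex → (D.Edge → Bool) → F) :
    ∃ f : D.Gen → F, ∀ v κ, Compatible v κ → evalAt h f v κ = G v κ := by
  let T : (D.Gen → F) →ₗ[F] (D.Gen → F) :=
    { toFun := fun f g => evalAt h f g.1 g.label
      map_add' := fun f f' => by ext g; exact evalAt_add h f f' _ _
      map_smul' := fun a f => by ext g; exact evalAt_smul h a f _ _ }
  have hlabel : ∀ v κ (hc : Compatible v κ), Gen.label (D := D) ⟨v, Quot.lift κ hc⟩ = κ :=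
    fun v κ hc => rfl
  have hT : Function.Injective T := by
    intro f f' hf
    refine eq_of_evalAt_eq hh fun v κ hc => ?_
    have := congrFun hf ⟨v, Quot.lift κ hc⟩
    exact this
  obtain ⟨f, hf⟩ := LinearMap.injective_iff_surjective.1 hT fun g => G g.1 g.label
  refine ⟨f, fun v κ hc => ?_⟩
  have := congrFun hf ⟨v, Quot.lift κ hc⟩
  exact this

/-- The homological degree of a vertex of the cube. -/
def vertexDegree (v : D.Vertex) : ℤ :=
  ((Finset.univ.filter fun k => v k = true).card : ℤ) - D.nMinus

theorem evalAt_eq_zero_of_vertexDegree_ne {R : Type*} [CommRing R] {h : R} {i : ℤ} {f : D.Gen → R}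
    (hf : f ∈ D.cochains R fun g => g.hdeg = i) {v : D.Vertex} (hv : vertexDegree v ≠ i)
    (κ : D.Edge → Bool) : evalAt h f v κ = 0 := by
  unfold evalAt
  split_ifs
  · refine Finset.sum_eq_zero fun l _ => ?_
    rw [hf ⟨v, l⟩ hv, zero_mul]
  · rfl

theorem exists_evalAt_eq_of_vertexDegree {F : Type*} [Field F] {h : F} (hh : h ≠ 0) {i : ℤ}
    (G : D.Vertex → (D.Edge → Bool) → F)
    (hG : ∀ v κ, Compatible v κ → vertexDegree v ≠ i → G v κ = 0) :
    ∃ f ∈ D.cochains F fun g => g.hdeg = i, ∀ v κ, Compatible v κ → evalAt h f v κ = G v κ := by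
  obtain ⟨f, hf⟩ := exists_evalAt_eq hh G
  have hmem : (fun g => if vertexDegree g.1 = i then f g else 0) ∈
      D.cochains F fun g => g.hdeg = i := fun g hg => if_neg hg
  refine ⟨_, hmem, fun v κ hc => ?_⟩
  by_cases hv : vertexDegree v = i
  · rw [← hf v κ hc, evalAt, evalAt, dif_pos hc, dif_pos hc]
    exact Finset.sum_congr rfl fun l _ => by rw [if_pos hv]
  · rw [evalAt_eq_zero_of_vertexDegree_ne hmem hv, hG v κ hc hv]

theorem IsAlternating.evalAt_differential_two {χ : D.Edge → Bool} (hχ : D.IsAlternating χ)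
    (f : D.Gen → ZMod 2) (w : D.Vertex) {κ : D.Edge → Bool} (hc : Compatible w κ) :
    evalAt 1 (D.differential 1 f) w κ =
      ∑ k, if w k = true then evalAt 1 f (Function.update w k false) κ else 0 := by
  have h1 : (-1 : ZMod 2) = 1 := by decide
  rw [hχ.evalAt_differential _ _ _ hc]
  refine Finset.sum_congr rfl fun k _ => ?_
  have h2 : edgeFactor (1 : ZMod 2) (Function.update w k false) k κ = 1 := by
    unfold edgeFactor
    rw [h1]
    simp
  rw [h1, one_pow, h2, one_mul, one_mul]

/-- The smoothing that respects the orientation of the knot. -/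
def orientedVertex (D : SignedGaussCode) : D.Vertex := fun k => !D.positive k

theorem vertexDegree_orientedVertex : vertexDegree D.orientedVertex = 0 := by
  unfold vertexDegree orientedVertex nMinus
  simp

theorem IsAlternating.not {χ : D.Edge → Bool} (hχ : D.IsAlternating χ) :
    D.IsAlternating fun e => !χ e := fun k => by
  obtain ⟨h1, h2, h3⟩ := hχ k
  simp [h1, h2, h3]

theorem IsAlternating.compatible_iff {χ : D.Edge → Bool} (hχ : D.IsAlternating χ) {v : D.Vertex} :
    Compatible v χ ↔ v = D.orientedVertex := by
  constructor
  · intro hc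
    ext k
    by_contra hk
    have hk : v k = D.positive k := by
      revert hk
      unfold orientedVertex
      cases v k <;> cases D.positive k <;> simp
    have h1 := hc _ _ (.unoriented₁ k hk)
    rw [(hχ k).2.2] at h1
    revert h1
    cases χ (D.overIn k) <;> simp
  · rintro rfl e f he
    cases he with
    | oriented₁ k h => rw [(hχ k).1, (hχ k).2.2]
    | oriented₂ k h => rw [(hχ k).2.1, (hχ k).2.2, Bool.not_not]
    | unoriented₁ k h => simp [orientedVertex] at h
    | unoriented₂ k h => simp [orientedVertex] at h

/-- An alternating colouring is compatible with the oriented smoothing only, so no edge of the cube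
contributes. -/
theorem IsAlternating.evalAt_differential_orientedVertex {χ : D.Edge → Bool}
    (hχ : D.IsAlternating χ) (f : D.Gen → ZMod 2) :
    evalAt 1 (D.differential 1 f) D.orientedVertex χ = 0 := by
  rw [hχ.evalAt_differential_two f _ (hχ.compatible_iff.2 rfl)]
  refine Finset.sum_eq_zero fun k _ => ?_
  split_ifs with hk
  · refine evalAt_of_not _ _ fun hc => ?_
    have := congrFun (hχ.compatible_iff.1 hc) k
    rw [Function.update_self, hk] at this
    exact absurd this (by simp)
  · rfl

/-- The cochain with values the delta function at the colouring `χ`, which lives at the oriented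
smoothing alone. -/
theorem IsAlternating.exists_cocycle {χ : D.Edge → Bool} (hχ : D.IsAlternating χ) :
    ∃ f ∈ D.cochains (ZMod 2) fun g => g.hdeg = 0, D.differential 1 f = 0 ∧
      evalAt 1 f D.orientedVertex χ = 1 ∧ evalAt 1 f D.orientedVertex (fun e => !χ e) = 0 := by
  classical
  obtain ⟨f, hf, h⟩ := exists_evalAt_eq_of_vertexDegree (D := D) (one_ne_zero (α := ZMod 2)) (i := 0)
    (fun _ κ => if κ = χ then 1 else 0) (fun v κ hc hv => by
      by_cases hκ : κ = χ
      · subst hκ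
        rw [hχ.compatible_iff] at hc
        exact absurd (hc ▸ vertexDegree_orientedVertex) hv
      · exact if_neg hκ)
  refine ⟨f, hf, ?_, ?_, ?_⟩
  · refine eq_of_evalAt_eq one_ne_zero fun w κ hc => ?_
    rw [evalAt_zero, hχ.evalAt_differential_two f w hc]
    refine Finset.sum_eq_zero fun k _ => ?_
    split_ifs with hk
    · by_cases hc' : Compatible (Function.update w k false) κ
      · rw [h _ _ hc', if_neg]
        rintro rfl
        have := (hχ.compatible_iff.1 hc').trans (hχ.compatible_iff.1 hc).symm
        have := congrFun this k
        rw [Function.update_self, hk] at this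
        exact absurd this (by simp)
      · exact evalAt_of_not _ _ hc'
    · rfl
  · rw [h _ _ (hχ.compatible_iff.2 rfl), if_pos rfl]
  · rw [h _ _ (hχ.not.compatible_iff.2 rfl), if_neg]
    intro h'
    have := congrFun h' ⟨0, by omega⟩
    simp at this

/-- All edges at a crossing have the same colour. -/
def IsMonochrome (κ : D.Edge → Bool) (k : Fin D.n) : Prop :=
  κ (D.underOut k) = κ (D.underIn k) ∧ κ (D.overIn k) = κ (D.underIn k) ∧
    κ (D.overOut k) = κ (D.underIn k)

theorem IsMonochrome.compatible_update {κ : D.Edge → Bool} {k : Fin D.n} (hk : IsMonochrome κ k)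
    {v w : D.Vertex} (hv : Compatible v κ) (hw : ∀ j, j ≠ k → w j = v j) : Compatible w κ := by
  obtain ⟨h1, h2, h3⟩ := hk
  intro e f he
  cases he with
  | oriented₁ j h =>
    by_cases hj : j = k
    · subst hj; rw [h3]
    · exact hv _ _ (.oriented₁ j (hw j hj ▸ h))
  | oriented₂ j h =>
    by_cases hj : j = k
    · subst hj; rw [h1, h2]
    · exact hv _ _ (.oriented₂ j (hw j hj ▸ h))
  | unoriented₁ j h =>
    by_cases hj : j = k
    · subst hj; rw [h2]
    · exact hv _ _ (.unoriented₁ j (hw j hj ▸ h))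
  | unoriented₂ j h =>
    by_cases hj : j = k
    · subst hj; rw [h1, h3]
    · exact hv _ _ (.unoriented₂ j (hw j hj ▸ h))

/-- If a crossing is not monochrome, its two arcs have different colours, and for either smoothing
the colour changes along both strands. So `κ` and `χ` differ by a constant. -/
theorem IsAlternating.of_not_isMonochrome {χ : D.Edge → Bool} (hχ : D.IsAlternating χ)
    {v : D.Vertex} {κ : D.Edge → Bool} (hv : Compatible v κ) (hκ : ∀ k, ¬ IsMonochrome κ k) :
    κ = χ ∨ κ = fun e => !χ e := by
  have h : ∀ k, κ (D.overOut k) = (!κ (D.overIn k)) ∧ κ (D.underOut k) = !κ (D.underIn k) := by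
    intro k
    have hk := hκ k
    unfold IsMonochrome at hk
    by_cases hp : v k = D.positive k
    · have h1 := hv _ _ (.unoriented₁ k hp)
      have h2 := hv _ _ (.unoriented₂ k hp)
      revert hk h1 h2
      cases κ (D.overOut k) <;> cases κ (D.overIn k) <;> cases κ (D.underOut k) <;>
        cases κ (D.underIn k) <;> simp
    · have hp : v k = !D.positive k := by
        revert hp; cases v k <;> cases D.positive k <;> simp
      have h1 := hv _ _ (.oriented₁ k hp)
      have h2 := hv _ _ (.oriented₂ k hp)
      revert hk h1 h2
      cases κ (D.overOut k) <;> cases κ (D.overIn k) <;> cases κ (D.underOut k) <;>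
        cases κ (D.underIn k) <;> simp
  have h := D.eq_of_comp_out (fun e => xor (κ e) (χ e)) fun k => by
    rw [(hχ k).1, (hχ k).2.1, (h k).1, (h k).2]
    simp
  let e0 : D.Edge := ⟨0, by omega⟩
  cases h0 : xor (κ e0) (χ e0)
  · left
    ext1 e
    have := (h e e0).trans h0
    revert this
    cases κ e <;> cases χ e <;> simp
  · right
    ext1 e
    have := (h e e0).trans h0
    revert this
    cases κ e <;> cases χ e <;> simp

theorem vertexDegree_update {v : D.Vertex} {k : Fin D.n} (hv : v k = false) :
    vertexDegree (Function.update v k true) = vertexDegree v + 1 := by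
  unfold vertexDegree
  rw [card_filter_update v k hv]
  push_cast
  ring

/-- A colouring other than `χ` and its negative, if compatible with some smoothing, has a monochrome
crossing. It stays compatible when that crossing is switched, so its part of the complex is
contractible in this direction. -/
theorem IsAlternating.exists_differential_eq {χ : D.Edge → Bool} (hχ : D.IsAlternating χ)
    {f : D.Gen → ZMod 2} (hf : f ∈ D.cochains (ZMod 2) fun g => g.hdeg = 0)
    (hdf : D.differential 1 f = 0) (h1 : evalAt 1 f D.orientedVertex χ = 0)
    (h2 : evalAt 1 f D.orientedVertex (fun e => !χ e) = 0) :
    ∃ f' ∈ D.cochains (ZMod 2) fun g => g.hdeg = -1, D.differential 1 f' = f := by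
  classical
  -- The contracting homotopy applied to `f`: read the value of `f` after switching one chosen
  -- monochrome crossing from `0` to `1`.
  let G : D.Vertex → (D.Edge → Bool) → ZMod 2 := fun v κ =>
    if hκ : ∃ k, IsMonochrome κ k then
      if v hκ.choose = false then evalAt 1 f (Function.update v hκ.choose true) κ else 0 else 0
  obtain ⟨f', hf', hG⟩ := exists_evalAt_eq_of_vertexDegree (one_ne_zero (α := ZMod 2)) (i := -1) G
    (fun v κ _ hv => by
      simp only [G]
      split_ifs with hκ hk
      · refine evalAt_eq_zero_of_vertexDegree_ne hf (fun h' => hv ?_) κ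
        rw [vertexDegree_update hk] at h'
        omega
      · rfl
      · rfl)
  refine ⟨f', hf', eq_of_evalAt_eq one_ne_zero fun v κ hc => ?_⟩
  by_cases hκ : ∃ k, IsMonochrome κ k
  swap
  · rcases hχ.of_not_isMonochrome hc (not_exists.1 hκ) with rfl | rfl
    · rw [hχ.compatible_iff.1 hc, hχ.evalAt_differential_orientedVertex, h1]
    · rw [hχ.not.compatible_iff.1 hc, hχ.not.evalAt_differential_orientedVertex, h2]
  obtain ⟨k, hk, hGk⟩ : ∃ k, IsMonochrome κ k ∧ ∀ v, G v κ =
      if v k = false then evalAt 1 f (Function.update v k true) κ else 0 :=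
    ⟨hκ.choose, hκ.choose_spec, fun v => dif_pos hκ⟩
  have hG' : ∀ w, evalAt 1 f' w κ =
      if w k = false then evalAt 1 f (Function.update w k true) κ else 0 := by
    intro w
    by_cases hw : Compatible w κ
    · rw [hG w κ hw, hGk]
    · rw [evalAt_of_not _ _ hw, evalAt_of_not, ite_self]
      exact fun hw' => hw (hk.compatible_update hw' fun j hj => by simp [hj])
  rw [hχ.evalAt_differential_two f' v hc]
  simp only [hG']
  cases hvk : v k
  · have hc' : Compatible (Function.update v k true) κ :=
      hk.compatible_update hc fun j hj => by simp [hj]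
    have h3 := hχ.evalAt_differential_two f _ hc'
    rw [hdf, evalAt_zero, ← Finset.add_sum_erase _ _ (Finset.mem_univ k),
      Function.update_self, if_pos rfl, Function.update_idem,
      show Function.update v k false = v by rw [← hvk, Function.update_eq_self]] at h3
    have h4 : ∀ x y : ZMod 2, 0 = x + y → y = x := by decide
    rw [← h4 _ _ h3, ← Finset.add_sum_erase _ _ (Finset.mem_univ k), hvk, if_neg (by simp), zero_add]
    refine Finset.sum_congr rfl fun j hj => ?_
    have hj : j ≠ k := Finset.ne_of_mem_erase hj
    rw [Function.update_of_ne hj, Function.update_of_ne hj.symm, hvk, if_pos rfl,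
      Function.update_comm hj]
  · rw [Finset.sum_eq_single k]
    · rw [if_pos hvk, Function.update_self, if_pos rfl, Function.update_idem, ← hvk,
        Function.update_eq_self]
    · intro j _ hj
      rw [Function.update_of_ne hj.symm, hvk]
      simp
    · exact fun h' => absurd (Finset.mem_univ _) h'

end SignedGaussCode
end

noncomputable section
namespace SignedGaussCode

variable {D : SignedGaussCode}

/-! ### The filtration of Bar-Natan homology -/

theorem mem_cocycles {R : Type*} [CommRing R] {h : R} {P : D.Gen → Prop} {i : ℤ} {f : D.Gen → R} :
    f ∈ D.cocycles h P i ↔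
      f ∈ D.cochains R (fun g => g.hdeg = i ∧ P g) ∧ D.differential h f = 0 :=
  Iff.rfl

theorem mem_cochains_and {R : Type*} [CommRing R] {P Q : D.Gen → Prop} {f : D.Gen → R}
    (hP : f ∈ D.cochains R P) (hQ : f ∈ D.cochains R Q) : f ∈ D.cochains R fun g => P g ∧ Q g :=
  mem_cochains.2 fun g hg => ⟨mem_cochains.1 hP g hg, mem_cochains.1 hQ g hg⟩

/-- The values of a Bar-Natan cochain at the oriented resolution for the two colourings of its
circles by a checkerboard colouring of the plane. -/
def orientedValues (χ : D.Edge → Bool) : (D.Gen → ZMod 2) →ₗ[ZMod 2] ZMod 2 × ZMod 2 where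
  toFun f := (evalAt 1 f D.orientedVertex χ, evalAt 1 f D.orientedVertex fun e => !χ e)
  map_add' f f' := by simp [evalAt_add]
  map_smul' r f := by simp [evalAt_smul]

theorem IsAlternating.orientedValues_differential {χ : D.Edge → Bool} (hχ : D.IsAlternating χ)
    (f : D.Gen → ZMod 2) : orientedValues χ (D.differential 1 f) = 0 :=
  Prod.ext (hχ.evalAt_differential_orientedVertex f) (hχ.not.evalAt_differential_orientedVertex f)

/-- The isomorphism from Bar-Natan homology to a vector space of dimension two. -/
def IsAlternating.valuesBN {χ : D.Edge → Bool} (hχ : D.IsAlternating χ) :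
    D.BN (ZMod 2) 0 →ₗ[ZMod 2] ZMod 2 × ZMod 2 :=
  Submodule.liftQ _ ((orientedValues χ).comp (Submodule.subtype _)) (by
    rintro ⟨z, hz⟩ ⟨f, -, hf⟩
    change orientedValues χ z = 0
    rw [← hχ.orientedValues_differential f]
    exact congrArg _ hf.symm)

theorem IsAlternating.valuesBN_injective {χ : D.Edge → Bool} (hχ : D.IsAlternating χ) :
    Function.Injective hχ.valuesBN := by
  rw [← LinearMap.ker_eq_bot, LinearMap.ker_eq_bot']
  intro y hy
  obtain ⟨⟨z, hz⟩, rfl⟩ := Submodule.Quotient.mk_surjective _ y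
  have hy' : orientedValues χ z = 0 := hy
  rw [Submodule.Quotient.mk_eq_zero]
  obtain ⟨f, hf, hdf⟩ := hχ.exists_differential_eq (cochains_mono (fun g hg => hg.1) hz.1) hz.2
    (congrArg Prod.fst hy') (congrArg Prod.snd hy')
  exact ⟨f, cochains_mono (fun g hg => ⟨by omega, trivial⟩) hf, hdf⟩

/-- The values of the cocycles in a step of the filtration. -/
def valueFiltration (χ : D.Edge → Bool) (q : ℤ) : Submodule (ZMod 2) (ZMod 2 × ZMod 2) :=
  (D.cocycles (1 : ZMod 2) (fun g => q ≤ g.qdeg) 0).map (orientedValues χ)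

theorem IsAlternating.map_inducedFiltration {χ : D.Edge → Bool} (hχ : D.IsAlternating χ) (q : ℤ) :
    (D.inducedFiltration (ZMod 2) 0 q).map hχ.valuesBN = valueFiltration χ q := by
  ext y
  constructor
  · rintro ⟨_, ⟨a, rfl⟩, rfl⟩
    obtain ⟨⟨z, hz⟩, rfl⟩ := Submodule.Quotient.mk_surjective _ a
    exact ⟨z, hz, rfl⟩
  · rintro ⟨z, hz, rfl⟩
    exact ⟨_, ⟨Submodule.Quotient.mk ⟨z, hz⟩, rfl⟩, rfl⟩

theorem eq_top_of_mem_of_mem {W : Submodule (ZMod 2) (ZMod 2 × ZMod 2)} (h1 : ((1, 0) : _ × _) ∈ W)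
    (h2 : ((0, 1) : _ × _) ∈ W) : W = ⊤ := by
  refine eq_top_iff.2 fun y _ => ?_
  have : y = y.1 • (1, 0) + y.2 • (0, 1) := by ext <;> simp
  rw [this]
  exact W.add_mem (W.smul_mem _ h1) (W.smul_mem _ h2)

theorem IsAlternating.exists_cocycle_values {χ : D.Edge → Bool} (hχ : D.IsAlternating χ) :
    ∃ z ∈ D.cochains (ZMod 2) fun g => g.hdeg = 0, D.differential 1 z = 0 ∧
      orientedValues χ z = (1, 0) := by
  obtain ⟨z, h1, h2, h3, h4⟩ := hχ.exists_cocycle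
  exact ⟨z, h1, h2, Prod.ext h3 h4⟩

theorem IsAlternating.exists_cocycle_values_not {χ : D.Edge → Bool} (hχ : D.IsAlternating χ) :
    ∃ z ∈ D.cochains (ZMod 2) fun g => g.hdeg = 0, D.differential 1 z = 0 ∧
      orientedValues χ z = (0, 1) := by
  obtain ⟨z, h1, h2, h3, h4⟩ := hχ.not.exists_cocycle
  refine ⟨z, h1, h2, Prod.ext ?_ h3⟩
  simp only [Bool.not_not] at h4
  exact h4

theorem IsAlternating.valueFiltration_eq_top {χ : D.Edge → Bool} (hχ : D.IsAlternating χ) {q : ℤ}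
    (hq : ∀ g : D.Gen, q ≤ g.qdeg) : valueFiltration χ q = ⊤ := by
  obtain ⟨z, h1, h2, h3⟩ := hχ.exists_cocycle_values
  obtain ⟨z', h1', h2', h3'⟩ := hχ.exists_cocycle_values_not
  exact eq_top_of_mem_of_mem ⟨z, ⟨cochains_mono (fun g hg => ⟨hg, hq g⟩) h1, h2⟩, h3⟩
    ⟨z', ⟨cochains_mono (fun g hg => ⟨hg, hq g⟩) h1', h2'⟩, h3'⟩

theorem IsAlternating.valuesBN_surjective {χ : D.Edge → Bool} (hχ : D.IsAlternating χ) :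
    LinearMap.range hχ.valuesBN = ⊤ := by
  obtain ⟨m, hm⟩ := (Set.finite_range (Gen.qdeg (D := D))).bddBelow
  rw [eq_top_iff, ← hχ.valueFiltration_eq_top fun g => hm ⟨g, rfl⟩, ← hχ.map_inducedFiltration]
  exact LinearMap.map_le_range

theorem IsAlternating.mem_nonzeroLevels {χ : D.Edge → Bool} (hχ : D.IsAlternating χ) {q : ℤ} :
    q ∈ D.nonzeroLevels (ZMod 2) ↔ Odd q ∧ valueFiltration χ q ≠ ⊥ := by
  have : D.inducedFiltration (ZMod 2) 0 q = ⊥ ↔ valueFiltration χ q = ⊥ := by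
    rw [← hχ.map_inducedFiltration]
    exact ⟨fun h => by rw [h, Submodule.map_bot], fun h =>
      Submodule.map_injective_of_injective hχ.valuesBN_injective (by rw [h, Submodule.map_bot])⟩
  exact and_congr_right fun _ => not_congr this

theorem IsAlternating.span_eq_top_iff {χ : D.Edge → Bool} (hχ : D.IsAlternating χ)
    (y y' : D.BN (ZMod 2) 0) : Submodule.span (ZMod 2) {y, y'} = ⊤ ↔
      Submodule.span (ZMod 2) {hχ.valuesBN y, hχ.valuesBN y'} = ⊤ := by
  rw [← Set.image_pair, ← Submodule.map_span]
  refine ⟨fun h => by rw [h, Submodule.map_top, hχ.valuesBN_surjective], fun h => ?_⟩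
  refine Submodule.map_injective_of_injective hχ.valuesBN_injective ?_
  rw [h, Submodule.map_top, hχ.valuesBN_surjective]

/-! ### Operations on filtered cocycles -/

theorem orientedValues_shift (χ : D.Edge → Bool) (f : D.Gen → ZMod 2) :
    orientedValues χ (shift 1 f) = (orientedValues χ f).swap := by
  have h1 : (-1 : ZMod 2) = 1 := by decide
  have h2 := fun κ => evalAt_shift (1 : ZMod 2) f D.orientedVertex κ
  rw [h1] at h2
  refine Prod.ext (h2 χ) ((h2 _).trans ?_)
  simp [orientedValues]

theorem orientedValues_mulX (χ : D.Edge → Bool) (b : D.Edge) (f : D.Gen → ZMod 2) :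
    orientedValues χ (mulX 1 b f) = if χ b then ((orientedValues χ f).1, 0) else
      (0, (orientedValues χ f).2) := by
  have h1 : orientedValues χ (mulX 1 b f) = ((if χ b then 1 else 0) * (orientedValues χ f).1,
      (if (!χ b) then 1 else 0) * (orientedValues χ f).2) :=
    Prod.ext (evalAt_mulX _ _ _ _ _) (evalAt_mulX _ _ _ _ _)
  rw [h1]
  cases χ b <;> simp

theorem IsAlternating.shift_mem_cocycles {χ : D.Edge → Bool} (hχ : D.IsAlternating χ) {i q : ℤ}
    {f : D.Gen → ZMod 2} (hf : f ∈ D.cocycles (1 : ZMod 2) (fun g => q ≤ g.qdeg) i) :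
    shift 1 f ∈ D.cocycles (1 : ZMod 2) (fun g => q ≤ g.qdeg) i := by
  classical
  rw [mem_cocycles] at hf ⊢
  have h1 : (-1 : ZMod 2) = 1 := by decide
  constructor
  · have hf1 := mem_cochains.1 hf.1
    rw [mem_cochains]
    intro g hg
    obtain ⟨l, -, hl⟩ := Finset.exists_ne_zero_of_sum_ne_zero hg
    obtain ⟨h3, h4⟩ := hf1 _ (right_ne_zero_of_mul hl)
    have h2 := left_ne_zero_of_mul hl
    rw [prod_shiftCoeff] at h2
    have hle : g.2 ≤ l := by
      by_contra hle
      exact h2 (if_neg hle)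
    have h5 : g.qdeg = Gen.qdeg (D := D) ⟨g.1, l⟩ + 2 * labelDist g.2 l := qdeg_of_le hle
    exact ⟨h3, by omega⟩
  · have h2 := hχ.differential_shift (one_ne_zero (α := ZMod 2)) f
    rw [h1, hf.2] at h2
    rw [h2]
    ext g
    simp [shift]

/-- Every term of the shift besides the identity turns at least one `x` into `1`, raising the degree
by at least 2. -/
theorem IsAlternating.shift_sub_mem_cocycles {χ : D.Edge → Bool} (hχ : D.IsAlternating χ) {i q : ℤ}
    {f : D.Gen → ZMod 2} (hf : f ∈ D.cocycles (1 : ZMod 2) (fun g => q ≤ g.qdeg) i) :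
    shift 1 f - f ∈ D.cocycles (1 : ZMod 2) (fun g => q + 2 ≤ g.qdeg) i := by
  classical
  have hd := Submodule.sub_mem _ (hχ.shift_mem_cocycles hf) hf
  rw [mem_cocycles] at hf hd ⊢
  refine ⟨?_, hd.2⟩
  have hf1 := mem_cochains.1 hf.1
  rw [mem_cochains]
  intro g hg
  refine ⟨(mem_cochains.1 hd.1 g hg).1, ?_⟩
  have h1 : f g = ∑ l : D.Circle g.1 → Bool, if g.2 = l then f ⟨g.1, l⟩ else 0 := by
    rw [Finset.sum_ite_eq, if_pos (Finset.mem_univ _)]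
  rw [Pi.sub_apply, h1, shift, ← Finset.sum_sub_distrib] at hg
  obtain ⟨l, -, hl⟩ := Finset.exists_ne_zero_of_sum_ne_zero hg
  rw [prod_shiftCoeff] at hl
  by_cases hle : g.2 ≤ l
  · have hne : g.2 ≠ l := by
      rintro rfl
      simp at hl
    have h3 : f ⟨g.1, l⟩ ≠ 0 := fun h3 => hl (by simp [h3])
    have h4 := (hf1 _ h3).2
    have h5 : g.qdeg = Gen.qdeg (D := D) ⟨g.1, l⟩ + 2 * labelDist g.2 l := qdeg_of_le hle
    have h6 : labelDist g.2 l ≠ 0 := fun h6 => hne (labelDist_eq_zero.1 h6)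
    omega
  · have hne : g.2 ≠ l := fun h => hle h.le
    exact absurd (by simp [hle, hne]) hl

theorem IsAlternating.mulX_mem_cocycles {χ : D.Edge → Bool} (hχ : D.IsAlternating χ) {i q : ℤ}
    (b : D.Edge) {f : D.Gen → ZMod 2}
    (hf : f ∈ D.cocycles (1 : ZMod 2) (fun g => q ≤ g.qdeg) i) :
    mulX 1 b f ∈ D.cocycles (1 : ZMod 2) (fun g => q - 2 ≤ g.qdeg) i := by
  rw [mem_cocycles] at hf ⊢
  have hf1 := mem_cochains.1 hf.1
  constructor
  · rw [mem_cochains]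
    intro g hg
    by_cases hb : g.label b = true
    · have h1 : mulX 1 b f g = f (setLabel g b false) + f g := by simp [mulX, hb]
      rw [h1] at hg
      by_cases h2 : f g = 0
      · rw [h2, add_zero] at hg
        have h3 := hf1 _ hg
        rw [qdeg_setLabel hb] at h3
        exact ⟨h3.1, by omega⟩
      · exact ⟨(hf1 g h2).1, by have := (hf1 g h2).2; omega⟩
    · exact absurd (by simp [mulX, hb]) hg
  · rw [hχ.differential_mulX one_ne_zero, hf.2, map_zero]

theorem valueFiltration_antitone (χ : D.Edge → Bool) : Antitone (valueFiltration χ) :=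
  fun _ _ hpq => Submodule.map_mono (D.cocycles_mono 1 (fun _ hg => hpq.trans hg) 0)

/-- For a cocycle with values `(1, 0)`, shift minus identity has values `(1, 1)` and lies two steps
higher. -/
theorem IsAlternating.valueFiltration_add_two_ne_bot {χ : D.Edge → Bool} (hχ : D.IsAlternating χ)
    {q : ℤ} (hq : valueFiltration χ q = ⊤) : valueFiltration χ (q + 2) ≠ ⊥ := by
  intro h
  obtain ⟨f, hf, hv⟩ : ((1, 0) : _ × _) ∈ valueFiltration χ q := by rw [hq]; trivial
  have h1 : orientedValues χ (shift 1 f - f) ∈ valueFiltration χ (q + 2) :=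
    ⟨_, hχ.shift_sub_mem_cocycles hf, rfl⟩
  rw [h, Submodule.mem_bot, map_sub, orientedValues_shift, hv] at h1
  exact absurd (congrArg Prod.snd h1) (by decide)

/-- If exactly one coordinate is nonzero, the shift supplies the other vector. For values `(1, 1)`,
multiplication by `x` isolates one coordinate at the cost of two degrees. -/
theorem IsAlternating.valueFiltration_sub_two_eq_top {χ : D.Edge → Bool} (hχ : D.IsAlternating χ)
    (b : D.Edge) {q : ℤ} (hq : valueFiltration χ q ≠ ⊥) : valueFiltration χ (q - 2) = ⊤ := by
  obtain ⟨y, ⟨f, hf, rfl⟩, hy⟩ := Submodule.exists_mem_ne_zero_of_ne_bot hq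
  have hle := valueFiltration_antitone χ (show q - 2 ≤ q by omega)
  have h1 : orientedValues χ f ∈ valueFiltration χ (q - 2) := hle ⟨f, hf, rfl⟩
  have h2 : (orientedValues χ f).swap ∈ valueFiltration χ (q - 2) :=
    hle ⟨_, hχ.shift_mem_cocycles hf, orientedValues_shift χ f⟩
  have h3 : (if χ b then ((orientedValues χ f).1, 0) else (0, (orientedValues χ f).2)) ∈
      valueFiltration χ (q - 2) := ⟨_, hχ.mulX_mem_cocycles b hf, orientedValues_mulX χ b f⟩
  have hcases : ∀ a : ZMod 2, a = 0 ∨ a = 1 := by decide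
  generalize orientedValues χ f = y at *
  obtain ⟨y1, y2⟩ := y
  rcases hcases y1 with rfl | rfl <;> rcases hcases y2 with rfl | rfl
  · exact absurd rfl hy
  · exact eq_top_of_mem_of_mem h2 h1
  · exact eq_top_of_mem_of_mem h1 h2
  · have h4 := Submodule.sub_mem _ h1 h3
    cases hb : χ b
    · simp only [hb] at h3 h4
      exact eq_top_of_mem_of_mem (by simpa using h4) (by simpa using h3)
    · simp only [hb] at h3 h4
      exact eq_top_of_mem_of_mem (by simpa using h3) (by simpa using h4)

theorem IsAlternating.isGreatest_nonzeroLevels {χ : D.Edge → Bool} (hχ : D.IsAlternating χ) :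
    IsGreatest (D.nonzeroLevels (ZMod 2)) (sSup (D.nonzeroLevels (ZMod 2))) := by
  obtain ⟨m, hm⟩ := (Set.finite_range (Gen.qdeg (D := D))).bddBelow
  obtain ⟨M, hM⟩ := (Set.finite_range (Gen.qdeg (D := D))).bddAbove
  have hne : (D.nonzeroLevels (ZMod 2)).Nonempty := by
    -- An odd integer below all quantum degrees, where the filtration step is the whole complex.
    refine ⟨2 * (-|m|) - 1, hχ.mem_nonzeroLevels.2 ⟨⟨-|m| - 1, by ring⟩, ?_⟩⟩
    rw [hχ.valueFiltration_eq_top]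
    · exact top_ne_bot
    · intro g
      have h1 : m ≤ g.qdeg := hm ⟨g, rfl⟩
      have h2 := neg_abs_le m
      have h3 := abs_nonneg m
      omega
  have hbdd : BddAbove (D.nonzeroLevels (ZMod 2)) := by
    refine ⟨M, fun q hq => ?_⟩
    obtain ⟨y, ⟨f, hf, rfl⟩, hy⟩ :=
      Submodule.exists_mem_ne_zero_of_ne_bot (hχ.mem_nonzeroLevels.1 hq).2
    have hf0 : f ≠ 0 := fun h => hy (by rw [h, map_zero])
    obtain ⟨g, hg⟩ := Function.ne_iff.1 hf0
    exact (mem_cochains.1 hf.1 g hg).2.trans (hM ⟨g, rfl⟩)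
  exact ⟨Int.csSup_mem hne hbdd, fun q hq => le_csSup hbdd hq⟩

end SignedGaussCode
end

noncomputable section
namespace SignedGaussCode

variable {D : SignedGaussCode}

/-! ### Reduction modulo two -/

theorem map_edgeCoeff {R S : Type*} [CommRing R] [CommRing S] (φ : R →+* S) (h : R) (k : Fin D.n)
    (g g' : D.Gen) : φ (D.edgeCoeff h k g g') = D.edgeCoeff (φ h) k g g' := by
  have h1 : ∀ a b c, φ (frobeniusMul h a b c) = frobeniusMul (φ h) a b c := by
    intro a b c
    cases a <;> cases b <;> cases c <;> simp [frobeniusMul]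
  have h2 : ∀ a b c, φ (frobeniusComul h a b c) = frobeniusComul (φ h) a b c := by
    intro a b c
    cases a <;> cases b <;> cases c <;> simp [frobeniusComul]
  unfold edgeCoeff
  split_ifs <;> simp [h1, h2]

theorem map_differential {R S : Type*} [CommRing R] [CommRing S] (φ : R →+* S) (h : R)
    (f : D.Gen → R) : D.differential (φ h) (φ ∘ f) = φ ∘ D.differential h f := by
  ext g'
  simp [differential_apply, map_edgeCoeff]

/-- Reduction of an integral cochain modulo two. -/
def modTwo (f : D.Gen → ℤ) : D.Gen → ZMod 2 := Int.castRingHom (ZMod 2) ∘ f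

theorem modTwo_add (f f' : D.Gen → ℤ) : modTwo (f + f') = modTwo f + modTwo f' := by
  ext g
  simp [modTwo]

theorem differential_zero_modTwo (f : D.Gen → ℤ) :
    D.differential 0 (modTwo f) = modTwo (D.differential 0 f) := by
  have := map_differential (Int.castRingHom (ZMod 2)) 0 f
  rwa [map_zero] at this

theorem differentialOne_modTwo (f : D.Gen → ℤ) :
    D.differentialOne (ZMod 2) (modTwo f) = modTwo (D.differentialOne ℤ f) := by
  have h1 := map_differential (Int.castRingHom (ZMod 2)) 1 f
  rw [map_one] at h1
  have h2 := differential_zero_modTwo f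
  ext g
  have h3 := congrFun h1 g
  have h4 := congrFun h2 g
  simp only [differentialOne, LinearMap.sub_apply, Pi.sub_apply]
  rw [h4]
  change D.differential 1 (modTwo f) g - _ = _
  rw [show D.differential 1 (modTwo f) g = _ from h3]
  simp [modTwo]

theorem modTwo_mem {P : D.Gen → Prop} {f : D.Gen → ℤ} (hf : f ∈ D.cochains ℤ P) :
    modTwo f ∈ D.cochains (ZMod 2) P := fun g hg => by
  simp [modTwo, hf g hg]

/-! ### Absence of two-torsion -/

theorem NoTwoTorsion.exists_differential_eq {b : D.Edge} {i q : ℤ} (H : D.NoTwoTorsion b i (q + 1))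
    {f e : D.Gen → ℤ} (hf : f ∈ D.cochains ℤ fun g => g.hdeg = i ∧ g.label b = true ∧ g.qdeg = q)
    (hdf : D.differential 0 f = 0)
    (he : e ∈ D.cochains ℤ fun g => g.hdeg = i - 1 ∧ g.label b = true ∧ g.qdeg = q)
    (hde : D.differential 0 e = (2 : ℤ) • f) :
    ∃ e' ∈ D.cochains ℤ fun g => g.hdeg = i - 1 ∧ g.label b = true ∧ g.qdeg = q,
      D.differential 0 e' = f := by
  have hz : f ∈ D.cocycles (0 : ℤ) (fun g => g.label b = true ∧ g.qdeg + 1 = q + 1) i :=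
    ⟨cochains_mono (fun g hg => ⟨hg.1, hg.2.1, by omega⟩) hf, hdf⟩
  have h1 := H (Submodule.Quotient.mk ⟨f, hz⟩) (by
    rw [← Submodule.Quotient.mk_smul, Submodule.Quotient.mk_eq_zero]
    exact ⟨e, cochains_mono (fun g hg => ⟨hg.1, hg.2.1, by omega⟩) he, hde⟩)
  rw [Submodule.Quotient.mk_eq_zero] at h1
  obtain ⟨e', he', hde'⟩ := h1
  exact ⟨e', cochains_mono (fun g hg => ⟨hg.1, hg.2.1, by omega⟩) he', hde'⟩

/-- Without two-torsion in reduced homology, an integral cocycle `w` with `2 * w` a coboundary is,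
up to the terms of degree zero, a Bar-Natan coboundary. -/
theorem IsAlternating.exists_eq_add_of_differential_eq_two_smul {χ : D.Edge → Bool}
    (hχ : D.IsAlternating χ) {b : D.Edge} {i q : ℤ} (H1 : D.NoTwoTorsion b i (q + 1))
    (H2 : D.NoTwoTorsion b i (q - 1)) {c w : D.Gen → ℤ}
    (hc : c ∈ D.cochains ℤ fun g => g.hdeg = i - 1 ∧ g.qdeg = q)
    (hw : w ∈ D.cochains ℤ fun g => g.hdeg = i ∧ g.qdeg = q)
    (hcw : D.differential 0 c = (2 : ℤ) • w) :
    ∃ t ∈ D.cochains ℤ fun g => g.hdeg = i - 1 ∧ g.qdeg = q,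
      ∃ m ∈ D.cochains ℤ fun g => g.hdeg = i - 1 ∧ g.qdeg = q - 2,
        D.differential 0 m = 0 ∧ w = D.differential 0 t + D.differentialOne ℤ m := by
  have htwo : ∀ f : D.Gen → ℤ, (2 : ℤ) • f = 0 → f = 0 := fun f hf =>
    (smul_eq_zero.1 hf).resolve_left two_ne_zero
  have hdw : D.differential 0 w = 0 := htwo _ (by
    rw [← map_smul, ← hcw, hχ.differential_zero_differential_zero])
  -- Twice `x w` is the coboundary of `x c` in the reduced complex. Its generators have degree `q -
  -- 2`, which is reduced degree `q - 1`.
  obtain ⟨y, hy, hdy⟩ := NoTwoTorsion.exists_differential_eq (q := q - 2)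
    (by rwa [show q - 2 + 1 = q - 1 by ring])
    (mulX_zero_mem hw) (by rw [hχ.differential_zero_mulX, hdw, map_zero]) (mulX_zero_mem hc)
    (by rw [hχ.differential_zero_mulX, hcw, map_smul])
  obtain ⟨e, he, rfl⟩ := exists_mulX_zero_eq hy
  rw [show q - 2 + 2 = q by ring] at he
  -- Subtracting the coboundary of `e`, and `2 * e` from `c`, preserves the relation and makes `x
  -- w'` vanish, so `w'` is a reduced cochain.
  obtain ⟨w', hw'⟩ : ∃ w', w' = w - D.differential 0 e := ⟨_, rfl⟩
  obtain ⟨c', hc'⟩ : ∃ c', c' = c - (2 : ℤ) • e := ⟨_, rfl⟩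
  have hc'mem : c' ∈ D.cochains ℤ fun g => g.hdeg = i - 1 ∧ g.qdeg = q := by
    rw [hc']
    exact Submodule.sub_mem _ hc (Submodule.smul_mem _ _ he)
  have hw'mem : w' ∈ D.cochains ℤ fun g => g.hdeg = i ∧ g.qdeg = q := by
    rw [hw']
    have := hχ.differential_zero_mem he
    rw [sub_add_cancel] at this
    exact Submodule.sub_mem _ hw this
  have hcw' : D.differential 0 c' = (2 : ℤ) • w' := by
    rw [hc', hw', map_sub, map_smul, hcw, smul_sub]
  have hxw' : mulX 0 b w' = 0 := by
    rw [hw', map_sub, ← hdy, hχ.differential_zero_mulX, sub_self]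
  have hmmem := mulX_zero_mem (b := b) hc'mem
  have hdm : D.differential 0 (mulX 0 b c') = 0 := by
    rw [hχ.differential_zero_mulX, hcw', map_smul, hxw', smul_zero]
  -- Both commutation relations for `derivX` are applied to the cocycle `x c'`, which will be `m`.
  have hdmX := hχ.differential_zero_derivX (mulX 0 b c')
  rw [hdm, map_zero, zero_add, derivX_mulX, map_sub, map_add, hcw'] at hdmX
  have hkey : D.differential 0 ((2 : ℤ) • projX b c' - mulX 0 b (derivX c')) =
      (2 : ℤ) • (w' - D.differentialOne ℤ (mulX 0 b c')) := by
    rw [smul_sub, ← hdmX, map_sub]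
    abel
  have h1 : D.differentialOne ℤ (mulX 0 b c') ∈ D.cochains ℤ fun g => g.hdeg = i ∧ g.qdeg = q := by
    have := hχ.differentialOne_mem (cochains_mono (fun g hg => ⟨hg.1, hg.2.2⟩) hmmem)
    rwa [sub_add_cancel, sub_add_cancel] at this
  have h2 : D.differentialOne ℤ (mulX 0 b c') ∈ D.cochains ℤ fun g => g.label b = true :=
    hχ.differentialOne_mem_label (cochains_mono (fun g hg => hg.2.1) hmmem)
  have h3 : w' - D.differentialOne ℤ (mulX 0 b c') ∈
      D.cochains ℤ fun g => g.hdeg = i ∧ g.label b = true ∧ g.qdeg = q :=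
    cochains_mono (fun g hg => ⟨hg.1.1, hg.2, hg.1.2⟩) (mem_cochains_and
      (Submodule.sub_mem _ hw'mem h1) (Submodule.sub_mem _ (mulX_zero_eq_zero_iff.1 hxw') h2))
  have h4 := mulX_zero_mem (b := b) (derivX_mem hc'mem)
  rw [show q + 2 - 2 = q by ring] at h4
  -- Both sides of `hkey` are in the reduced complex in unreduced degree `q`, so torsion in reduced
  -- degree `q + 1` is what matters.
  obtain ⟨f, hf, hdf⟩ := H1.exists_differential_eq h3
    (htwo _ (by rw [← map_smul, ← hkey, hχ.differential_zero_differential_zero]))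
    (Submodule.sub_mem _ (Submodule.smul_mem _ (2 : ℤ) (projX_mem hc'mem)) h4) hkey
  refine ⟨e + f, Submodule.add_mem _ he (cochains_mono (fun g hg => ⟨hg.1, hg.2.2⟩) hf),
    mulX 0 b c', cochains_mono (fun g hg => ⟨hg.1, hg.2.2⟩) hmmem, hdm, ?_⟩
  rw [map_add, hdf, hw']
  abel

/-! ### The refinement by the first Steenrod square -/

/-- The leading part is `d₀ T + d₁ m` modulo 2, with `d₀ m = 0`. The Bar-Natan coboundary of `T + m`
has precisely this part in degree `q` and otherwise only terms in degree `q + 2`; subtracting it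
keeps the class and raises the filtration. -/
theorem IsAlternating.exists_cocycle_of_leadingPartInSqOne {χ : D.Edge → Bool}
    (hχ : D.IsAlternating χ) {b : D.Edge} {q : ℤ} (hq : Odd q) (H1 : D.NoTwoTorsion b 0 (q + 1))
    (H2 : D.NoTwoTorsion b 0 (q - 1)) {a : D.FilteredBN (ZMod 2) 0 q}
    (ha : D.LeadingPartInSqOne q a) :
    hχ.valuesBN (D.toBN (ZMod 2) 0 q a) ∈ valueFiltration χ (q + 2) := by
  obtain ⟨-, y, ⟨z, l, rfl, hl, hlz⟩, -, u, c, w, -, hu, hc, hw, hcw, -, hwu⟩ := ha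
  rw [← hu, Submodule.Quotient.eq] at hl
  obtain ⟨g₀, hg₀, hdg₀⟩ := hl
  obtain ⟨t, ht, m, hm, hdm, hwt⟩ := hχ.exists_eq_add_of_differential_eq_two_smul H1 H2 hc hw hcw
  have hl' : l.1 = D.differential 0 (modTwo t + g₀) + D.differentialOne (ZMod 2) (modTwo m) := by
    have h1 : l.1 - u.1 = D.differential 0 g₀ := hdg₀.symm
    have h2 : u.1 = modTwo w := funext fun g => (hwu g).symm
    rw [h2, hwt, modTwo_add, ← differential_zero_modTwo, ← differentialOne_modTwo,
      sub_eq_iff_eq_add] at h1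
    rw [h1, map_add]
    abel
  obtain ⟨T, hT⟩ : ∃ T, T = modTwo t + g₀ := ⟨_, rfl⟩
  have hTmem : T ∈ D.cochains (ZMod 2) fun g => g.hdeg = 0 - 1 ∧ g.qdeg = q :=
    hT ▸ Submodule.add_mem _ (modTwo_mem ht) hg₀
  have hTz := hχ.differential_zero_mem hTmem
  have hTo := hχ.differentialOne_mem hTmem
  have hmo := hχ.differentialOne_mem (modTwo_mem hm)
  have hm1 : D.differential 1 (modTwo m) = D.differentialOne (ZMod 2) (modTwo m) := by
    rw [differential_eq 1, differential_zero_modTwo, hdm, one_smul]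
    ext g
    simp [modTwo]
  have hT1 : D.differential 1 T = D.differential 0 T + D.differentialOne (ZMod 2) T := by
    rw [differential_eq 1, one_smul]
  rw [sub_add_cancel] at hTz hTo hmo
  rw [sub_add_cancel] at hmo
  rw [← hT] at hl'
  have hz := mem_cocycles.1 z.2
  refine ⟨z.1 - D.differential 1 (T + modTwo m), mem_cocycles.2 ⟨?_, ?_⟩, ?_⟩
  · have h1 : z.1 - D.differential 1 (T + modTwo m) ∈
        D.cochains (ZMod 2) fun g => g.hdeg = 0 ∧ q ≤ g.qdeg := by
      rw [map_add, hT1, hm1]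
      refine Submodule.sub_mem _ hz.1 (Submodule.add_mem _ (Submodule.add_mem _
        (cochains_mono (fun g hg => ⟨hg.1, hg.2.ge⟩) hTz)
        (cochains_mono (fun g hg => ⟨hg.1, by omega⟩) hTo))
        (cochains_mono (fun g hg => ⟨hg.1, hg.2.ge⟩) hmo))
    rw [mem_cochains] at h1 ⊢
    intro g hg
    obtain ⟨h2, h3⟩ := h1 g hg
    refine ⟨h2, ?_⟩
    have hne : g.qdeg ≠ q := by
      intro hgq
      refine hg ?_
      have h4 : D.differentialOne (ZMod 2) T g = 0 := hTo g fun h => by omega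
      have h5 := congrFun hl' g
      rw [hlz g hgq] at h5
      rw [map_add, hT1, hm1]
      simp only [Pi.sub_apply, Pi.add_apply] at h5 ⊢
      rw [h5, h4]
      ring
    -- All quantum degrees are odd, so a degree above `q` is at least `q + 2`.
    obtain ⟨r, hr⟩ := hq
    obtain ⟨r', hr'⟩ := hχ.odd_qdeg g
    omega
  · rw [map_sub, hz.2, hχ.differential_differential one_ne_zero, sub_zero]
  · rw [map_sub, hχ.orientedValues_differential, sub_zero]
    rfl

/-- A vanishing leading part is Sq¹ of zero. -/
theorem leadingPartInSqOne_of_add_two_le {q : ℤ} (z : D.cocycles (1 : ZMod 2)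
    (fun g => q ≤ g.qdeg) 0) (hz : ∀ g : D.Gen, g.qdeg = q → z.1 g = 0) :
    D.LeadingPartInSqOne q (Submodule.Quotient.mk z) :=
  ⟨Submodule.Quotient.mk 0, Submodule.Quotient.mk 0,
    ⟨z, 0, rfl, rfl, fun g hg => (hz g hg).symm⟩,
    0, 0, 0, 0, rfl, rfl, Submodule.zero_mem _, Submodule.zero_mem _, by simp, by simp, by simp⟩

theorem IsAlternating.mem_sqOneFullLevels {χ : D.Edge → Bool} (hχ : D.IsAlternating χ) {q : ℤ}
    (hq : Odd q) (h : valueFiltration χ (q + 2) = ⊤) : q ∈ D.sqOneFullLevels := by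
  have H : ∀ y : ZMod 2 × ZMod 2, ∃ a : D.FilteredBN (ZMod 2) 0 q, D.LeadingPartInSqOne q a ∧
      hχ.valuesBN (D.toBN (ZMod 2) 0 q a) = y := by
    intro y
    obtain ⟨z, hz, rfl⟩ : y ∈ valueFiltration χ (q + 2) := by rw [h]; trivial
    have hz' := D.cocycles_mono (1 : ZMod 2) (fun g (hg : q + 2 ≤ g.qdeg) =>
      (show q ≤ g.qdeg by omega)) 0 hz
    exact ⟨Submodule.Quotient.mk ⟨z, hz'⟩, leadingPartInSqOne_of_add_two_le _ fun g hg =>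
      (mem_cocycles.1 hz).1 g fun h => by omega, rfl⟩
  obtain ⟨a, ha, ha'⟩ := H (1, 0)
  obtain ⟨b, hb, hb'⟩ := H (0, 1)
  refine ⟨hq, a, b, ha, hb, ?_⟩
  rw [hχ.span_eq_top_iff, ha', hb']
  exact eq_top_of_mem_of_mem (Submodule.subset_span (by simp)) (Submodule.subset_span (by simp))

theorem IsAlternating.valueFiltration_eq_top_of_span {χ : D.Edge → Bool} (hχ : D.IsAlternating χ)
    {q : ℤ} {y y' : D.BN (ZMod 2) 0} (h : Submodule.span (ZMod 2) {y, y'} = ⊤)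
    (hy : hχ.valuesBN y ∈ valueFiltration χ q) (hy' : hχ.valuesBN y' ∈ valueFiltration χ q) :
    valueFiltration χ q = ⊤ := by
  rw [eq_top_iff, ← (hχ.span_eq_top_iff y y').1 h, Submodule.span_le]
  rintro _ (rfl | rfl)
  exacts [hy, hy']

/-- With `S = s + 1` the top nonzero level, the filtration is everything at `S - 2`, so `S - 4` is
full by means of vanishing leading parts. A full `q` gives everything at `q`, hence something
nonzero at `q + 2`. -/
theorem IsAlternating.isGreatest_sqOneFullLevels {χ : D.Edge → Bool} (hχ : D.IsAlternating χ)
    (b : D.Edge) :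
    IsGreatest D.sqOneFullLevels (sSup D.sqOneFullLevels) ∧
      sSup (D.nonzeroLevels (ZMod 2)) - 4 ∈ D.sqOneFullLevels ∧
      ∀ q ∈ D.sqOneFullLevels, q + 2 ≤ sSup (D.nonzeroLevels (ZMod 2)) := by
  obtain ⟨hmem, hle⟩ := hχ.isGreatest_nonzeroLevels
  obtain ⟨hodd, hne⟩ := hχ.mem_nonzeroLevels.1 hmem
  have h1 : sSup (D.nonzeroLevels (ZMod 2)) - 4 ∈ D.sqOneFullLevels := by
    refine hχ.mem_sqOneFullLevels (hodd.sub_even (by decide)) ?_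
    rw [show sSup (D.nonzeroLevels (ZMod 2)) - 4 + 2 = sSup (D.nonzeroLevels (ZMod 2)) - 2 by ring]
    exact hχ.valueFiltration_sub_two_eq_top b hne
  have h2 : ∀ q ∈ D.sqOneFullLevels, q + 2 ≤ sSup (D.nonzeroLevels (ZMod 2)) := by
    rintro q ⟨hq, a, a', -, -, hspan⟩
    refine hle (hχ.mem_nonzeroLevels.2 ⟨hq.add_even (by decide),
      hχ.valueFiltration_add_two_ne_bot (hχ.valueFiltration_eq_top_of_span hspan ?_ ?_)⟩) <;>
    · rw [← hχ.map_inducedFiltration]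
      exact ⟨_, ⟨_, rfl⟩, rfl⟩
  have hbdd : BddAbove D.sqOneFullLevels :=
    ⟨sSup (D.nonzeroLevels (ZMod 2)) - 2, fun q hq => by have := h2 q hq; omega⟩
  exact ⟨⟨Int.csSup_mem ⟨_, h1⟩ hbdd, fun q hq => le_csSup hbdd hq⟩, h1, h2⟩

/-- Only the levels `s - 3` and `s - 1` can be the greatest full one. If `s - 1` were full, its two
generators would come from filtration `s + 1`, making level `s + 3` nonzero. -/
theorem IsAlternating.sqOneRefinement_eq {χ : D.Edge → Bool} (hχ : D.IsAlternating χ) (b : D.Edge)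
    (H1 : D.NoTwoTorsion b 0 (D.rasmussenInvariant (ZMod 2)))
    (H2 : D.NoTwoTorsion b 0 (D.rasmussenInvariant (ZMod 2) - 2)) :
    D.sqOneRefinement = D.rasmussenInvariant (ZMod 2) := by
  obtain ⟨⟨hmem, hle⟩, h4, h2⟩ := hχ.isGreatest_sqOneFullLevels b
  obtain ⟨hmem', hle'⟩ := hχ.isGreatest_nonzeroLevels
  unfold sqOneRefinement
  unfold rasmussenInvariant at H1 H2 ⊢
  generalize sSup D.sqOneFullLevels = q at *
  generalize sSup (D.nonzeroLevels (ZMod 2)) = s at *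
  have h5 := h2 q hmem
  have h6 := hle h4
  obtain ⟨hq, a, a', ha, ha', hspan⟩ := hmem
  have hne : q ≠ s - 2 := by
    rintro rfl
    rw [show s - 1 = s - 2 + 1 by ring] at H1
    rw [show s - 1 - 2 = s - 2 - 1 by ring] at H2
    have htop := hχ.valueFiltration_eq_top_of_span hspan
      (hχ.exists_cocycle_of_leadingPartInSqOne hq H1 H2 ha)
      (hχ.exists_cocycle_of_leadingPartInSqOne hq H1 H2 ha')
    have := hle' (hχ.mem_nonzeroLevels.2 ⟨(hq.add_even (by decide)).add_even (by decide),
      hχ.valueFiltration_add_two_ne_bot htop⟩)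
    omega
  obtain ⟨r, hr⟩ := hq
  obtain ⟨r', hr'⟩ := hmem'.1
  omega

theorem IsThinInDegrees.noTwoTorsion {b : D.Edge} {m : ℕ} {k l : ℤ}
    (h : D.IsThinInDegrees b m k l) {i : ℤ} (hk : k ≤ i) (hl : i ≤ l) (q : ℤ) :
    D.NoTwoTorsion b i q :=
  fun y hy => (h.2 i q hk hl 2 y hy).resolve_left two_ne_zero

end SignedGaussCode

end

/-! ### The theorem for planar diagrams -/

theorem mainTheorem11 (D : SignedGaussCode) (hD : D.IsPlanar) (b : D.Edge) :
    IsGreatest (D.nonzeroLevels (ZMod 2)) (D.rasmussenInvariant (ZMod 2) + 1) ∧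
    IsGreatest D.sqOneFullLevels (D.sqOneRefinement - 3) ∧
    (D.NoTwoTorsion b 0 (D.rasmussenInvariant (ZMod 2)) →
      D.NoTwoTorsion b 0 (D.rasmussenInvariant (ZMod 2) - 2) →
      D.sqOneRefinement = D.rasmussenInvariant (ZMod 2)) ∧
    (∀ c : ℕ, D.IsThinInDegrees b 1 (-c) c →
      D.sqOneRefinement = D.rasmussenInvariant (ZMod 2)) := by
  obtain ⟨χ, hχ⟩ : ∃ χ, D.IsAlternating χ := D.exists_alternating hD
  refine ⟨?_, ?_, hχ.sqOneRefinement_eq b, fun c hc => ?_⟩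
  · rw [SignedGaussCode.rasmussenInvariant, sub_add_cancel]
    exact hχ.isGreatest_nonzeroLevels
  · rw [SignedGaussCode.sqOneRefinement, add_sub_cancel_right]
    exact (hχ.isGreatest_sqOneFullLevels b).1
  -- Degree 0 lies between `-c` and `c`, so torsion-freeness there supplies both hypotheses.
  · exact hχ.sqOneRefinement_eq b (hc.noTwoTorsion (by simp) (by simp) _)
      (hc.noTwoTorsion (by simp) (by simp) _)
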